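/- Let $G$ and $H$ be locally compact, $\sigma$-compact Hausdorff abelian groups with Haar measures $m_G,m_H$. Let $(G,H,\widetilde L)$ be a cut and project scheme: $\widetilde L$ is a discrete cocompact subgroup of $G\times H$, the projection $G\times H\to G$ is injective on $\widetilde L$, and the projection of $\widetilde L$ to $H$ is dense; elements of $\widetilde L$ are written $(l,l^\star)$. Put $\mathbb T=(G\times H)/\widetilde L$, and let $Z\subset G\times H$ be a measurable set of representatives for $\mathbb T$. Let $\rho\neq 0$ be an $\widetilde L$-invariant complex Radon measure on $G\times H$, and let $\rho_{\mathbb T}$ be the (unique) complex Radon measure on $\mathbb T$ with $$\int_{G\times H} g\,d\rho=\int_{\mathbb T}\sum_{(l,l^\star)\in\widetilde L}g(s+l,h+l^\star)\,d\rho_{\mathbb T}([s,h])\qquad (g\in C_c(G\times H)).$$ Let $f:H\to\mathbb C$ be continuous and admissible, i.e. for all $\varepsilon>0$ and $\varphi\in C_c(G)$ there is a compact $Q\subset H$ with $\int_{G\times H}|\varphi(t+s)f(h+k)|\,(1-1_Q(h+k))\,d|\rho|(t,h)\le\varepsilon$ for all $(s,k)\in G\times H$. Let $\nu_f$ be the measure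 $\nu_f(\varphi)=\int\varphi(t)f(h)\,d\rho(t,h)$, $\varphi \in C_c(G)$, on $G$. For a complex Radon measure $\omega$ on $G$ put $(\alpha_t\omega)(\varphi)=\omega(\varphi(\cdot+t))$ and $\widetilde\omega(\varphi)=\overline{\omega(\overline{\varphi(-\cdot)})}$, and let $\Omega(\nu_f)$ be the closure of $\{\alpha_t\nu_f:t\in G\}$ in the vague topology. Put $\widetilde f(h)=\overline{f(-h)}$. Then $f$ is integrable with respect to $m_H$, so that $(f*\widetilde f)(h)$ exists for almost every $h\in H$. For $\varphi\in C_c(G)$ and $\xi=[s,h]\in\mathbb T$ put $$\gamma_\xi(\varphi)=\frac1{(m_G\times m_H)(Z)}\sum_{(l,l^\star)\in\widetilde L}(f*\widetilde f)(h-l^\star)\,\varphi(s-l)$$ whenever this exists (it does not depend on the representative $(s,h)$ of $\xi$). For every $\varphi\in C_c(G)$, $\gamma_{\xi-\eta}(\varphi)$ exists for $|\rho_{\mathbb T}|\times|\rho_{\mathbb T}|$-almost every $(\xi,\eta)$ and is integrable in $(\xi,\eta)$ with respect to $|\rho_{\mathbb T}|\times|\rho_{\mathbb T}|$. There is exactly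 one $\alpha$-invariant regular Borel probability measure $m$ on $\Omega(\nu_f)$, and the autocorrelation of $\nu_f$, defined by $$\gamma(\varphi)=\int_{\Omega(\nu_f)}\int_G\int_G\varphi(s+t)\psi(t)\,d\omega(s)\,d\widetilde\omega(t)\,dm(\omega)$$ for any $\psi\in C_c(G)$ with $\int\psi\,dm_G=1$, satisfies, independently of $\psi$, $$\gamma(\varphi)=\int_{\mathbb T}\int_{\mathbb T}\gamma_{\xi-\eta}(\varphi)\,d\rho_{\mathbb T}(\xi)\,d\overline{\rho_{\mathbb T}}(\eta)\qquad(\varphi\in C_c(G)).$$ If $\rho=\delta_{\widetilde L}=\sum_{x\in\widetilde L}\delta_x$, then $f$ is square integrable, $(f*\widetilde f)(h)$ exists for every $h\in H$, $\gamma_0(\varphi)$ exists for every $\varphi\in C_c(G)$, and $$\gamma=\gamma_0=\frac1{(m_G\times m_H)(Z)}\sum_{(l,l^\star)\in\widetilde L}(f*\widetilde f)(-l^\star)\,\delta_{-l}.$$ -/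

import Mathlib

open MeasureTheory Filter Topology
open scoped CompactlySupported ENNReal

noncomputable section

namespace CutProject

/-! ### Complex Radon measures -/

section RadonMeasures

variable {X : Type*} [TopologicalSpace X]

/-- A (possibly unbounded) complex Radon measure `ρ` on `X`, given by its polar decomposition
`dρ = phase · d|ρ|`: the total variation `|ρ|` is a regular Borel measure (in particular finite on
compact sets) and the phase is a unimodular Borel function. The `σ`-algebra is always the Borel
`σ`-algebra of the topology of `X`; for a product `X = G × H` it is the Borel `σ`-algebra of the
product topology. -/
structure ComplexRadonMeasure (X : Type*) [TopologicalSpace X] where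
  /-- The total variation measure `|ρ|`. -/
  variation : @Measure X (borel X)
  regular : @Measure.Regular X (borel X) _ variation
  /-- The density of `ρ` with respect to `|ρ|`. -/
  phase : X → ℂ
  measurable_phase : @Measurable X ℂ (borel X) _ phase
  norm_phase : ∀ x, ‖phase x‖ = 1

/-- The integral `∫ g dρ`. -/
def ComplexRadonMeasure.integral (ρ : ComplexRadonMeasure X) (g : X → ℂ) : ℂ :=
  ∫ x, g x * ρ.phase x ∂ρ.variation

/-- The integral `∫ g dρ̄` against the complex conjugate measure,
`ρ̄ (g) = conj (ρ (conj g))`. -/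
def ComplexRadonMeasure.conjIntegral (ρ : ComplexRadonMeasure X) (g : X → ℂ) : ℂ :=
  (starRingEnd ℂ) (ρ.integral fun x => (starRingEnd ℂ) (g x))

/-- The positive measure `|ρ| × |ρ|`, the total variation of `ρ × ρ̄`. -/
def ComplexRadonMeasure.prodVariation (ρ : ComplexRadonMeasure X) :
    @Measure (X × X) (@Prod.instMeasurableSpace X X (borel X) (borel X)) :=
  @Measure.prod X X (borel X) (borel X) ρ.variation ρ.variation

/-- The space `M(X)` of complex regular Borel measures, as the space of linear functionals on
`C_c(X)` that are bounded with respect to the supremum norm on the functions supported in any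
given compact set. -/
structure RadonFunctional (X : Type*) [TopologicalSpace X] where
  toLin : C_c(X, ℂ) →ₗ[ℂ] ℂ
  bounded : ∀ K : Set X, IsCompact K → ∃ C : ℝ, ∀ φ : C_c(X, ℂ), tsupport φ ⊆ K →
    ∀ B : ℝ, (∀ x, ‖φ x‖ ≤ B) → ‖toLin φ‖ ≤ C * B

instance : CoeFun (RadonFunctional X) fun _ => C_c(X, ℂ) → ℂ := ⟨fun ν => ν.toLin⟩

/-- The vague topology: the weakest one for which all `ν ↦ ν φ` are continuous. -/
instance : TopologicalSpace (RadonFunctional X) :=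
  TopologicalSpace.induced (fun ν φ => ν φ) inferInstance

theorem RadonFunctional.continuous_eval (φ : C_c(X, ℂ)) :
    Continuous fun ν : RadonFunctional X => ν φ :=
  (continuous_apply φ).comp continuous_induced_dom

end RadonMeasures

/-! ### Translation, reflection, hull and autocorrelation -/

section Dynamics

variable {G : Type*} [AddCommGroup G] [TopologicalSpace G] [IsTopologicalAddGroup G]

/-- `φ(· + t)`, that is `δ_{-t} ∗ φ`. -/
def shift (t : G) (φ : C_c(G, ℂ)) : C_c(G, ℂ) where
  toFun x := φ (x + t)
  continuous_toFun := by fun_prop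
  hasCompactSupport' := φ.hasCompactSupport.comp_homeomorph (Homeomorph.addRight t)

@[simp]
theorem shift_apply (t : G) (φ : C_c(G, ℂ)) (x : G) : shift t φ x = φ (x + t) := rfl

/-- The function `x ↦ conj (φ(-x))`. -/
def reflectConj (φ : C_c(G, ℂ)) : C_c(G, ℂ) where
  toFun x := (starRingEnd ℂ) (φ (-x))
  continuous_toFun := by
    have := φ.continuous_toFun
    exact Complex.continuous_conj.comp (this.comp continuous_neg)
  hasCompactSupport' :=
    (φ.hasCompactSupport.comp_homeomorph (Homeomorph.neg G)).comp_left (map_zero _)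

@[simp]
theorem reflectConj_apply (φ : C_c(G, ℂ)) (x : G) :
    reflectConj φ x = (starRingEnd ℂ) (φ (-x)) := rfl

/-- The translation action `(α_t ν)(φ) = ν (δ_{-t} ∗ φ)`. -/
def translate (t : G) (ν : RadonFunctional G) : RadonFunctional G where
  toLin :=
    { toFun := fun φ => ν (shift t φ)
      map_add' := fun φ ψ => by
        rw [← map_add]; congr 1
      map_smul' := fun c φ => by
        rw [RingHom.id_apply, ← map_smul]; congr 1 }
  bounded := by
    intro K hK
    obtain ⟨C, hC⟩ := ν.bounded ((fun x => x + -t) '' K) (hK.image (by fun_prop))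
    refine ⟨C, fun φ hφ B hB => hC _ ?_ B fun x => hB _⟩
    intro x hx
    refine ⟨x + t, hφ ?_, by simp⟩
    have := tsupport_comp_eq_preimage φ (Homeomorph.addRight t)
    have hx' : x ∈ tsupport (φ ∘ (Homeomorph.addRight t)) := hx
    rw [this] at hx'
    exact hx'

@[simp]
theorem translate_apply (t : G) (ν : RadonFunctional G) (φ : C_c(G, ℂ)) :
    translate t ν φ = ν (shift t φ) := rfl

/-- The measure `ν̃`, given by `ν̃(φ) = conj (ν (conj φ(-·)))`. -/
def tildeMeasure (ν : RadonFunctional G) : RadonFunctional G where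
  toLin :=
    { toFun := fun φ => (starRingEnd ℂ) (ν (reflectConj φ))
      map_add' := fun φ ψ => by
        rw [← map_add, ← map_add]; congr 2; ext x; simp
      map_smul' := fun c φ => by
        have : reflectConj (c • φ) = (starRingEnd ℂ) c • reflectConj φ := by
          ext x; simp
        rw [this, map_smul]; simp }
  bounded := by
    intro K hK
    obtain ⟨C, hC⟩ := ν.bounded ((fun x => -x) '' K) (hK.image continuous_neg)
    refine ⟨C, fun φ hφ B hB => ?_⟩
    change ‖(starRingEnd ℂ) (ν (reflectConj φ))‖ ≤ _
    rw [RCLike.norm_conj]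
    refine hC _ ?_ B fun x => by simpa using hB (-x)
    intro x hx
    refine ⟨-x, hφ ?_, by simp⟩
    have h1 : tsupport (reflectConj φ) ⊆ tsupport (φ ∘ (Homeomorph.neg G)) := by
      refine closure_mono fun y hy => ?_
      intro h0
      apply hy
      have h0' : φ (-y) = 0 := h0
      simp [h0']
    have h2 := h1 hx
    rw [tsupport_comp_eq_preimage φ (Homeomorph.neg G)] at h2
    exact h2

theorem continuous_translate (t : G) :
    Continuous (translate t : RadonFunctional G → RadonFunctional G) :=
  continuous_induced_rng.2 <| continuous_pi fun φ =>
    RadonFunctional.continuous_eval (shift t φ)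

/-- The hull `Ω(ν)`: the vague closure of the orbit of `ν` under translations. -/
def hull (ν : RadonFunctional G) : Set (RadonFunctional G) :=
  closure (Set.range fun t => translate t ν)

theorem translate_mem_hull (t : G) {ν ω : RadonFunctional G} (hω : ω ∈ hull ν) :
    translate t ω ∈ hull ν := by
  refine map_mem_closure (continuous_translate t) hω ?_
  rintro _ ⟨s, rfl⟩
  refine ⟨t + s, ?_⟩
  change translate (t + s) ν = translate t (translate s ν)
  have : (translate (t + s) ν).toLin = (translate t (translate s ν)).toLin := by
    ext φ
    change ν (shift (t + s) φ) = ν (shift s (shift t φ))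
    congr 1
    ext x
    simp only [shift_apply]
    congr 1
    abel
  cases h1 : translate (t + s) ν
  cases h2 : translate t (translate s ν)
  simp_all

/-- The action of `G` on the hull. -/
def hullAction (ν : RadonFunctional G) (t : G) (ω : hull ν) : hull ν :=
  ⟨translate t ω, translate_mem_hull t ω.2⟩

/-- `m` is a translation invariant (regular Borel) probability measure on the hull of `ν`. -/
structure IsInvariantProbability (ν : RadonFunctional G)
    (m : @Measure (hull ν) (borel (hull ν))) : Prop where
  isProbabilityMeasure : @IsProbabilityMeasure (hull ν) (borel (hull ν)) m
  regular : @Measure.Regular (hull ν) (borel (hull ν)) _ m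
  invariant : ∀ t, @Measure.map _ _ (borel (hull ν)) (borel (hull ν)) (hullAction ν t) m = m

theorem continuous_apply_shift [LocallyCompactSpace G] [T2Space G] (ω : RadonFunctional G)
    (φ : C_c(G, ℂ)) : Continuous fun t => ω (shift t φ) := by
  rw [continuous_iff_continuousAt]
  intro t₀
  obtain ⟨K₀, hK₀, ht₀⟩ := exists_compact_mem_nhds t₀
  have hS : IsCompact (tsupport φ) := φ.hasCompactSupport
  set K : Set G := (fun p : G × G => p.1 - p.2) '' (tsupport φ ×ˢ K₀) with hKdef
  have hK : IsCompact K := (hS.prod hK₀).image (by fun_prop)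
  have hzero : ∀ t ∈ K₀, ∀ x, x ∉ K → φ (x + t) = 0 := by
    intro t ht x hx
    by_contra h
    exact hx ⟨(x + t, t), ⟨subset_tsupport _ h, ht⟩, by simp⟩
  obtain ⟨C, hC⟩ := ω.bounded K hK
  rw [Metric.continuousAt_iff']
  intro ε hε
  have hpos : 0 < ε / (2 * (|C| + 1)) := by positivity
  have hev : ∀ᶠ t in 𝓝 t₀, ∀ x ∈ K, ‖φ (x + t) - φ (x + t₀)‖ < ε / (2 * (|C| + 1)) := by
    refine hK.eventually_forall_of_forall_eventually fun x _ => ?_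
    have hcont : Continuous fun z : G × G => ‖φ (z.2 + z.1) - φ (z.2 + t₀)‖ := by fun_prop
    have := hcont.tendsto (t₀, x)
    simp only [sub_self, norm_zero] at this
    exact this.eventually (gt_mem_nhds hpos)
  filter_upwards [hev, ht₀] with t ht htK
  have hle : ‖ω (shift t φ - shift t₀ φ)‖ ≤ C * (ε / (2 * (|C| + 1))) := by
    refine hC _ ?_ _ fun x => ?_
    · refine closure_minimal (fun x hx => ?_) hK.isClosed
      by_contra hxK
      apply hx
      simp [hzero t htK x hxK, hzero t₀ (mem_of_mem_nhds ht₀) x hxK]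
    · by_cases hxK : x ∈ K
      · simpa using (ht x hxK).le
      · simpa [hzero t htK x hxK, hzero t₀ (mem_of_mem_nhds ht₀) x hxK] using hpos.le
  rw [map_sub] at hle
  rw [dist_eq_norm]
  refine hle.trans_lt ?_
  calc C * (ε / (2 * (|C| + 1))) ≤ (|C| + 1) * (ε / (2 * (|C| + 1))) := by
        gcongr; linarith [le_abs_self C]
    _ = ε / 2 := by field_simp
    _ < ε := by linarith

/-- The function `t ↦ (∫ φ(s + t) dω(s)) ψ(t)`. -/
def innerCorrelation [LocallyCompactSpace G] [T2Space G] (ω : RadonFunctional G)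
    (φ ψ : C_c(G, ℂ)) : C_c(G, ℂ) where
  toFun t := ω (shift t φ) * ψ t
  continuous_toFun := (continuous_apply_shift ω φ).mul ψ.continuous_toFun
  hasCompactSupport' := ψ.hasCompactSupport.mul_left

/-- The double integral `∫∫ φ(s + t) ψ(t) dω(s) dω̃(t)`. -/
def correlation [LocallyCompactSpace G] [T2Space G] (ω : RadonFunctional G)
    (φ ψ : C_c(G, ℂ)) : ℂ :=
  tildeMeasure ω (innerCorrelation ω φ ψ)

/-- The hull of `ν` is uniquely ergodic and, for its unique invariant probability measure `m`, `γ`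
is the autocorrelation
`γ(φ) = ∫ ∫ ∫ φ(s + t) ψ(t) dω(s) dω̃(t) dm(ω)`, for every `ψ ∈ C_c(G)` with `∫ ψ = 1`. -/
def IsAutocorrelation [LocallyCompactSpace G] [T2Space G] [MeasurableSpace G]
    (mG : Measure G) (ν : RadonFunctional G) (γ : C_c(G, ℂ) → ℂ) : Prop :=
  ∃ m : @Measure (hull ν) (borel (hull ν)), IsInvariantProbability ν m ∧
    (∀ m', IsInvariantProbability ν m' → m' = m) ∧
    ∀ ψ : C_c(G, ℂ), ∫ t, ψ t ∂mG = 1 → ∀ φ : C_c(G, ℂ),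
      γ φ = ∫ ω, correlation ω.1 φ ψ ∂m

end Dynamics

/-! ### Cut and project schemes -/

section Schemes

variable {G H : Type*} [AddCommGroup G] [TopologicalSpace G] [IsTopologicalAddGroup G]
  [AddCommGroup H] [TopologicalSpace H] [IsTopologicalAddGroup H]

/-- `(G, H, L)` is a cut and project scheme: `L` is a discrete cocompact subgroup of `G × H`, the
projection to `G` is injective on `L` and the projection of `L` to `H` is dense. An element of `L`
is a pair `(l, l⋆)`. -/
structure IsCutProjectScheme (L : AddSubgroup (G × H)) : Prop where
  discrete : DiscreteTopology L
  cocompact : CompactSpace ((G × H) ⧸ L)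
  injOn_fst : Set.InjOn Prod.fst (L : Set (G × H))
  dense_snd : Dense (Prod.snd '' (L : Set (G × H)))

/-- `ρ` is invariant under translations by elements of `L`. -/
def IsInvariantUnder (L : AddSubgroup (G × H)) (ρ : ComplexRadonMeasure (G × H)) : Prop :=
  ∀ l ∈ L, ∀ g : C_c(G × H, ℂ), ρ.integral (fun x => g (x + l)) = ρ.integral g

/-- `ρ` is the Dirac comb `δ_L`, the sum of the unit point masses at the points of `L`. -/
def IsDiracComb (L : AddSubgroup (G × H)) (ρ : ComplexRadonMeasure (G × H)) : Prop :=
  ∀ g : C_c(G × H, ℂ), ρ.integral g = ∑' l : L, g l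

/-- A measurable, locally bounded `f : H → ℂ` is admissible for `ρ` if for all `ε > 0` and
`φ ∈ C_c(G)` there is a compact `Q ⊆ H` with
`∫ |φ(t + s) f(h + k)| (1 - 1_Q(h + k)) d|ρ|(t, h) ≤ ε` for all `(s, k) ∈ G × H`. -/
structure IsAdmissible [MeasurableSpace H] (ρ : ComplexRadonMeasure (G × H)) (f : H → ℂ) :
    Prop where
  measurable : Measurable f
  locallyBounded : ∀ h, ∃ U ∈ 𝓝 h, ∃ C : ℝ, ∀ k ∈ U, ‖f k‖ ≤ C
  small_outside : ∀ ε : ℝ, 0 < ε → ∀ φ : C_c(G, ℂ), ∃ Q : Set H, IsCompact Q ∧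
    ∀ (s : G) (k : H),
      ∫⁻ x, ‖φ (x.1 + s) * f (x.2 + k)‖ₑ * Qᶜ.indicator 1 (x.2 + k) ∂ρ.variation ≤
        ENNReal.ofReal ε

/-- A measurable set of representatives of `(G × H) / L`. -/
structure IsFundamentalCell [MeasurableSpace G] [MeasurableSpace H] (L : AddSubgroup (G × H))
    (Z : Set (G × H)) : Prop where
  measurableSet : MeasurableSet Z
  bijOn : Set.BijOn (QuotientAddGroup.mk : G × H → (G × H) ⧸ L) Z Set.univ

/-- `σ_ξ(g) = ∑_{l ∈ L} g(x + l)` for `ξ = [x]`. -/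
def orbitSum (L : AddSubgroup (G × H)) (g : C_c(G × H, ℂ)) (ξ : (G × H) ⧸ L) : ℂ :=
  Quotient.liftOn' ξ (fun x => ∑' l : L, g (x + l)) <| by
    intro x y hxy
    rw [QuotientAddGroup.leftRel_apply] at hxy
    refine ((Equiv.addLeft (⟨-x + y, hxy⟩ : L)).tsum_eq fun l : L => g (x + l)).symm.trans ?_
    refine tsum_congr fun l => ?_
    simp [add_assoc]

/-- `ρT` is the measure on `(G × H) / L` with `∫ g dρ = ∫ σ_ξ(g) dρT(ξ)` for all
`g ∈ C_c(G × H)`. -/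
def IsDisintegration (L : AddSubgroup (G × H)) (ρ : ComplexRadonMeasure (G × H))
    (ρT : ComplexRadonMeasure ((G × H) ⧸ L)) : Prop :=
  ∀ g : C_c(G × H, ℂ), ρ.integral g = ρT.integral (orbitSum L g)

/-- `f̃(h) = conj (f(-h))`. -/
def tildeFun (f : H → ℂ) (h : H) : ℂ := (starRingEnd ℂ) (f (-h))

variable [MeasurableSpace H]

/-- `(f ∗ f̃)(h)`. -/
def selfConv (mH : Measure H) (f : H → ℂ) : H → ℂ :=
  MeasureTheory.convolution f (tildeFun f) (ContinuousLinearMap.mul ℂ ℂ) mH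

/-- `(f ∗ f̃)(h)` exists, that is, `k ↦ f(k) f̃(h - k)` is integrable. -/
def SelfConvExistsAt (mH : Measure H) (f : H → ℂ) (h : H) : Prop :=
  MeasureTheory.ConvolutionExistsAt f (tildeFun f) h (ContinuousLinearMap.mul ℂ ℂ) mH

/-- `γ_ξ(φ) = v⁻¹ ∑_{(l, l⋆) ∈ L} (f ∗ f̃)(h - l⋆) φ(s - l)` for `ξ = [s, h]`, where `v` is the
volume of a fundamental cell. -/
def gammaAt (L : AddSubgroup (G × H)) (mH : Measure H) (v : ℝ) (f : H → ℂ)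
    (ξ : (G × H) ⧸ L) (φ : C_c(G, ℂ)) : ℂ :=
  Quotient.liftOn' ξ
    (fun x => (v : ℂ)⁻¹ * ∑' l : L, selfConv mH f (x.2 - l.1.2) * φ (x.1 - l.1.1)) <| by
    intro x y hxy
    rw [QuotientAddGroup.leftRel_apply] at hxy
    refine congrArg (fun c => (v : ℂ)⁻¹ * c) ?_
    refine Eq.trans ?_ ((Equiv.addLeft (⟨-x + y, hxy⟩ : L)).tsum_eq
      fun l : L => selfConv mH f (y.2 - l.1.2) * φ (y.1 - l.1.1))
    refine tsum_congr fun l => ?_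
    have h1 : y.1 - (-x.1 + y.1 + l.1.1) = x.1 - l.1.1 := by abel
    have h2 : y.2 - (-x.2 + y.2 + l.1.2) = x.2 - l.1.2 := by abel
    simp [h1, h2]

/-- `γ_ξ(φ)` exists: for the representatives `(s, h)` of `ξ`, all the values `(f ∗ f̃)(h - l⋆)`
exist and the sum over `L` converges absolutely. -/
def GammaExistsAt (L : AddSubgroup (G × H)) (mH : Measure H) (f : H → ℂ)
    (ξ : (G × H) ⧸ L) (φ : C_c(G, ℂ)) : Prop :=
  ∀ x : G × H, (x : (G × H) ⧸ L) = ξ →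
    (∀ l : L, SelfConvExistsAt mH f (x.2 - l.1.2)) ∧
    Summable fun l : L => selfConv mH f (x.2 - l.1.2) * φ (x.1 - l.1.1)

set_option linter.unusedSectionVars false in
theorem integrable_weight [LocallyCompactSpace G] [T2Space G] [T2Space H] [BorelSpace H]
    {ρ : ComplexRadonMeasure (G × H)} {f : H → ℂ} (hf : IsAdmissible ρ f) (φ : C_c(G, ℂ)) :
    Integrable (fun x => φ x.1 * f x.2 * ρ.phase x) ρ.variation := by
  let _ : MeasurableSpace (G × H) := borel (G × H)
  have : BorelSpace (G × H) := ⟨rfl⟩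
  have := ρ.regular
  have hmeas : Measurable fun x : G × H => φ x.1 * f x.2 * ρ.phase x := by
    have h1 : Measurable fun x : G × H => φ x.1 :=
      ((map_continuous φ).comp continuous_fst).measurable
    have h2 : Measurable fun x : G × H => f x.2 := hf.measurable.comp continuous_snd.measurable
    exact (h1.mul h2).mul ρ.measurable_phase
  refine ⟨hmeas.aestronglyMeasurable, ?_⟩
  obtain ⟨Q, hQ, hQle⟩ := hf.small_outside 1 one_pos φ
  obtain ⟨C, hC⟩ : ∃ C : ℝ, ∀ h ∈ Q, ‖f h‖ ≤ C := by
    refine hQ.induction_on (p := fun s => ∃ C : ℝ, ∀ h ∈ s, ‖f h‖ ≤ C) ⟨0, by simp⟩ ?_ ?_ ?_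
    · rintro s t hst ⟨C, hC⟩
      exact ⟨C, fun h hh => hC h (hst hh)⟩
    · rintro s t ⟨C, hC⟩ ⟨D, hD⟩
      refine ⟨max C D, fun h hh => ?_⟩
      rcases hh with hh | hh
      · exact (hC h hh).trans (le_max_left _ _)
      · exact (hD h hh).trans (le_max_right _ _)
    · intro h _
      obtain ⟨U, hU, C, hC⟩ := hf.locallyBounded h
      exact ⟨U, mem_nhdsWithin_of_mem_nhds hU, C, hC⟩
  obtain ⟨M, hM⟩ := (map_continuous φ).bounded_above_of_compact_support φ.hasCompactSupport
  have hKc : IsCompact (tsupport φ ×ˢ Q) := φ.hasCompactSupport.isCompact.prod hQ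
  set c : ℝ≥0∞ := ENNReal.ofReal M * ENNReal.ofReal C
  have hpt : ∀ x : G × H, ‖φ x.1 * f x.2 * ρ.phase x‖ₑ ≤
      ‖φ (x.1 + 0) * f (x.2 + 0)‖ₑ * Qᶜ.indicator 1 (x.2 + 0) +
        (tsupport φ ×ˢ Q).indicator (fun _ => c) x := by
    intro x
    have hph : ‖ρ.phase x‖ₑ = 1 := by
      rw [← ofReal_norm, ρ.norm_phase, ENNReal.ofReal_one]
    rw [enorm_mul, hph, mul_one, add_zero, add_zero]
    by_cases hx : x.2 ∈ Q
    · by_cases hx1 : x.1 ∈ tsupport φ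
      · refine le_trans ?_ le_add_self
        rw [Set.indicator_of_mem (Set.mk_mem_prod hx1 hx), enorm_mul]
        refine mul_le_mul' ?_ ?_
        · rw [← ofReal_norm]; exact ENNReal.ofReal_le_ofReal (hM _)
        · rw [← ofReal_norm]; exact ENNReal.ofReal_le_ofReal (hC _ hx)
      · simp [image_eq_zero_of_notMem_tsupport hx1]
    · simp [hx]
  refine lt_of_le_of_lt (lintegral_mono hpt) ?_
  rw [lintegral_add_right _ (measurable_const.indicator hKc.measurableSet)]
  refine ENNReal.add_lt_top.2 ⟨(hQle 0 0).trans_lt ENNReal.ofReal_lt_top, ?_⟩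
  rw [lintegral_indicator_const hKc.measurableSet]
  exact ENNReal.mul_lt_top (ENNReal.mul_lt_top ENNReal.ofReal_lt_top ENNReal.ofReal_lt_top)
    hKc.measure_lt_top

/-- The measure `ν_f` on `G`, `ν_f(φ) = ∫ φ(t) f(h) dρ(t, h)`. -/
def weightedMeasure [LocallyCompactSpace G] [T2Space G] [T2Space H] [BorelSpace H]
    (ρ : ComplexRadonMeasure (G × H)) (f : H → ℂ) (hf : IsAdmissible ρ f) :
    RadonFunctional G where
  toLin :=
    { toFun := fun φ => ρ.integral fun x => φ x.1 * f x.2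
      map_add' := fun φ ψ => by
        unfold ComplexRadonMeasure.integral
        let _ : MeasurableSpace (G × H) := borel (G × H)
        rw [← integral_add (integrable_weight hf φ) (integrable_weight hf ψ)]
        congr 1
        funext x
        simp [add_mul]
      map_smul' := fun c φ => by
        unfold ComplexRadonMeasure.integral
        let _ : MeasurableSpace (G × H) := borel (G × H)
        rw [RingHom.id_apply, smul_eq_mul, ← integral_const_mul]
        congr 1
        funext x
        simp [mul_assoc] }
  bounded := by
    intro K hK
    let _ : MeasurableSpace (G × H) := borel (G × H)
    obtain ⟨χ, hχ1, -, hχc, -⟩ :=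
      exists_continuous_one_zero_of_isCompact hK isClosed_empty (Set.disjoint_empty K)
    let χ' : C_c(G, ℂ) :=
      { toFun := fun x => (χ x : ℂ)
        continuous_toFun := by fun_prop
        hasCompactSupport' := hχc.comp_left (g := fun r : ℝ => (r : ℂ)) Complex.ofReal_zero }
    refine ⟨∫ x, ‖χ' x.1 * f x.2 * ρ.phase x‖ ∂ρ.variation, fun φ hφ B hB => ?_⟩
    change ‖∫ x, φ x.1 * f x.2 * ρ.phase x ∂ρ.variation‖ ≤ _
    refine (norm_integral_le_integral_norm _).trans ?_
    rw [← integral_mul_const]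
    refine integral_mono (integrable_weight hf φ).norm
      ((integrable_weight hf χ').norm.mul_const B) fun x => ?_
    change ‖φ x.1 * f x.2 * ρ.phase x‖ ≤ ‖χ' x.1 * f x.2 * ρ.phase x‖ * B
    have hB0 : 0 ≤ B := (norm_nonneg _).trans (hB 0)
    by_cases hx : x.1 ∈ tsupport φ
    · have h1 : χ' x.1 = 1 := by
        change ((χ x.1 : ℝ) : ℂ) = 1
        rw [hχ1 (hφ hx)]; simp
      rw [h1, mul_assoc, norm_mul, one_mul, mul_comm]
      exact mul_le_mul_of_nonneg_left (hB _) (norm_nonneg _)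
    · rw [image_eq_zero_of_notMem_tsupport hx, zero_mul, zero_mul, norm_zero]
      positivity

end Schemes

end CutProject

end

open CutProject

/-! Write 𝕋 = (G × H)/L, a compact group. The point ζ = [s, k] of 𝕋 carries the measure φ ↦ ∫ φ(t +
s) f(h + k) dρ(t, h) on G. For compactly supported f this equals ∫ σ_{ξ+ζ}(φ ⊗ f) dρ_𝕋(ξ)
(`torusVal`), so it depends only on ζ, and continuously. This gives a continuous map β from 𝕋 to the
measures on G with β(0) = ν_f and β(ζ + [t, 0]) = α_t β(ζ). As the points [t, 0] are dense in 𝕋, the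
hull of ν_f is β(𝕋), and its only invariant probability measure is the image of the Haar measure of
𝕋 (`exists_unique_invariantProbability`). The autocorrelation is thus the Haar mean over ζ of the
correlation of β(ζ).

For compactly supported f this mean can be computed (`integral_torusCorr`). Writing the outer
integral over ρ_𝕋, exchanging it with the mean and translating ζ, the integrand becomes the orbit
sum of a product function on G × H. Its integral over 𝕋 unfolds to v⁻¹ times an integral over G,
which is 1 by the normalisation of ψ, times an integral over H, which produces f ∗ f̃.

An admissible f is the limit of cutoffs χ_n f. Admissibility is uniform in all translates, and
`IsDisintegration.torusNorm_le` carries estimates from |ρ| to |ρ_𝕋|. Hence the measures and their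
correlations converge uniformly on 𝕋, which settles the mean. On the side of γ_{ξ-η} dominated
convergence applies: the formula for compact supports, used for |ρ_𝕋|, |φ| and |χ_n f|, bounds the
integrals of the majorants by a bound for correlations that does not depend on n
(`integral_normSum_autoConv_le`). The same majorant shows that γ_{ξ-η}(φ) exists almost everywhere
and is integrable.

Integrating the uniform bounds over 𝕋 bounds the L¹ norms of χ_n f, so f is integrable. For the
Dirac comb ρ_𝕋 = δ_0, so "almost every (ξ, η)" means (0, 0); existence of (f ∗ f̃)(0) = ∫ |f|² then
makes f square integrable. -/

noncomputable section

namespace CutProject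

/-! ### Regular measures -/

section Regularity

variable {Y : Type*} [TopologicalSpace Y] [MeasurableSpace Y] [BorelSpace Y]

/-- If all integrals `∫ g k u dμ` with `k ∈ C_c(Y)`, `|k| ≤ 1` and unimodular `u` are bounded by
`C`, then so is `∫ g dμ`. -/
theorem integral_le_of_norm_integral_mul_le [T2Space Y] [LocallyCompactSpace Y]
    [SigmaCompactSpace Y] (μ : Measure Y) [μ.Regular] {u : Y → ℂ} (hu : Measurable u) (hu1 : ∀ y, ‖u y‖ = 1)
    {g : Y → ℝ} (hg : Continuous g) (hgc : HasCompactSupport g) {C : ℝ}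
    (hC : ∀ k : C_c(Y, ℂ), (∀ y, ‖k y‖ ≤ 1) → ‖∫ y, (g y : ℂ) * k y * u y ∂μ‖ ≤ C) :
    ∫ y, g y ∂μ ≤ C := by
  obtain ⟨M, hM0, hM⟩ : ∃ M : ℝ, 0 ≤ M ∧ ∀ y, ‖g y‖ ≤ M := by
    obtain ⟨M, hM⟩ := hg.bounded_above_of_compact_support hgc
    exact ⟨max M 0, le_max_right _ _, fun y => (hM y).trans (le_max_left _ _)⟩
  set K := tsupport g
  have hK : IsCompact K := hgc
  -- The ideal test function: g h u = g, since u is unimodular. It is replaced by a function in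
  -- C_c(Y) with values in the unit disc.
  set h : Y → ℂ := K.indicator fun y => (starRingEnd ℂ) (u y)
  have hh1 : ∀ y, ‖h y‖ ≤ 1 := fun y => by
    by_cases hy : y ∈ K <;> simp [h, hy, hu1]
  have hhi : Integrable h μ := by
    refine IntegrableOn.integrable_indicator ?_ hK.measurableSet
    refine Measure.integrableOn_of_bounded (M := 1) hK.measure_lt_top.ne
      (Complex.continuous_conj.measurable.comp hu).aestronglyMeasurable ?_
    exact ae_of_all _ fun y => by simp [hu1]
  refine le_of_forall_pos_le_add fun ε hε => ?_
  -- The final error is at most M · 2 · ∫ |h - k₀|; using M + 1 avoids division by zero.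
  obtain ⟨k₀, hk₀c, hk₀, hk₀cont, hk₀i⟩ :=
    hhi.exists_hasCompactSupport_integral_sub_le (ε := ε / (2 * (M + 1))) (by positivity)
  -- Radial retraction of k₀ to the unit disc. As |h| ≤ 1, it moves k₀ by at most |h - k₀|, which
  -- costs a factor 2.
  let k : C_c(Y, ℂ) :=
    { toFun := fun y => ((max 1 ‖k₀ y‖ : ℝ) : ℂ)⁻¹ * k₀ y
      continuous_toFun := by
        refine Continuous.mul (Continuous.inv₀ (by fun_prop) fun y => ?_) hk₀cont
        have : (0 : ℝ) < max 1 ‖k₀ y‖ := lt_max_of_lt_left one_pos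
        exact_mod_cast this.ne'
      hasCompactSupport' := hk₀c.mul_left }
  have hkdef : ∀ y, k y = ((max 1 ‖k₀ y‖ : ℝ) : ℂ)⁻¹ * k₀ y := fun y => rfl
  have hpos : ∀ y, (0 : ℝ) < max 1 ‖k₀ y‖ := fun y => lt_max_of_lt_left one_pos
  have hk1 : ∀ y, ‖k y‖ ≤ 1 := fun y => by
    rw [hkdef, norm_mul, norm_inv, Complex.norm_real, Real.norm_of_nonneg (hpos y).le,
      inv_mul_le_one₀ (hpos y)]
    exact le_max_right _ _
  have hkk : ∀ y, ‖h y - k y‖ ≤ 2 * ‖h y - k₀ y‖ := fun y => by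
    have h1 : ‖k₀ y - k y‖ ≤ ‖h y - k₀ y‖ := by
      have : k₀ y - k y = ((1 - (max 1 ‖k₀ y‖)⁻¹ : ℝ) : ℂ) * k₀ y := by
        rw [hkdef]; push_cast; ring
      have hle : (max 1 ‖k₀ y‖)⁻¹ ≤ 1 := inv_le_one_of_one_le₀ (le_max_left _ _)
      rw [this, norm_mul, Complex.norm_real, Real.norm_of_nonneg (by linarith)]
      have h2 : ‖k₀ y‖ - ‖h y‖ ≤ ‖h y - k₀ y‖ := by
        rw [norm_sub_rev]; exact norm_sub_norm_le _ _
      rcases le_total ‖k₀ y‖ 1 with hle1 | hle1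
      · rw [max_eq_left hle1]; simp
      · rw [max_eq_right hle1, sub_mul, inv_mul_cancel₀ (by positivity)]
        linarith [hh1 y]
    calc ‖h y - k y‖ = ‖(h y - k₀ y) + (k₀ y - k y)‖ := by congr 1; ring
      _ ≤ _ := (norm_add_le _ _).trans (by linarith)
  have hgi : Integrable g μ := hg.integrable_of_hasCompactSupport hgc
  have hki : Integrable (fun y => (g y : ℂ) * k y * u y) μ := by
    refine Integrable.mono (hgi.norm) ?_ (ae_of_all _ fun y => ?_)
    · exact (((Complex.continuous_ofReal.comp hg).measurable.mul
        (map_continuous k).measurable).mul hu).aestronglyMeasurable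
    · rw [norm_mul, norm_mul, hu1, mul_one, Complex.norm_real, norm_norm]
      exact mul_le_of_le_one_right (norm_nonneg _) (hk1 y)
  have hpt : ∀ y, ‖(g y : ℂ) - (g y : ℂ) * k y * u y‖ ≤ M * (2 * ‖h y - k₀ y‖) := fun y => by
    by_cases hy : y ∈ K
    · have hone : (starRingEnd ℂ) (u y) * u y = 1 := by
        rw [mul_comm, Complex.mul_conj, Complex.normSq_eq_norm_sq, hu1]; simp
      have : (g y : ℂ) - (g y : ℂ) * k y * u y = (g y : ℂ) * ((h y - k y) * u y) := by
        simp only [h, Set.indicator_of_mem hy, sub_mul, hone]; ring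
      rw [this, norm_mul, norm_mul, hu1, mul_one, Complex.norm_real]
      exact mul_le_mul (hM y) (hkk y) (norm_nonneg _) hM0
    · have : g y = 0 := image_eq_zero_of_notMem_tsupport hy
      rw [this]; simp; positivity
  have hdiff : ‖∫ y, (g y : ℂ) ∂μ - ∫ y, (g y : ℂ) * k y * u y ∂μ‖ ≤ ε := by
    have hgi' : Integrable (fun y => (g y : ℂ)) μ := hgi.ofReal
    rw [← integral_sub hgi' hki]
    refine (norm_integral_le_of_norm_le
      (((hhi.sub hk₀i).norm.const_mul 2).const_mul M) (ae_of_all _ hpt)).trans ?_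
    simp only [Pi.sub_apply]
    rw [integral_const_mul, integral_const_mul]
    calc M * (2 * ∫ y, ‖h y - k₀ y‖ ∂μ) ≤ M * (2 * (ε / (2 * (M + 1)))) := by gcongr
      _ = M / (M + 1) * ε := by field_simp
      _ ≤ 1 * ε := by gcongr; rw [div_le_one (by positivity)]; linarith
      _ = ε := one_mul ε
  have h0 : ∫ y, g y ∂μ ≤ ‖∫ y, (g y : ℂ) ∂μ‖ := by
    rw [integral_complex_ofReal, Complex.norm_real]; exact Real.le_norm_self _
  calc ∫ y, g y ∂μ ≤ ‖∫ y, (g y : ℂ) ∂μ‖ := h0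
    _ ≤ ‖∫ y, (g y : ℂ) * k y * u y ∂μ‖ + ‖∫ y, (g y : ℂ) ∂μ - ∫ y, (g y : ℂ) * k y * u y ∂μ‖ := by
      have := norm_add_le (∫ y, (g y : ℂ) * k y * u y ∂μ)
        (∫ y, (g y : ℂ) ∂μ - ∫ y, (g y : ℂ) * k y * u y ∂μ)
      rwa [add_sub_cancel] at this
    _ ≤ C + ε := add_le_add (hC k hk1) hdiff

/-- By absolute continuity of the integral of d, a compact K ⊆ A with μ(A \ K) small also has small
∫ d over A \ K. -/
theorem innerRegularCompactLTTop_withDensity [T2Space Y] (μ : Measure Y) [IsFiniteMeasure μ]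
    [μ.InnerRegularCompactLTTop] {d : Y → ℝ≥0∞} (hd : ∫⁻ y, d y ∂μ ≠ ∞) :
    (μ.withDensity d).InnerRegularCompactLTTop := by
  refine ⟨fun A hA r hr => ?_⟩
  obtain ⟨hA, -⟩ := hA
  obtain ⟨r', hrr', hr'⟩ := exists_between hr
  obtain ⟨δ, hδ, hsmall⟩ := exists_pos_setLIntegral_lt_of_measure_lt hd
    (ε := r' - r) (tsub_pos_of_lt hrr').ne'
  obtain ⟨K, hKA, hK, hKδ⟩ := hA.exists_isCompact_sdiff_lt (measure_ne_top μ A) hδ.ne'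
  refine ⟨K, hKA, hK, ?_⟩
  have h1 := hsmall _ hKδ
  rw [← withDensity_apply _ (hA.diff hK.measurableSet)] at h1
  by_contra hle
  push Not at hle
  have : μ.withDensity d A ≤ r + (r' - r) := by
    calc μ.withDensity d A = μ.withDensity d (K ∪ A \ K) := by rw [Set.union_sdiff_cancel hKA]
      _ ≤ _ := (measure_union_le _ _).trans (add_le_add hle h1.le)
  rw [add_tsub_cancel_of_le hrr'.le] at this
  exact absurd hr' (not_lt.2 this)

end Regularity

/-! ### Functionals on `C(T)` -/

section Functional

variable {T : Type*} [TopologicalSpace T]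

instance (τ : ComplexRadonMeasure T) : @Measure.Regular T (borel T) _ τ.variation := τ.regular

theorem ComplexRadonMeasure.isFiniteMeasure [CompactSpace T] (τ : ComplexRadonMeasure T) :
    @IsFiniteMeasure T (borel T) τ.variation := by
  let _ : MeasurableSpace T := borel T
  have := τ.regular
  infer_instance

theorem ComplexRadonMeasure.integrable [CompactSpace T] (τ : ComplexRadonMeasure T) {F : T → ℂ}
    (hF : Continuous F) : Integrable (fun x => F x * τ.phase x) τ.variation := by
  let _ : MeasurableSpace T := borel T
  have : BorelSpace T := ⟨rfl⟩
  have := τ.isFiniteMeasure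
  obtain ⟨M, hM⟩ := hF.bounded_above_of_compact_support (HasCompactSupport.of_compactSpace F)
  refine Integrable.of_bound (hF.measurable.mul τ.measurable_phase).aestronglyMeasurable M
    (ae_of_all _ fun x => ?_)
  rw [norm_mul, τ.norm_phase, mul_one]
  exact hM x

/-- Integration against `τ` as a continuous linear functional on `C(T)`. -/
def ComplexRadonMeasure.toCLM [CompactSpace T] (τ : ComplexRadonMeasure T) : C(T, ℂ) →L[ℂ] ℂ :=
  LinearMap.mkContinuous
    { toFun := fun F => τ.integral F
      map_add' := fun F F' => by
        unfold ComplexRadonMeasure.integral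
        let _ : MeasurableSpace T := borel T
        rw [← integral_add (τ.integrable F.continuous) (τ.integrable F'.continuous)]
        simp only [ContinuousMap.add_apply, add_mul]
      map_smul' := fun c F => by
        unfold ComplexRadonMeasure.integral
        let _ : MeasurableSpace T := borel T
        rw [RingHom.id_apply, smul_eq_mul, ← integral_const_mul]
        simp only [ContinuousMap.smul_apply, smul_eq_mul, mul_assoc] }
    (@Measure.real T (borel T) τ.variation Set.univ) fun F => by
      let _ : MeasurableSpace T := borel T
      have := τ.isFiniteMeasure
      refine (norm_integral_le_of_norm_le_const (C := ‖F‖) (ae_of_all _ fun x => ?_)).trans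
        (mul_comm _ _).le
      rw [norm_mul, τ.norm_phase, mul_one]
      exact F.norm_coe_le_norm x

theorem ComplexRadonMeasure.toCLM_apply [CompactSpace T] (τ : ComplexRadonMeasure T) (F : C(T, ℂ)) :
    τ.toCLM F = τ.integral F := rfl

theorem ComplexRadonMeasure.norm_integral_le [CompactSpace T] (τ : ComplexRadonMeasure T)
    {F : T → ℂ} {g : T → ℝ} (hg : Continuous g) (hFg : ∀ x, ‖F x‖ ≤ g x) :
    ‖τ.integral F‖ ≤ @MeasureTheory.integral T ℝ _ _ (borel T) τ.variation g := by
  let _ : MeasurableSpace T := borel T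
  have : BorelSpace T := ⟨rfl⟩
  have := τ.isFiniteMeasure
  refine norm_integral_le_of_norm_le
    (hg.integrable_of_hasCompactSupport (HasCompactSupport.of_compactSpace g))
    (ae_of_all _ fun x => ?_)
  rw [norm_mul, τ.norm_phase, mul_one]
  exact hFg x

/-- The total variation, as a complex Radon measure. -/
def ComplexRadonMeasure.abs (τ : ComplexRadonMeasure T) : ComplexRadonMeasure T where
  variation := τ.variation
  regular := τ.regular
  phase _ := 1
  measurable_phase := @measurable_const _ _ _ (borel T) _
  norm_phase _ := norm_one

theorem ComplexRadonMeasure.abs_integral_ofReal (τ : ComplexRadonMeasure T) (g : T → ℝ) :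
    τ.abs.integral (fun x => (g x : ℂ)) =
      (@MeasureTheory.integral T ℝ _ _ (borel T) τ.variation g : ℂ) := by
  let _ : MeasurableSpace T := borel T
  simp only [ComplexRadonMeasure.integral, ComplexRadonMeasure.abs, mul_one]
  exact integral_complex_ofReal

theorem ComplexRadonMeasure.continuous_integral [CompactSpace T] (τ : ComplexRadonMeasure T)
    {P : Type*} [TopologicalSpace P] {F : P → T → ℂ} (hF : Continuous (Function.uncurry F)) :
    Continuous fun p => τ.integral (F p) :=
  τ.toCLM.continuous.comp (ContinuousMap.curry ⟨_, hF⟩).continuous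

/-- Fubini's theorem for a compactly supported continuous function on `P × T`. -/
theorem ComplexRadonMeasure.integral_integral_swap [CompactSpace T] (τ : ComplexRadonMeasure T)
    {P : Type*} [TopologicalSpace P] [MeasurableSpace P] [BorelSpace P] [R1Space P]
    (m : Measure P) [IsFiniteMeasureOnCompacts m] {F : P → T → ℂ}
    (hF : Continuous (Function.uncurry F)) {K : Set P} (hK : IsCompact K)
    (hKF : ∀ p, p ∉ K → ∀ x, F p x = 0) :
    ∫ p, τ.integral (F p) ∂m = τ.integral fun x => ∫ p, F p x ∂m := by
  let Φ : C(P, C(T, ℂ)) := ContinuousMap.curry ⟨_, hF⟩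
  have hΦ : Integrable Φ m := by
    refine Φ.continuous.integrable_of_hasCompactSupport (HasCompactSupport.intro hK fun p hp => ?_)
    ext x
    exact hKF p hp x
  have h1 := τ.toCLM.integral_comp_comm hΦ
  refine h1.trans ?_
  rw [τ.toCLM_apply]
  congr 1
  funext x
  exact ((ContinuousMap.evalCLM ℂ x).integral_comp_comm hΦ).symm

end Functional

/-! ### Push-forward of a complex Radon measure -/

/-- Phases can cancel along the fibres of π, so the variation of the image need not be the image κ
of w|ρ|. The density with respect to κ is the conditional expectation v of the phase given π, and
the polar decomposition of v κ is |v| κ with phase v/|v|. -/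
theorem ComplexRadonMeasure.exists_pushforward {X T : Type*} [TopologicalSpace X] [T2Space X]
    [TopologicalSpace T] [T2Space T] [CompactSpace T] (ρ : ComplexRadonMeasure X) {π : X → T}
    (hπ : Continuous π) {w : X → ℝ} (hw : Continuous w) (hwc : HasCompactSupport w)
    (hw0 : ∀ x, 0 ≤ w x) :
    ∃ τ : ComplexRadonMeasure T, ∀ F : C(T, ℂ),
      τ.integral F = ρ.integral fun x => w x * F (π x) := by
  let mX : MeasurableSpace X := borel X
  have : BorelSpace X := ⟨rfl⟩
  let mT : MeasurableSpace T := borel T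
  have : BorelSpace T := ⟨rfl⟩
  have := ρ.regular
  have hK : IsCompact (tsupport w) := hwc
  have hwm : Measurable fun x => (w x).toNNReal := hw.measurable.real_toNNReal
  set lam : Measure X := ρ.variation.withDensity fun x => ((w x).toNNReal : ℝ≥0∞)
  have hwi : ∫⁻ x, ((w x).toNNReal : ℝ≥0∞) ∂ρ.variation ≠ ∞ :=
    (hw.integrable_of_hasCompactSupport (μ := ρ.variation) hwc).lintegral_lt_top.ne
  have hfin : IsFiniteMeasure lam := isFiniteMeasure_withDensity hwi
  -- The variation may be infinite; restricting it to the support of w gives a finite base measure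
  -- for the regularity of the density.
  have hres : lam = (ρ.variation.restrict (tsupport w)).withDensity
      fun x => ((w x).toNNReal : ℝ≥0∞) := by
    rw [← restrict_withDensity hK.measurableSet]
    refine (Measure.restrict_eq_self_of_ae_mem ?_).symm
    rw [ae_withDensity_iff hwm.coe_nnreal_ennreal]
    refine ae_of_all _ fun x hx => ?_
    by_contra h
    exact hx (by rw [image_eq_zero_of_notMem_tsupport h]; simp)
  have : IsFiniteMeasure (ρ.variation.restrict (tsupport w)) :=
    ⟨by rw [Measure.restrict_apply_univ]; exact hK.measure_lt_top⟩
  have hlamreg : lam.InnerRegularCompactLTTop := by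
    rw [hres]
    refine innerRegularCompactLTTop_withDensity _ (ne_top_of_le_ne_top hwi ?_)
    exact lintegral_mono' Measure.restrict_le_self le_rfl
  set κ : Measure T := lam.map π
  have hκreg : κ.InnerRegularCompactLTTop := hlamreg.map_of_continuous hπ
  have hui : Integrable ρ.phase lam := Integrable.of_bound
    ρ.measurable_phase.aestronglyMeasurable 1 (ae_of_all _ fun x => (ρ.norm_phase x).le)
  have hle : mT.comap π ≤ mX := hπ.measurable.comap_le
  -- A function measurable for the σ-algebra generated by π factors through π.
  obtain ⟨v, hv, hve⟩ := (stronglyMeasurable_condExp (μ := lam) (m := mT.comap π)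
    (f := ρ.phase)).measurable.exists_eq_measurable_comp
  have hvi' : Integrable (v ∘ π) lam := by rw [← hve]; exact integrable_condExp
  have hvi : Integrable v κ :=
    (integrable_map_measure hv.aestronglyMeasurable hπ.aemeasurable).2 hvi'
  have hvfin : ∫⁻ x, ((‖v x‖₊ : NNReal) : ℝ≥0∞) ∂κ ≠ ∞ := hvi.hasFiniteIntegral.ne
  have : IsFiniteMeasure (κ.withDensity fun x => ((‖v x‖₊ : NNReal) : ℝ≥0∞)) :=
    isFiniteMeasure_withDensity hvfin
  have hreg := innerRegularCompactLTTop_withDensity κ hvfin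
  let τ : ComplexRadonMeasure T :=
    { variation := κ.withDensity fun x => ((‖v x‖₊ : NNReal) : ℝ≥0∞)
      regular := inferInstance
      -- The value 1 on {v = 0} is arbitrary, as this set is null for |v| κ.
      phase := fun x => if v x = 0 then 1 else v x / ‖v x‖
      measurable_phase := Measurable.ite (hv (measurableSet_singleton 0)) measurable_const
        (hv.div (Complex.measurable_ofReal.comp hv.norm))
      norm_phase := fun x => by
        split_ifs with h
        · simp
        · rw [norm_div, Complex.norm_real, norm_norm, div_self (norm_ne_zero_iff.2 h)] }
  refine ⟨τ, fun F => ?_⟩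
  have hFm : StronglyMeasurable[mT.comap π] (F ∘ π) :=
    F.continuous.stronglyMeasurable.comp_measurable (comap_measurable π)
  have hFui : Integrable (fun x => (ContinuousLinearMap.mul ℝ ℂ) ((F ∘ π) x) (ρ.phase x)) lam :=
    Integrable.of_bound
      ((F.continuous.comp hπ).measurable.mul ρ.measurable_phase).aestronglyMeasurable ‖F‖
      (ae_of_all _ fun x => by
        rw [ContinuousLinearMap.mul_apply', norm_mul, ρ.norm_phase, mul_one]
        exact F.norm_coe_le_norm _)
  have hpull := condExp_bilin_of_stronglyMeasurable_left (ContinuousLinearMap.mul ℝ ℂ) hFm hFui hui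
  calc τ.integral F
      = ∫ x, F x * (if v x = 0 then 1 else v x / ‖v x‖)
          ∂κ.withDensity fun x => ((‖v x‖₊ : NNReal) : ℝ≥0∞) := rfl
    _ = ∫ x, F x * v x ∂κ := by
      rw [integral_withDensity_eq_integral_smul hv.nnnorm]
      congr 1
      funext x
      rw [NNReal.smul_def, Complex.real_smul]
      split_ifs with h
      · simp [h]
      · have : (‖v x‖ : ℂ) ≠ 0 := by exact_mod_cast norm_ne_zero_iff.2 h
        simp only [coe_nnnorm]; field_simp
    _ = ∫ x, F (π x) * v (π x) ∂lam :=
      integral_map hπ.aemeasurable (F.continuous.measurable.mul hv).aestronglyMeasurable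
    _ = ∫ x, F (π x) * ρ.phase x ∂lam := by
      refine Eq.trans ?_ (integral_condExp (μ := lam) hle)
      refine integral_congr_ae ?_
      filter_upwards [hpull] with x hx
      refine Eq.trans ?_ hx.symm
      rw [ContinuousLinearMap.mul_apply', hve]; rfl
    _ = ρ.integral fun x => w x * F (π x) := by
      rw [integral_withDensity_eq_integral_smul hwm]
      unfold ComplexRadonMeasure.integral
      congr 1
      funext x
      rw [NNReal.smul_def, Complex.real_smul, Real.coe_toNNReal _ (hw0 x), mul_assoc]

/-! ### Orbit sums -/

section OrbitSums

set_option linter.unusedSectionVars false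

variable {G H : Type*} [AddCommGroup G] [TopologicalSpace G] [IsTopologicalAddGroup G] [T2Space G]
  [AddCommGroup H] [TopologicalSpace H] [IsTopologicalAddGroup H] [T2Space H]
  (L : AddSubgroup (G × H)) [DiscreteTopology L]

/-- The class `[x]` of `x` modulo `L`. -/
abbrev toTorus (x : G × H) : (G × H) ⧸ L := QuotientAddGroup.mk x

theorem continuous_toTorus : Continuous (toTorus L) := continuous_quot_mk

theorem orbitSum_mk (g : C_c(G × H, ℂ)) (x : G × H) :
    orbitSum L g (toTorus L x) = ∑' l : L, g (x + l) := rfl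

theorem orbitSum_shift (g : C_c(G × H, ℂ)) (x : G × H) (ξ : (G × H) ⧸ L) :
    orbitSum L (shift x g) ξ = orbitSum L g (ξ + toTorus L x) := by
  induction ξ using QuotientAddGroup.induction_on with
  | H y =>
    change ∑' l : L, g (y + l + x) = ∑' l : L, g (y + x + l)
    exact tsum_congr fun l => by congr 1; abel

/-- Such l lie in the compact set C - V, which meets a discrete subgroup in a finite set. -/
theorem finite_lattice_translates {V C : Set (G × H)} (hV : IsCompact V) (hC : IsCompact C) :
    {l : L | ∃ x ∈ V, x + l ∈ C}.Finite := by
  have h := AddSubgroup.tendsto_coe_cofinite_of_discrete L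
    (isDiscrete_iff_discreteTopology.2 inferInstance)
  have hK : IsCompact ((fun p : (G × H) × (G × H) => p.1 - p.2) '' (C ×ˢ V)) :=
    (hC.prod hV).image (by fun_prop)
  have h2 := h hK.compl_mem_cocompact
  rw [mem_map, mem_cofinite] at h2
  refine h2.subset ?_
  rintro l ⟨x, hx, hl⟩
  simp only [Set.mem_compl_iff, Set.mem_preimage, not_not]
  exact ⟨(x + l, x), ⟨hl, hx⟩, by simp⟩

theorem summable_lattice_translates {E : Type*} [AddCommMonoid E] [TopologicalSpace E]
    {g : G × H → E} (hg : HasCompactSupport g) (x : G × H) : Summable fun l : L => g (x + l) := by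
  refine summable_of_hasFiniteSupport
    ((finite_lattice_translates L (isCompact_singleton (x := x)) hg).subset ?_)
  intro l hl
  exact ⟨x, rfl, subset_tsupport _ hl⟩

/-- A sum of translates is continuous, also in parameters. -/
theorem continuous_tsum_translates [LocallyCompactSpace G] [LocallyCompactSpace H]
    {P : Type*} [TopologicalSpace P] {g : P → G × H → ℂ}
    (hg : Continuous (Function.uncurry g)) {C : Set (G × H)} (hC : IsCompact C)
    (h0 : ∀ p x, x ∉ C → g p x = 0) :
    Continuous fun q : P × (G × H) => ∑' l : L, g q.1 (q.2 + l) := by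
  rw [continuous_iff_continuousAt]
  rintro ⟨p₀, x₀⟩
  obtain ⟨V, hV, hx₀⟩ := exists_compact_mem_nhds x₀
  have hfin := finite_lattice_translates L hV hC
  have hsum : Continuous fun q : P × (G × H) => ∑ l ∈ hfin.toFinset, g q.1 (q.2 + l) :=
    continuous_finsetSum _ fun l _ =>
      hg.comp (continuous_fst.prodMk (continuous_snd.add continuous_const))
  refine hsum.continuousAt.congr ?_
  have : (Set.univ : Set P) ×ˢ V ∈ 𝓝 (p₀, x₀) := prod_mem_nhds univ_mem hx₀
  filter_upwards [this] with q hq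
  refine (tsum_eq_sum fun l hl => h0 _ _ fun hlC => hl ?_).symm
  rw [Set.Finite.mem_toFinset]
  exact ⟨q.2, hq.2, hlC⟩

theorem continuous_orbitSum_param [LocallyCompactSpace G] [LocallyCompactSpace H]
    {P : Type*} [TopologicalSpace P] {g : P → C_c(G × H, ℂ)}
    (hg : Continuous fun q : P × (G × H) => g q.1 q.2) {C : Set (G × H)} (hC : IsCompact C)
    (h0 : ∀ p x, x ∉ C → g p x = 0) :
    Continuous fun q : P × ((G × H) ⧸ L) => orbitSum L (g q.1) q.2 := by
  have hq : IsOpenQuotientMap (Prod.map (id : P → P) (toTorus L)) :=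
    IsOpenQuotientMap.id.prodMap QuotientAddGroup.isOpenQuotientMap_mk
  rw [← hq.continuous_comp_iff]
  exact continuous_tsum_translates L (g := fun p x => g p x) hg hC h0

theorem continuous_orbitSum [LocallyCompactSpace G] [LocallyCompactSpace H] (g : C_c(G × H, ℂ)) :
    Continuous (orbitSum L g) := by
  have := continuous_orbitSum_param L (P := Unit) (g := fun _ => g) (by fun_prop)
    g.hasCompactSupport (fun _ x hx => image_eq_zero_of_notMem_tsupport hx)
  exact this.comp (continuous_const.prodMk continuous_id : Continuous fun ξ => ((), ξ))

theorem exists_isCompact_toTorus_surjOn [LocallyCompactSpace G] [LocallyCompactSpace H]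
    [CompactSpace ((G × H) ⧸ L)] :
    ∃ C : Set (G × H), IsCompact C ∧ ∀ ξ, ∃ x ∈ C, toTorus L x = ξ := by
  choose V hV hVx using fun x : G × H => exists_compact_mem_nhds x
  have hopen : ∀ x, IsOpen (toTorus L '' interior (V x)) := fun x =>
    QuotientAddGroup.isOpenQuotientMap_mk.isOpenMap _ isOpen_interior
  obtain ⟨t, ht⟩ := isCompact_univ.elim_finite_subcover _ hopen fun ξ _ => by
    obtain ⟨x, rfl⟩ := QuotientAddGroup.mk_surjective ξ
    exact Set.mem_iUnion.2 ⟨x, x, mem_interior_iff_mem_nhds.2 (hVx x), rfl⟩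
  refine ⟨⋃ x ∈ t, V x, t.isCompact_biUnion fun x _ => hV x, fun ξ => ?_⟩
  obtain ⟨x, hx, y, hy, rfl⟩ := Set.mem_iUnion₂.1 (ht (Set.mem_univ ξ))
  exact ⟨y, Set.mem_iUnion₂.2 ⟨x, hx, interior_subset hy⟩, rfl⟩

/-- The complex-valued version of a real compactly supported function. -/
def complexify {X : Type*} [TopologicalSpace X] (w : C_c(X, ℝ)) : C_c(X, ℂ) where
  toFun x := (w x : ℂ)
  continuous_toFun := by fun_prop
  hasCompactSupport' :=
    w.hasCompactSupport.comp_left (g := fun r : ℝ => (r : ℂ)) Complex.ofReal_zero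

@[simp]
theorem complexify_apply {X : Type*} [TopologicalSpace X] (w : C_c(X, ℝ)) (x : X) :
    complexify w x = (w x : ℂ) := rfl

/-- There is a Bruhat function: a nonnegative `w ∈ C_c(G × H)` with `∑_l w(x + l) = 1`. -/
theorem exists_bruhat [LocallyCompactSpace G] [LocallyCompactSpace H]
    [CompactSpace ((G × H) ⧸ L)] :
    ∃ w : C_c(G × H, ℝ), (∀ x, 0 ≤ w x) ∧ ∀ x, ∑' l : L, w (x + l) = 1 := by
  obtain ⟨C, hC, hCs⟩ := exists_isCompact_toTorus_surjOn L
  obtain ⟨w₀, hw₀1, -, hw₀c, hw₀01⟩ :=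
    exists_continuous_one_zero_of_isCompact hC isClosed_empty (Set.disjoint_empty C)
  let w₁ : C_c(G × H, ℝ) := ⟨w₀, hw₀c⟩
  have hw₁0 : ∀ x, 0 ≤ w₁ x := fun x => (hw₀01 x).1
  -- The Bruhat function is w₁ divided by its own periodisation s, which is positive because every
  -- class has a representative in C.
  let s : G × H → ℝ := fun x => ∑' l : L, w₁ (x + l)
  have hsS : ∀ x, ((s x : ℝ) : ℂ) = orbitSum L (complexify w₁) (toTorus L x) := fun x => by
    rw [orbitSum_mk]; exact Complex.ofReal_tsum _
  have hs : Continuous s := by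
    have h := Complex.continuous_re.comp
      ((continuous_orbitSum L (complexify w₁)).comp (continuous_toTorus L))
    refine h.congr fun x => ?_
    simp only [Function.comp_apply, ← hsS, Complex.ofReal_re]
  have hsper : ∀ x (l : L), s (x + l) = s x := fun x l => by
    have : toTorus L (x + l) = toTorus L x := by
      rw [QuotientAddGroup.eq]; simp
    have h := (hsS (x + l)).trans ((congrArg _ this).trans (hsS x).symm)
    exact_mod_cast h
  have hspos : ∀ x, 0 < s x := fun x => by
    obtain ⟨y, hy, hyx⟩ := hCs (toTorus L x)
    rw [eq_comm, QuotientAddGroup.eq] at hyx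
    have h1 : w₁ (x + (⟨-x + y, hyx⟩ : L)) = 1 := by
      have : x + (-x + y) = y := by abel
      change w₀ (x + (-x + y)) = 1
      rw [this]; exact hw₀1 hy
    have h2 := (summable_lattice_translates L w₁.hasCompactSupport x).le_tsum
      (⟨-x + y, hyx⟩ : L) (fun l _ => hw₁0 _)
    rw [h1] at h2
    exact one_pos.trans_le h2
  refine ⟨⟨⟨fun x => w₁ x / s x, (map_continuous w₁).div hs fun x => (hspos x).ne'⟩, ?_⟩,
    fun x => div_nonneg (hw₁0 x) (hspos x).le, fun x => ?_⟩
  · refine HasCompactSupport.intro w₁.hasCompactSupport fun x hx => ?_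
    change w₁ x / s x = 0
    rw [image_eq_zero_of_notMem_tsupport hx, zero_div]
  · change ∑' l : L, w₁ (x + l) / s (x + l) = 1
    simp only [hsper]
    rw [tsum_div_const]
    exact div_self (hspos x).ne'

/-- `w · (F ∘ π)` for `F ∈ C(T)`. -/
def mulLift (w : C_c(G × H, ℂ)) (F : C((G × H) ⧸ L, ℂ)) : C_c(G × H, ℂ) where
  toFun x := w x * F (toTorus L x)
  continuous_toFun := (map_continuous w).mul (F.continuous.comp (continuous_toTorus L))
  hasCompactSupport' := w.hasCompactSupport.mul_right

theorem mulLift_apply (w : C_c(G × H, ℂ)) (F : C((G × H) ⧸ L, ℂ)) (x : G × H) :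
    mulLift L w F x = w x * F (toTorus L x) := rfl

theorem orbitSum_mulLift (w : C_c(G × H, ℂ)) (F : C((G × H) ⧸ L, ℂ)) (ξ : (G × H) ⧸ L) :
    orbitSum L (mulLift L w F) ξ = orbitSum L w ξ * F ξ := by
  induction ξ using QuotientAddGroup.induction_on with
  | H y =>
    change ∑' l : L, w (y + l) * F (toTorus L (y + l)) = (∑' l : L, w (y + l)) * F (toTorus L y)
    rw [← tsum_mul_right]
    refine tsum_congr fun l => ?_
    have : toTorus L (y + l) = toTorus L y := by rw [QuotientAddGroup.eq]; simp
    rw [this]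

/-- Unfolding: an `L`-invariant functional takes the same value at `g` and at
`w · (orbitSum g ∘ π)` when `w` is a Bruhat function. -/
theorem map_mulLift_orbitSum [LocallyCompactSpace G] [LocallyCompactSpace H]
    (J : C_c(G × H, ℂ) →ₗ[ℂ] ℂ) (hJ : ∀ l ∈ L, ∀ g, J (shift l g) = J g)
    (w : C_c(G × H, ℂ)) (hw : ∀ x, ∑' l : L, w (x + l) = 1) (g : C_c(G × H, ℂ)) :
    J (mulLift L w ⟨orbitSum L g, continuous_orbitSum L g⟩) = J g := by
  -- Only finitely many l let w meet the translate of g by l. Both sums are therefore finite and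
  -- commute with J, for which no continuity is assumed.
  have hfin := finite_lattice_translates L w.hasCompactSupport g.hasCompactSupport
  have h1 : mulLift L w ⟨orbitSum L g, continuous_orbitSum L g⟩ =
      ∑ l ∈ hfin.toFinset, w * shift (l : G × H) g := by
    ext x
    rw [mulLift_apply, CompactlySupportedContinuousMap.sum_apply]
    change w x * ∑' l : L, g (x + l) = ∑ l ∈ hfin.toFinset, w x * g (x + l)
    rw [← Finset.mul_sum]
    by_cases hx : w x = 0
    · simp [hx]
    congr 1
    refine tsum_eq_sum fun l hl => ?_
    by_contra h
    refine hl ?_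
    rw [Set.Finite.mem_toFinset]
    exact ⟨x, subset_tsupport _ hx, subset_tsupport _ h⟩
  have h2 : g = ∑ l ∈ hfin.toFinset, shift (-(l : G × H)) w * g := by
    ext x
    rw [CompactlySupportedContinuousMap.sum_apply]
    change g x = ∑ l ∈ hfin.toFinset, w (x + -(l : G × H)) * g x
    rw [← Finset.sum_mul]
    by_cases hx : g x = 0
    · simp [hx]
    have h3 : ∑ l ∈ hfin.toFinset, w (x + -(l : G × H)) = 1 := by
      rw [← hw x, ← (Equiv.neg L).tsum_eq]
      refine (tsum_eq_sum fun l hl => ?_).symm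
      by_contra h
      refine hl ?_
      rw [Set.Finite.mem_toFinset]
      refine ⟨x + -(l : G × H), subset_tsupport _ h, subset_tsupport _ ?_⟩
      simpa using hx
    rw [h3, one_mul]
  rw [h1, map_sum]
  conv_rhs => rw [h2, map_sum]
  refine Finset.sum_congr rfl fun l _ => ?_
  rw [← hJ _ (neg_mem l.2) (w * shift (l : G × H) g)]
  congr 1
  ext x
  change w (x + -(l : G × H)) * g (x + -(l : G × H) + l) = w (x + -(l : G × H)) * g x
  simp

/-- Integration against a complex Radon measure as a linear functional on `C_c`. -/
def ComplexRadonMeasure.toLinearMap {X : Type*} [TopologicalSpace X] (ρ : ComplexRadonMeasure X) :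
    C_c(X, ℂ) →ₗ[ℂ] ℂ :=
  have hi : ∀ g : C_c(X, ℂ), Integrable (fun x => g x * ρ.phase x) ρ.variation := fun g => by
    let _ : MeasurableSpace X := borel X
    have : BorelSpace X := ⟨rfl⟩
    have := ρ.regular
    refine Integrable.mono
      ((map_continuous g).integrable_of_hasCompactSupport g.hasCompactSupport)
      ((map_continuous g).measurable.mul ρ.measurable_phase).aestronglyMeasurable
      (ae_of_all _ fun x => ?_)
    rw [norm_mul, ρ.norm_phase, mul_one]
  { toFun := fun g => ρ.integral g
    map_add' := fun F F' => by
      unfold ComplexRadonMeasure.integral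
      let _ : MeasurableSpace X := borel X
      rw [← integral_add (hi F) (hi F')]
      simp only [CompactlySupportedContinuousMap.add_apply, add_mul]
    map_smul' := fun c F => by
      unfold ComplexRadonMeasure.integral
      let _ : MeasurableSpace X := borel X
      rw [RingHom.id_apply, smul_eq_mul, ← integral_const_mul]
      simp only [CompactlySupportedContinuousMap.smul_apply, smul_eq_mul, mul_assoc] }

/-- ρ_𝕋 is the image of w ρ for a Bruhat function w; `map_mulLift_orbitSum` turns ∫ w · (σ(g) ∘ π)
dρ back into ∫ g dρ. -/
theorem exists_isDisintegration [LocallyCompactSpace G] [LocallyCompactSpace H]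
    [CompactSpace ((G × H) ⧸ L)] {ρ : ComplexRadonMeasure (G × H)} (hρ : IsInvariantUnder L ρ) :
    ∃ ρT : ComplexRadonMeasure ((G × H) ⧸ L), IsDisintegration L ρ ρT := by
  obtain ⟨w, hw0, hw⟩ := exists_bruhat L
  obtain ⟨τ, hτ⟩ := ρ.exists_pushforward (continuous_toTorus L) (map_continuous w)
    w.hasCompactSupport hw0
  refine ⟨τ, fun g => ?_⟩
  have h := map_mulLift_orbitSum L ρ.toLinearMap hρ (complexify w)
    (fun x => by
      have := congrArg (fun r : ℝ => (r : ℂ)) (hw x)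
      simpa [Complex.ofReal_tsum] using this) g
  exact (h.symm.trans (hτ ⟨orbitSum L g, continuous_orbitSum L g⟩).symm)

end OrbitSums

/-! ### Haar measure of the torus -/

section HaarTorus

set_option linter.unusedSectionVars false

variable {G H : Type*} [AddCommGroup G] [TopologicalSpace G] [IsTopologicalAddGroup G] [T2Space G]
  [LocallyCompactSpace G] [SigmaCompactSpace G] [MeasurableSpace G] [BorelSpace G]
  [AddCommGroup H] [TopologicalSpace H] [IsTopologicalAddGroup H] [T2Space H]
  [LocallyCompactSpace H] [SigmaCompactSpace H] [MeasurableSpace H] [BorelSpace H]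

/-- Without second countability the product σ-algebra can be smaller than the Borel one. Compact
support is what makes a continuous function measurable for it. -/
theorem integrable_prod_of_hasCompactSupport {X Y E : Type*} [TopologicalSpace X]
    [TopologicalSpace Y] [MeasurableSpace X] [MeasurableSpace Y] [OpensMeasurableSpace X]
    [OpensMeasurableSpace Y] [NormedAddCommGroup E] (μ : Measure X) [SFinite μ]
    [IsFiniteMeasureOnCompacts μ] (ν : Measure Y) [SFinite ν] [IsFiniteMeasureOnCompacts ν]
    {g : X × Y → E} (hg : Continuous g) (hgc : HasCompactSupport g) :
    Integrable g (μ.prod ν) := by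
  obtain ⟨M, hM⟩ := hg.bounded_above_of_compact_support hgc
  have hK : IsCompact (tsupport g) := hgc
  have hm : AEStronglyMeasurable g (μ.prod ν) :=
    (hgc.stronglyMeasurable_of_prod hg).aestronglyMeasurable
  have hfin : (μ.prod ν) ((Prod.fst '' tsupport g) ×ˢ (Prod.snd '' tsupport g)) ≠ ∞ := by
    rw [Measure.prod_prod]
    exact ENNReal.mul_ne_top (hK.image continuous_fst).measure_ne_top
      (hK.image continuous_snd).measure_ne_top
  refine (integrableOn_iff_integrable_of_support_subset fun x hx => ?_).1
    (Measure.integrableOn_of_bounded hfin hm (ae_of_all _ hM))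
  exact ⟨⟨x, subset_tsupport _ hx, rfl⟩, ⟨x, subset_tsupport _ hx, rfl⟩⟩

variable (mG : Measure G) [mG.IsAddHaarMeasure] (mH : Measure H) [mH.IsAddHaarMeasure]
  (L : AddSubgroup (G × H)) [DiscreteTopology L]

instance measurableAdd_prod : MeasurableAdd (G × H) where
  measurable_const_add c :=
    ((measurable_const_add c.1).comp measurable_fst).prodMk
      ((measurable_const_add c.2).comp measurable_snd)
  measurable_add_const c :=
    ((measurable_add_const c.1).comp measurable_fst).prodMk
      ((measurable_add_const c.2).comp measurable_snd)

instance measurableConstVAdd_prod (L : AddSubgroup (G × H)) : MeasurableConstVAdd L (G × H) where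
  measurable_const_vadd l := measurable_const_add (l : G × H)

instance vaddInvariantMeasure_prod (L : AddSubgroup (G × H)) :
    VAddInvariantMeasure L (G × H) (mG.prod mH) where
  measure_preimage_vadd l s _ := measure_preimage_add (mG.prod mH) (l : G × H) s

/-- A discrete subgroup is closed, hence σ-compact here, and a discrete σ-compact space is
countable. -/
theorem countable_lattice (L : AddSubgroup (G × H)) [DiscreteTopology L] : Countable L := by
  have hcl : IsClosed (L : Set (G × H)) := AddSubgroup.isClosed_of_discrete
  have : SigmaCompactSpace L := hcl.isClosedEmbedding_subtypeVal.sigmaCompactSpace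
  exact countable_of_Lindelof_of_discrete

theorem IsFundamentalCell.isAddFundamentalDomain {L : AddSubgroup (G × H)} {Z : Set (G × H)}
    (hZ : IsFundamentalCell L Z) : IsAddFundamentalDomain L Z (mG.prod mH) where
  nullMeasurableSet := hZ.measurableSet.nullMeasurableSet
  ae_covers := ae_of_all _ fun x => by
    obtain ⟨z, hz, hzx⟩ := hZ.bijOn.surjOn (Set.mem_univ (toTorus L x))
    rw [eq_comm, QuotientAddGroup.eq] at hzx
    refine ⟨⟨-x + z, hzx⟩, ?_⟩
    change -x + z + x ∈ Z
    rwa [show -x + z + x = z by abel]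
  aedisjoint := fun a b hab => by
    refine Disjoint.aedisjoint (Set.disjoint_left.2 ?_)
    rintro _ ⟨x, hx, rfl⟩ ⟨y, hy, hyx⟩
    change (b : G × H) + y = a + x at hyx
    have hxy : x = y := by
      refine hZ.bijOn.injOn hx hy ?_
      rw [QuotientAddGroup.eq]
      have : -x + y = (a - b : L) := by
        rw [AddSubgroup.coe_sub, ← sub_eq_zero]
        rw [← sub_eq_zero] at hyx
        rw [← hyx]; abel
      rw [this]
      exact (a - b).2
    subst hxy
    exact hab (Subtype.ext (add_right_cancel hyx).symm)

/-- Cutting G × H into translates of Z turns ∫ w into the integral over Z of ∑_l w(x + l) = 1. -/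
theorem integral_bruhat {Z : Set (G × H)} (hZ : IsFundamentalCell L Z) {w : C_c(G × H, ℝ)}
    (hw0 : ∀ x, 0 ≤ w x) (hw : ∀ x, ∑' l : L, w (x + l) = 1) :
    ∫ x, w x ∂mG.prod mH = (mG.prod mH).real Z := by
  have := countable_lattice L
  have hwm : Measurable w := w.hasCompactSupport.measurable_of_prod (map_continuous w)
  rw [integral_eq_lintegral_of_nonneg_ae (ae_of_all _ hw0) hwm.aestronglyMeasurable,
    Measure.real]
  congr 1
  rw [(hZ.isAddFundamentalDomain mG mH).lintegral_eq_tsum'']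
  have hm : ∀ l : L, Measurable fun x : G × H => ENNReal.ofReal (w (l +ᵥ x)) := fun l =>
    (hwm.comp (measurable_const_vadd l)).ennreal_ofReal
  rw [← lintegral_tsum fun l => (hm l).aemeasurable]
  have : ∀ x : G × H, ∑' l : L, ENNReal.ofReal (w (l +ᵥ x)) = 1 := fun x => by
    rw [← ENNReal.ofReal_one, ← hw x, ENNReal.ofReal_tsum_of_nonneg (fun l => hw0 _)
      (summable_lattice_translates L w.hasCompactSupport x)]
    refine tsum_congr fun l => ?_
    rw [add_comm]; rfl
  simp only [this, lintegral_one, Measure.restrict_apply_univ]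

/-- By `integral_bruhat` the volume is ∫ w, and w is positive on a nonempty open set. Positivity of
the real number also excludes infinite volume, for which `Measure.real` would be 0. -/
theorem volume_cell_pos {Z : Set (G × H)} (hZ : IsFundamentalCell L Z)
    [CompactSpace ((G × H) ⧸ L)] : 0 < (mG.prod mH).real Z := by
  obtain ⟨w, hw0, hw⟩ := exists_bruhat L
  rw [← integral_bruhat mG mH L hZ hw0 hw]
  obtain ⟨x, hx⟩ : ∃ x, w x ≠ 0 := by
    by_contra! h
    simpa [h] using hw 0
  have hwi := integrable_prod_of_hasCompactSupport mG mH (map_continuous w) w.hasCompactSupport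
  rw [integral_pos_iff_support_of_nonneg hw0 hwi]
  have hopen : IsOpen (Function.support w) := (map_continuous w).isOpen_support
  obtain ⟨U, V, hU, hxU, hV, hxV, hUV⟩ := mem_nhds_prod_iff'.1 (hopen.mem_nhds hx)
  refine lt_of_lt_of_le ?_ (measure_mono hUV)
  rw [Measure.prod_prod]
  exact ENNReal.mul_pos (hU.measure_pos mG ⟨_, hxU⟩).ne' (hV.measure_pos mH ⟨_, hxV⟩).ne'

/-- Integration over `G × H` as a functional on `C_c(G × H)`. -/
def haarFunctional : C_c(G × H, ℂ) →ₗ[ℂ] ℂ where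
  toFun g := ∫ x, g x ∂mG.prod mH
  map_add' g g' := integral_add
    (integrable_prod_of_hasCompactSupport mG mH (map_continuous g) g.hasCompactSupport)
    (integrable_prod_of_hasCompactSupport mG mH (map_continuous g') g'.hasCompactSupport)
  map_smul' c _ := integral_smul c _

theorem haarFunctional_shift (x : G × H) (g : C_c(G × H, ℂ)) :
    haarFunctional mG mH (shift x g) = haarFunctional mG mH g :=
  integral_add_right_eq_self (μ := mG.prod mH) g x

/-- The normalized Haar measure on the torus `(G × H) / L`. -/
structure IsTorusHaar (v : ℝ) (m : @Measure ((G × H) ⧸ L) (borel _)) : Prop where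
  isProbabilityMeasure : @IsProbabilityMeasure _ (borel _) m
  regular : @Measure.Regular _ (borel _) _ m
  integral_orbitSum : ∀ g : C_c(G × H, ℂ),
    ∫ ξ, orbitSum L g ξ ∂m = (v : ℂ)⁻¹ * ∫ x, g x ∂mG.prod mH
  integral_add_right : ∀ (F : C((G × H) ⧸ L, ℂ)) (η : (G × H) ⧸ L),
    ∫ ξ, F (ξ + η) ∂m = ∫ ξ, F ξ ∂m

/-- The Riesz theorem is applied to the positive functional F ↦ v⁻¹ ∫ w · (F ∘ π). Unfolding gives
the integrals of all orbit sums, and translation invariance is inherited from G × H. -/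
theorem exists_isTorusHaar {Z : Set (G × H)} (hZ : IsFundamentalCell L Z)
    [CompactSpace ((G × H) ⧸ L)] :
    ∃ m, IsTorusHaar mG mH L ((mG.prod mH).real Z) m := by
  let _ : MeasurableSpace ((G × H) ⧸ L) := borel _
  have : BorelSpace ((G × H) ⧸ L) := ⟨rfl⟩
  -- Closedness of `L` makes the quotient Hausdorff.
  have hcl : IsClosed (L : Set (G × H)) := AddSubgroup.isClosed_of_discrete
  obtain ⟨w, hw0, hw⟩ := exists_bruhat L
  set v := (mG.prod mH).real Z
  have hv : 0 < v := volume_cell_pos mG mH L hZ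
  have hwv : ∫ x, w x ∂mG.prod mH = v := integral_bruhat mG mH L hZ hw0 hw
  have hwC : ∀ x, ∑' l : L, complexify w (x + l) = 1 := fun x => by
    have := congrArg (fun r : ℝ => (r : ℂ)) (hw x)
    simpa [Complex.ofReal_tsum] using this
  have hi : ∀ F : C_c((G × H) ⧸ L, ℝ),
      Integrable (fun x => v⁻¹ * (w x * F (toTorus L x))) (mG.prod mH) := fun F =>
    (integrable_prod_of_hasCompactSupport mG mH
      ((map_continuous w).mul ((map_continuous F).comp (continuous_toTorus L)))
      w.hasCompactSupport.mul_right).const_mul _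
  let Λ₀ : C_c((G × H) ⧸ L, ℝ) →ₗ[ℝ] ℝ :=
    { toFun := fun F => ∫ x, v⁻¹ * (w x * F (toTorus L x)) ∂mG.prod mH
      map_add' := fun F F' => by
        rw [← integral_add (hi F) (hi F')]
        simp only [CompactlySupportedContinuousMap.add_apply, mul_add]
      map_smul' := fun c F => by
        rw [RingHom.id_apply, smul_eq_mul, ← integral_const_mul]
        refine integral_congr_ae (ae_of_all _ fun x => ?_)
        simp only [CompactlySupportedContinuousMap.smul_apply, smul_eq_mul]
        ring }
  let Λ : C_c((G × H) ⧸ L, ℝ) →ₚ[ℝ] ℝ := PositiveLinearMap.mk₀ Λ₀ fun F hF =>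
    integral_nonneg fun x => mul_nonneg (inv_nonneg.2 hv.le) (mul_nonneg (hw0 x) (hF _))
  let m : Measure ((G × H) ⧸ L) := RealRMK.rieszMeasure Λ
  have hm : ∀ F : C_c((G × H) ⧸ L, ℝ),
      ∫ ξ, F ξ ∂m = ∫ x, v⁻¹ * (w x * F (toTorus L x)) ∂mG.prod mH := fun F =>
    RealRMK.integral_rieszMeasure Λ F
  have hreg : m.Regular := RealRMK.regular_rieszMeasure Λ
  have hmC : ∀ F : C((G × H) ⧸ L, ℂ),
      ∫ ξ, F ξ ∂m = (v : ℂ)⁻¹ * haarFunctional mG mH (mulLift L (complexify w) F) := fun F => by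
    have hFi : Integrable F m := F.continuous.integrable_of_hasCompactSupport
      (HasCompactSupport.of_compactSpace _)
    let Fre : C_c((G × H) ⧸ L, ℝ) :=
      ⟨⟨fun ξ => (F ξ).re, by fun_prop⟩, HasCompactSupport.of_compactSpace _⟩
    let Fim : C_c((G × H) ⧸ L, ℝ) :=
      ⟨⟨fun ξ => (F ξ).im, by fun_prop⟩, HasCompactSupport.of_compactSpace _⟩
    have hre := hm Fre
    have him := hm Fim
    have hgi := (integrable_prod_of_hasCompactSupport mG mH
      (map_continuous (mulLift L (complexify w) F))
      (mulLift L (complexify w) F).hasCompactSupport).const_mul (v : ℂ)⁻¹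
    change _ = (v : ℂ)⁻¹ * ∫ x, mulLift L (complexify w) F x ∂mG.prod mH
    rw [← integral_const_mul]
    apply Complex.ext
    · refine ((integral_re hFi).symm.trans hre).trans (Eq.trans ?_ (integral_re hgi))
      congr 1; funext x
      simp only [mulLift_apply, complexify_apply, ← Complex.ofReal_inv]
      simp [Fre]
    · refine ((integral_im hFi).symm.trans him).trans (Eq.trans ?_ (integral_im hgi))
      congr 1; funext x
      simp only [mulLift_apply, complexify_apply, ← Complex.ofReal_inv]
      simp [Fim]
  have hS : ∀ g : C_c(G × H, ℂ),
      ∫ ξ, orbitSum L g ξ ∂m = (v : ℂ)⁻¹ * haarFunctional mG mH g := fun g => by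
    rw [← map_mulLift_orbitSum L (haarFunctional mG mH)
      (fun l _ g => haarFunctional_shift mG mH l g) (complexify w) hwC g]
    exact hmC ⟨orbitSum L g, continuous_orbitSum L g⟩
  refine ⟨m, ⟨?_⟩, hreg, hS, fun F η => ?_⟩
  · let one : C_c((G × H) ⧸ L, ℝ) :=
      ⟨⟨fun _ => 1, continuous_const⟩, HasCompactSupport.of_compactSpace _⟩
    have h1 : ∫ _, (1 : ℝ) ∂m = 1 := by
      refine (hm one).trans ?_
      change ∫ x, v⁻¹ * (w x * 1) ∂mG.prod mH = 1
      simp only [mul_one]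
      rw [integral_const_mul, hwv, inv_mul_cancel₀ hv.ne']
    rw [integral_const, smul_eq_mul, mul_one, Measure.real] at h1
    have := congrArg ENNReal.ofReal h1
    rwa [ENNReal.ofReal_toReal (measure_ne_top m _), ENNReal.ofReal_one] at this
  · obtain ⟨x, rfl⟩ := QuotientAddGroup.mk_surjective η
    -- Every F on the torus is the orbit sum of w · (F ∘ π), so invariance need only be checked for
    -- orbit sums.
    have hF : ∀ ξ, orbitSum L (mulLift L (complexify w) F) ξ = F ξ := fun ξ => by
      rw [orbitSum_mulLift]
      obtain ⟨y, rfl⟩ := QuotientAddGroup.mk_surjective ξ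
      rw [orbitSum_mk, hwC, one_mul]
    calc ∫ ξ, F (ξ + toTorus L x) ∂m
        = ∫ ξ, orbitSum L (shift x (mulLift L (complexify w) F)) ξ ∂m := by
          congr 1; funext ξ; rw [orbitSum_shift, hF]
      _ = ∫ ξ, orbitSum L (mulLift L (complexify w) F) ξ ∂m := by
          rw [hS, hS, haarFunctional_shift]
      _ = ∫ ξ, F ξ ∂m := by simp only [hF]

end HaarTorus

/-! ### Correlations of compactly supported weights -/

section Tensor

variable {X Y : Type*} [TopologicalSpace X] [TopologicalSpace Y]

/-- The function `(x, y) ↦ φ(x) f(y)`. -/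
def tensor (φ : C_c(X, ℂ)) (f : C_c(Y, ℂ)) : C_c(X × Y, ℂ) where
  toFun p := φ p.1 * f p.2
  continuous_toFun := by fun_prop
  hasCompactSupport' := by
    refine HasCompactSupport.intro' (φ.hasCompactSupport.isCompact.prod f.hasCompactSupport)
      ((isClosed_tsupport φ).prod (isClosed_tsupport f)) fun p hp => ?_
    by_contra h
    exact hp ⟨subset_tsupport _ (left_ne_zero_of_mul h), subset_tsupport _ (right_ne_zero_of_mul h)⟩

@[simp]
theorem tensor_apply (φ : C_c(X, ℂ)) (f : C_c(Y, ℂ)) (p : X × Y) :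
    tensor φ f p = φ p.1 * f p.2 := rfl

end Tensor

section Correlation

set_option linter.unusedSectionVars false

variable {G H : Type*} [AddCommGroup G] [TopologicalSpace G] [IsTopologicalAddGroup G] [T2Space G]
  [LocallyCompactSpace G]
  [AddCommGroup H] [TopologicalSpace H] [IsTopologicalAddGroup H] [T2Space H]
  [LocallyCompactSpace H]
  (L : AddSubgroup (G × H)) [DiscreteTopology L] [CompactSpace ((G × H) ⧸ L)]
  (τ : ComplexRadonMeasure ((G × H) ⧸ L))

/-- `∫ σ_{ξ + ζ}(φ ⊗ f) dτ(ξ)`, the value at `φ` of the measure on `G` with weight `f`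
belonging to `ζ`. -/
def torusVal (φ : C_c(G, ℂ)) (f : C_c(H, ℂ)) (ζ : (G × H) ⧸ L) : ℂ :=
  τ.integral fun ξ => orbitSum L (tensor φ f) (ξ + ζ)

theorem continuous_torusVal (φ : C_c(G, ℂ)) (f : C_c(H, ℂ)) :
    Continuous (torusVal L τ φ f) :=
  τ.continuous_integral (F := fun ζ ξ => orbitSum L (tensor φ f) (ξ + ζ))
    ((continuous_orbitSum L _).comp (continuous_snd.add continuous_fst))

/-- The function `s ↦ conj (b(ζ - [s, 0]) ψ(-s))` with `b = torusVal φ f`. -/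
def torusInner (φ ψ : C_c(G, ℂ)) (f : C_c(H, ℂ)) (ζ : (G × H) ⧸ L) : C_c(G, ℂ) where
  toFun s := (starRingEnd ℂ) (torusVal L τ φ f (ζ - toTorus L (s, 0))) * reflectConj ψ s
  continuous_toFun := by
    refine Continuous.mul (Complex.continuous_conj.comp ?_) (map_continuous _)
    refine (continuous_torusVal L τ φ f).comp (continuous_const.sub ?_)
    exact (continuous_toTorus L).comp (by fun_prop)
  hasCompactSupport' := (reflectConj ψ).hasCompactSupport.mul_left

theorem torusInner_apply (φ ψ : C_c(G, ℂ)) (f : C_c(H, ℂ)) (ζ : (G × H) ⧸ L) (s : G) :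
    torusInner L τ φ ψ f ζ s =
      (starRingEnd ℂ) (torusVal L τ φ f (ζ - toTorus L (s, 0))) * reflectConj ψ s := rfl

/-- The correlation `∫∫ φ(s + t) ψ(t) dω(s) dω̃(t)` of the measure `ω = torusVal · f ζ`. -/
def torusCorr (φ ψ : C_c(G, ℂ)) (f : C_c(H, ℂ)) (ζ : (G × H) ⧸ L) : ℂ :=
  (starRingEnd ℂ) (torusVal L τ (torusInner L τ φ ψ f ζ) f ζ)

/-- The functions on G × H being summed vanish outside one compact set for all ζ, which gives joint
continuity, as needed to exchange the integrals over both torus variables. -/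
theorem continuous_orbitSum_torusInner (φ ψ : C_c(G, ℂ)) (f : C_c(H, ℂ)) :
    Continuous fun q : ((G × H) ⧸ L) × ((G × H) ⧸ L) =>
      orbitSum L (tensor (torusInner L τ φ ψ f q.1) f) q.2 := by
  refine continuous_orbitSum_param L (g := fun ζ => tensor (torusInner L τ φ ψ f ζ) f) ?_
    ((reflectConj ψ).hasCompactSupport.isCompact.prod f.hasCompactSupport) fun ζ x hx => ?_
  · simp only [tensor_apply, torusInner_apply]
    have h1 : Continuous fun q : ((G × H) ⧸ L) × (G × H) => q.1 - toTorus L (q.2.1, 0) :=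
      continuous_fst.sub ((continuous_toTorus L).comp (by fun_prop))
    exact ((Complex.continuous_conj.comp ((continuous_torusVal L τ φ f).comp h1)).mul
      (by fun_prop)).mul (by fun_prop)
  · rw [tensor_apply, torusInner_apply]
    by_contra h
    exact hx ⟨subset_tsupport _ (right_ne_zero_of_mul (left_ne_zero_of_mul h)),
      subset_tsupport _ (right_ne_zero_of_mul h)⟩

theorem continuous_torusCorr (φ ψ : C_c(G, ℂ)) (f : C_c(H, ℂ)) :
    Continuous (torusCorr L τ φ ψ f) := by
  refine Complex.continuous_conj.comp ?_
  exact τ.continuous_integral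
    (F := fun ζ η => orbitSum L (tensor (torusInner L τ φ ψ f ζ) f) (η + ζ))
    ((continuous_orbitSum_torusInner L τ φ ψ f).comp
      (continuous_fst.prodMk (continuous_snd.add continuous_fst)))

variable [MeasurableSpace H] [BorelSpace H] (mH : Measure H) [mH.IsAddHaarMeasure]

theorem selfConv_eq (f : H → ℂ) (h : H) :
    selfConv mH f h = ∫ k, f (k + h) * (starRingEnd ℂ) (f k) ∂mH := by
  unfold selfConv MeasureTheory.convolution
  rw [← integral_add_right_eq_self _ h]
  simp [tildeFun]

/-- `f ∗ f̃` for `f ∈ C_c(H)`. -/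
def autoConv (f : C_c(H, ℂ)) : C_c(H, ℂ) where
  toFun := selfConv mH f
  continuous_toFun := (reflectConj f).hasCompactSupport.continuous_convolution_right _
    ((map_continuous f).locallyIntegrable (μ := mH)) (map_continuous (reflectConj f))
  hasCompactSupport' := f.hasCompactSupport.convolution _ (reflectConj f).hasCompactSupport

theorem autoConv_apply (f : C_c(H, ℂ)) (h : H) : autoConv mH f h = selfConv mH f h := rfl

/-- Moving in the direction of H and averaging against the conjugate of f produces f ∗ f̃. For k in
the support of f only finitely many l contribute, so sum and integral commute. -/
theorem integral_orbitSum_tensor (φ : C_c(G, ℂ)) (f : C_c(H, ℂ)) (ξ : (G × H) ⧸ L) :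
    ∫ k, orbitSum L (tensor φ f) (ξ + toTorus L (0, k)) * (starRingEnd ℂ) (f k) ∂mH =
      orbitSum L (tensor φ (autoConv mH f)) ξ := by
  obtain ⟨z, rfl⟩ := QuotientAddGroup.mk_surjective ξ
  have hV : IsCompact ((fun k : H => z + ((0 : G), k)) '' tsupport f) :=
    f.hasCompactSupport.isCompact.image (by fun_prop)
  have hfin := finite_lattice_translates L hV
    (φ.hasCompactSupport.isCompact.prod f.hasCompactSupport)
  have hz : ∀ l ∉ hfin.toFinset, ∀ k,
      φ (z.1 + l.1.1) * (f (z.2 + k + l.1.2) * (starRingEnd ℂ) (f k)) = 0 := by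
    intro l hl k
    by_contra h
    refine hl ?_
    rw [Set.Finite.mem_toFinset]
    have h2 := right_ne_zero_of_mul (right_ne_zero_of_mul h)
    refine ⟨z + (0, k), ⟨k, subset_tsupport _ fun h0 => h2 (by rw [h0, map_zero]), rfl⟩,
      subset_tsupport _ ?_, subset_tsupport _ ?_⟩
    · simpa using left_ne_zero_of_mul h
    · exact left_ne_zero_of_mul (right_ne_zero_of_mul h)
  have h1 : ∀ k, orbitSum L (tensor φ f) (toTorus L z + toTorus L (0, k)) *
      (starRingEnd ℂ) (f k) =
        ∑ l ∈ hfin.toFinset, φ (z.1 + l.1.1) * (f (z.2 + k + l.1.2) * (starRingEnd ℂ) (f k)) := by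
    intro k
    refine Eq.trans ?_ (tsum_eq_sum (L := .unconditional L) fun l hl => hz l hl k)
    change (∑' l : L, φ (z.1 + 0 + l.1.1) * f (z.2 + k + l.1.2)) * _ = _
    rw [← tsum_mul_right]
    simp only [add_zero, mul_assoc]
  have hi : ∀ l : L, Integrable
      (fun k => φ (z.1 + l.1.1) * (f (z.2 + k + l.1.2) * (starRingEnd ℂ) (f k))) mH := fun l => by
    refine Continuous.integrable_of_hasCompactSupport ?_ ?_
    · exact continuous_const.mul ((by fun_prop : Continuous fun k => f (z.2 + k + l.1.2)).mul
        (Complex.continuous_conj.comp (map_continuous f)))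
    · exact ((f.hasCompactSupport.comp_left (map_zero (starRingEnd ℂ))).mul_left).mul_left
  change ∫ k, orbitSum L (tensor φ f) (toTorus L z + toTorus L (0, k)) *
      (starRingEnd ℂ) (f k) ∂mH = _
  simp only [h1]
  rw [integral_finsetSum _ fun l _ => hi l]
  have h2 : ∀ l : L, ∫ k, φ (z.1 + l.1.1) * (f (z.2 + k + l.1.2) * (starRingEnd ℂ) (f k)) ∂mH =
      tensor φ (autoConv mH f) (z + l) := fun l => by
    rw [integral_const_mul, tensor_apply, autoConv_apply, selfConv_eq]
    congr 2
    funext k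
    congr 2
    change z.2 + k + l.1.2 = k + (z.2 + l.1.2)
    abel
  rw [orbitSum_mk]
  simp only [h2]
  refine (tsum_eq_sum fun l hl => ?_).symm
  rw [← h2]
  simp only [hz l hl, integral_zero]

/-- Substitute l ↦ -l. For compactly supported weights this makes γ_ξ(φ) continuous in ξ. -/
theorem gammaAt_eq_orbitSum (v : ℝ) (f : C_c(H, ℂ)) (ξ : (G × H) ⧸ L) (φ : C_c(G, ℂ)) :
    gammaAt L mH v f ξ φ = (v : ℂ)⁻¹ * orbitSum L (tensor φ (autoConv mH f)) ξ := by
  obtain ⟨z, rfl⟩ := QuotientAddGroup.mk_surjective ξ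
  change (v : ℂ)⁻¹ * ∑' l : L, selfConv mH f (z.2 - l.1.2) * φ (z.1 - l.1.1) =
    (v : ℂ)⁻¹ * ∑' l : L, φ (z.1 + l.1.1) * selfConv mH f (z.2 + l.1.2)
  rw [← (Equiv.neg L).tsum_eq]
  congr 1
  refine tsum_congr fun l => ?_
  simp [mul_comm]

theorem ComplexRadonMeasure.integral_const_mul {X : Type*} [TopologicalSpace X]
    (τ : ComplexRadonMeasure X) (c : ℂ) (F : X → ℂ) :
    τ.integral (fun ξ => c * F ξ) = c * τ.integral F := by
  unfold ComplexRadonMeasure.integral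
  simp only [mul_assoc]
  exact MeasureTheory.integral_const_mul _ _

theorem continuous_toTorus_snd_sub (η : (G × H) ⧸ L) :
    Continuous fun k : H => toTorus L ((0 : G), k) - η :=
  ((continuous_toTorus L).comp (by fun_prop)).sub continuous_const

/-- The function `k ↦ conj (b([0, k] - η)) f(k)` with `b = torusVal φ f`. -/
def torusWeight (φ : C_c(G, ℂ)) (f : C_c(H, ℂ)) (η : (G × H) ⧸ L) : C_c(H, ℂ) where
  toFun k := (starRingEnd ℂ) (torusVal L τ φ f (toTorus L (0, k) - η)) * f k
  continuous_toFun := (Complex.continuous_conj.comp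
    ((continuous_torusVal L τ φ f).comp (continuous_toTorus_snd_sub L η))).mul (map_continuous f)
  hasCompactSupport' := f.hasCompactSupport.mul_left

theorem torusWeight_apply (φ : C_c(G, ℂ)) (f : C_c(H, ℂ)) (η : (G × H) ⧸ L) (k : H) :
    torusWeight L τ φ f η k =
      (starRingEnd ℂ) (torusVal L τ φ f (toTorus L (0, k) - η)) * f k := rfl

/-- At a representative p + l of θ the point θ - [p₁ + l₁, 0] is [0, p₂ + l₂], which involves only
the H-coordinate. So the correlation integrand splits as a tensor product, although `torusInner`
itself depends on θ. -/
theorem orbitSum_torusInner_sub (φ ψ : C_c(G, ℂ)) (f : C_c(H, ℂ)) (η θ : (G × H) ⧸ L) :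
    orbitSum L (tensor (torusInner L τ φ ψ f (θ - η)) f) θ =
      orbitSum L (tensor (reflectConj ψ) (torusWeight L τ φ f η)) θ := by
  obtain ⟨p, rfl⟩ := QuotientAddGroup.mk_surjective θ
  change ∑' l : L, torusInner L τ φ ψ f (toTorus L p - η) (p.1 + l.1.1) * f (p.2 + l.1.2) =
    ∑' l : L, reflectConj ψ (p.1 + l.1.1) * torusWeight L τ φ f η (p.2 + l.1.2)
  refine tsum_congr fun l => ?_
  have h0 : toTorus L p - toTorus L (p.1 + l.1.1, 0) = toTorus L (0, p.2 + l.1.2) := by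
    refine (QuotientAddGroup.eq (s := L) (a := p - (p.1 + l.1.1, 0))).2 ?_
    convert l.2 using 1
    ext <;> simp
  have h : toTorus L p - η - toTorus L (p.1 + l.1.1, 0) = toTorus L (0, p.2 + l.1.2) - η := by
    rw [sub_right_comm, h0]
  rw [torusInner_apply, torusWeight_apply, h]
  ring

/-- Fubini in k and ξ, followed by `integral_orbitSum_tensor`. -/
theorem integral_torusWeight (φ : C_c(G, ℂ)) (f : C_c(H, ℂ)) (η : (G × H) ⧸ L) :
    ∫ k, torusWeight L τ φ f η k ∂mH =
      (starRingEnd ℂ)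
        (τ.integral fun ξ => orbitSum L (tensor φ (autoConv mH f)) (ξ - η)) := by
  have h1 : ∀ ξ, orbitSum L (tensor φ (autoConv mH f)) (ξ - η) =
      ∫ k, orbitSum L (tensor φ f) (ξ + (toTorus L (0, k) - η)) * (starRingEnd ℂ) (f k) ∂mH := by
    intro ξ
    rw [← integral_orbitSum_tensor]
    have : ∀ k : H, ξ - η + toTorus L ((0 : G), k) = ξ + (toTorus L (0, k) - η) := fun k => by abel
    simp only [this]
  have hswap := τ.integral_integral_swap mH
    (F := fun k ξ => orbitSum L (tensor φ f) (ξ + (toTorus L (0, k) - η)) * (starRingEnd ℂ) (f k))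
    (((continuous_orbitSum L _).comp
      (continuous_snd.add ((continuous_toTorus_snd_sub L η).comp continuous_fst))).mul
      (Complex.continuous_conj.comp ((map_continuous f).comp continuous_fst)))
    f.hasCompactSupport (fun k hk ξ => by
      rw [image_eq_zero_of_notMem_tsupport hk]; simp)
  simp only [h1]
  rw [← hswap, ← integral_conj]
  refine integral_congr_ae (ae_of_all _ fun k => ?_)
  have := τ.integral_const_mul ((starRingEnd ℂ) (f k))
    fun ξ => orbitSum L (tensor φ f) (ξ + (toTorus L (0, k) - η))
  simp only [mul_comm ((starRingEnd ℂ) (f k))] at this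
  simp only [torusWeight_apply]
  rw [this, map_mul, Complex.conj_conj]
  rfl

variable [SigmaCompactSpace G] [SigmaCompactSpace H] [MeasurableSpace G] [BorelSpace G]
  (mG : Measure G) [mG.IsAddHaarMeasure] [mG.Regular]

/-- The mean of the correlations for a compactly supported weight. -/
theorem integral_torusCorr {v : ℝ} {m : @Measure ((G × H) ⧸ L) (borel _)}
    (hm : IsTorusHaar mG mH L v m) (φ ψ : C_c(G, ℂ)) (hψ : ∫ t, ψ t ∂mG = 1) (f : C_c(H, ℂ)) :
    ∫ ζ, torusCorr L τ φ ψ f ζ ∂m =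
      τ.conjIntegral fun η => τ.integral fun ξ => gammaAt L mH v f (ξ - η) φ := by
  let _ : MeasurableSpace ((G × H) ⧸ L) := borel _
  have : BorelSpace ((G × H) ⧸ L) := ⟨rfl⟩
  have := hm.isProbabilityMeasure
  have hcl : IsClosed (L : Set (G × H)) := AddSubgroup.isClosed_of_discrete
  unfold torusCorr ComplexRadonMeasure.conjIntegral
  rw [integral_conj]
  congr 1
  have hcont : Continuous fun q : ((G × H) ⧸ L) × ((G × H) ⧸ L) =>
      orbitSum L (tensor (torusInner L τ φ ψ f q.1) f) (q.2 + q.1) :=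
    (continuous_orbitSum_torusInner L τ φ ψ f).comp
      (continuous_fst.prodMk (continuous_snd.add continuous_fst))
  -- With the mean over ζ as the inner integral, ζ can be translated by the fixed η.
  refine (τ.integral_integral_swap m
    (F := fun ζ η => orbitSum L (tensor (torusInner L τ φ ψ f ζ) f) (η + ζ)) hcont
    isCompact_univ (fun p hp => absurd (Set.mem_univ p) hp)).trans ?_
  congr 1
  funext η
  let Ψ : C((G × H) ⧸ L, ℂ) :=
    ⟨_, continuous_orbitSum L (tensor (reflectConj ψ) (torusWeight L τ φ f η))⟩
  have hΨ : ∀ ζ, orbitSum L (tensor (torusInner L τ φ ψ f ζ) f) (η + ζ) = Ψ (ζ + η) := fun ζ => by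
    have := orbitSum_torusInner_sub L τ φ ψ f η (ζ + η)
    rw [add_sub_cancel_right] at this
    rw [add_comm]
    exact this
  have hone : ∫ t, reflectConj ψ t ∂mG = 1 := by
    simp only [reflectConj_apply]
    rw [integral_conj, integral_neg_eq_self (fun t => ψ t) mG, hψ, map_one]
  -- The unfolded integral factorises. The factor over G is 1, which is why the result does not
  -- depend on ψ.
  have hval : ∫ ξ, Ψ ξ ∂m = (v : ℂ)⁻¹ * ∫ k, torusWeight L τ φ f η k ∂mH := by
    refine (hm.integral_orbitSum _).trans ?_
    simp only [tensor_apply]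
    rw [integral_prod_mul, hone, one_mul]
  simp only [hΨ]
  rw [hm.integral_add_right Ψ η, hval, integral_torusWeight]
  simp only [gammaAt_eq_orbitSum]
  rw [τ.integral_const_mul, map_mul, map_inv₀, Complex.conj_ofReal]

end Correlation

/-! ### Unique ergodicity of hulls that are factors of compact groups -/

section UniqueErgodicity

set_option linter.unusedSectionVars false

theorem RadonFunctional.ext {X : Type*} [TopologicalSpace X] {ν ω : RadonFunctional X}
    (h : ∀ φ, ν φ = ω φ) : ν = ω := by
  cases ν
  cases ω
  congr 1
  exact LinearMap.ext h

instance {X : Type*} [TopologicalSpace X] : T2Space (RadonFunctional X) :=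
  T2Space.of_injective_continuous (f := fun (ν : RadonFunctional X) (φ : C_c(X, ℂ)) => ν φ)
    (fun _ _ h => RadonFunctional.ext (congrFun h)) continuous_induced_dom

theorem RadonFunctional.continuous_iff {X P : Type*} [TopologicalSpace X] [TopologicalSpace P]
    {β : P → RadonFunctional X} : Continuous β ↔ ∀ φ, Continuous fun p => β p φ :=
  continuous_induced_rng.trans continuous_pi_iff

variable {G : Type*} [AddCommGroup G] [TopologicalSpace G] [IsTopologicalAddGroup G]
  {T : Type*} [AddCommGroup T] [TopologicalSpace T] [IsTopologicalAddGroup T] [T2Space T]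
  [CompactSpace T]

theorem map_add_right_eq_self_of_integral [MeasurableSpace T] [BorelSpace T] {mT : Measure T}
    [mT.Regular] (hinv : ∀ (F : C(T, ℂ)) (η : T), ∫ ξ, F (ξ + η) ∂mT = ∫ ξ, F ξ ∂mT) (η : T) :
    mT.map (fun ξ => ξ + η) = mT := by
  have h1 : (mT.map (Homeomorph.addRight η)).Regular := Measure.Regular.map _
  change mT.map (Homeomorph.addRight η) = mT
  refine Measure.ext_of_integral_eq_on_compactlySupported fun F => ?_
  rw [integral_map (Homeomorph.addRight η).continuous.aemeasurable
    (map_continuous F).measurable.aestronglyMeasurable]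
  have h := hinv ⟨fun ξ => (F ξ : ℂ), by fun_prop⟩ η
  simp only [ContinuousMap.coe_mk, integral_complex_ofReal] at h
  exact_mod_cast h

/-- The image of the compact group T is closed, and the orbit of β(0), the image of a dense set, is
dense in it. -/
theorem hull_eq_range {β : T → RadonFunctional G} (hβ : Continuous β) {j : G → T}
    (hj : DenseRange j) (hβj : ∀ ζ t, β (ζ + j t) = translate t (β ζ)) : hull (β 0) = Set.range β := by
  have horb : (Set.range fun t => translate t (β 0)) = β '' Set.range j := by
    rw [← Set.range_comp]
    congr 1
    funext t
    rw [Function.comp_apply, ← hβj, zero_add]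
  unfold hull
  rw [horb]
  apply subset_antisymm
  · exact closure_minimal (Set.image_subset_range _ _) (isCompact_range hβ).isClosed
  · rw [← Set.image_univ, ← hj.closure_range]
    exact image_closure_subset_closure_image hβ

/-- Equivariance gives equality for η in the range of j, and density extends it. Thus addition of
elements of T descends to the hull. -/
theorem add_congr_of_apply_eq {β : T → RadonFunctional G} (hβ : Continuous β) {j : G → T}
    (hj : DenseRange j) (hβj : ∀ ζ t, β (ζ + j t) = translate t (β ζ))
    {ξ ξ' : T} (h : β ξ = β ξ') (η : T) : β (ξ + η) = β (ξ' + η) := by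
  have : (fun η => β (ξ + η)) = fun η => β (ξ' + η) := hj.equalizer
    (hβ.comp (by fun_prop)) (hβ.comp (by fun_prop)) (by
      funext t
      simp only [Function.comp_apply, hβj, h])
  exact congrFun this η

/-- T acts on the hull through b. An invariant m is invariant under the range of j, hence by density
under all of T. Averaging this invariance over T and exchanging integrals leaves an inner integral
that is the same for every ω. -/
theorem integral_hull_eq {β : T → RadonFunctional G} (hβ : Continuous β) {j : G → T}
    (hj : DenseRange j) (hβj : ∀ ζ t, β (ζ + j t) = translate t (β ζ))
    [MeasurableSpace T] [BorelSpace T] {mT : Measure T}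
    [IsProbabilityMeasure mT] (hinv : ∀ (F : C(T, ℂ)) (η : T), ∫ ξ, F (ξ + η) ∂mT = ∫ ξ, F ξ ∂mT)
    {m : @Measure (hull (β 0)) (borel _)} (hm : IsInvariantProbability (β 0) m)
    {b : T → hull (β 0)} (hb : ∀ ζ, (b ζ : RadonFunctional G) = β ζ) (F : C(hull (β 0), ℂ)) :
    ∫ ω, F ω ∂m = ∫ ζ, F (b ζ) ∂mT := by
  let _ : MeasurableSpace (hull (β 0)) := borel _
  have : BorelSpace (hull (β 0)) := ⟨rfl⟩
  have := hm.isProbabilityMeasure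
  have := hm.regular
  have hbc : Continuous b := continuous_induced_rng.2 (hβ.congr fun ζ => (hb ζ).symm)
  have hbs : Function.Surjective b := fun ω => by
    obtain ⟨ζ, hζ⟩ := (hull_eq_range hβ hj hβj).subset ω.2
    exact ⟨ζ, Subtype.ext ((hb ζ).trans hζ)⟩
  have hcomp : CompactSpace (hull (β 0)) := hbs.compactSpace hbc
  -- A set-theoretic section suffices: `hact` shows that its choice does not affect the action.
  obtain ⟨s, hs⟩ := hbs.hasRightInverse
  have hact : ∀ ξ η, b (s (b ξ) + η) = b (ξ + η) := fun ξ η => by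
    refine Subtype.ext ?_
    rw [hb, hb]
    refine add_congr_of_apply_eq hβ hj hβj ?_ η
    exact (hb _).symm.trans ((congrArg Subtype.val (hs (b ξ))).trans (hb ξ))
  let τ : ComplexRadonMeasure (hull (β 0)) :=
    { variation := m
      regular := hm.regular
      phase := fun _ => 1
      measurable_phase := measurable_const
      norm_phase := fun _ => norm_one }
  have hτ : ∀ F : hull (β 0) → ℂ, τ.integral F = ∫ ω, F ω ∂m := fun F => by
    simp only [ComplexRadonMeasure.integral, τ, mul_one]
  let Φ : T → hull (β 0) → ℂ := fun η ω => F (b (s ω + η))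
  have hΦ : Continuous (Function.uncurry Φ) := by
    -- As s need not be continuous, continuity of Φ is tested after pulling back along the closed
    -- surjection id × b, where s disappears.
    have hq : IsQuotientMap (Prod.map (id : T → T) b) := by
      have hc : Continuous (Prod.map (id : T → T) b) := continuous_id.prodMap hbc
      exact hc.isClosedMap.isQuotientMap hc (Function.surjective_id.prodMap hbs)
    rw [hq.continuous_iff]
    have : Function.uncurry Φ ∘ Prod.map id b = fun p : T × T => F (b (p.2 + p.1)) := by
      funext p
      exact congrArg F (hact p.2 p.1)
    rw [this]
    exact F.continuous.comp (hbc.comp (continuous_snd.add continuous_fst))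
  have hconst : ∀ η, τ.integral (Φ η) = τ.integral F := by
    have : (fun η => τ.integral (Φ η)) = fun _ => τ.integral F := hj.equalizer
      (τ.continuous_integral hΦ) continuous_const (by
        funext t
        have hac : Continuous (hullAction (β 0) t) :=
          continuous_induced_rng.2 ((continuous_translate t).comp continuous_subtype_val)
        have h1 : ∀ ω, b (s ω + j t) = hullAction (β 0) t ω := fun ω => by
          refine Subtype.ext ?_
          rw [hb, hβj]
          change translate t (β (s ω)) = translate t ω
          exact congrArg (translate t) ((hb _).symm.trans (congrArg Subtype.val (hs ω)))
        simp only [Function.comp_apply, hτ, Φ, h1]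
        conv_rhs => rw [← hm.invariant t]
        exact (integral_map hac.aemeasurable F.continuous.measurable.aestronglyMeasurable).symm)
    exact congrFun this
  have hswap := τ.integral_integral_swap mT hΦ isCompact_univ
    (fun p hp => absurd (Set.mem_univ p) hp)
  have hinner : ∀ ω, ∫ η, Φ η ω ∂mT = ∫ ζ, F (b ζ) ∂mT := fun ω => by
    have := hinv ⟨fun ξ => F (b ξ), F.continuous.comp hbc⟩ (s ω)
    simp only [ContinuousMap.coe_mk] at this
    rw [← this]
    simp only [Φ, add_comm]
  simp only [hconst, hinner, hτ, integral_const, probReal_univ, one_smul] at hswap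
  exact hswap

/-- The measure is the image of Haar measure under β. A compact-to-Hausdorff surjection is a
quotient map, so continuity of F ∘ β suffices for F to be continuous on the hull. -/
theorem exists_unique_invariantProbability {β : T → RadonFunctional G} (hβ : Continuous β) {j : G → T}
    (hj : DenseRange j) (hβj : ∀ ζ t, β (ζ + j t) = translate t (β ζ))
    [MeasurableSpace T] [BorelSpace T] {mT : Measure T}
    [IsProbabilityMeasure mT] [mT.Regular]
    (hinv : ∀ (F : C(T, ℂ)) (η : T), ∫ ξ, F (ξ + η) ∂mT = ∫ ξ, F ξ ∂mT) :
    ∃ m : @Measure (hull (β 0)) (borel _), IsInvariantProbability (β 0) m ∧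
      (∀ m', IsInvariantProbability (β 0) m' → m' = m) ∧
      ∀ F : RadonFunctional G → ℂ, Continuous (fun ζ => F (β ζ)) →
        ∫ ω, F ω.1 ∂m = ∫ ζ, F (β ζ) ∂mT := by
  let _ : MeasurableSpace (hull (β 0)) := borel _
  have : BorelSpace (hull (β 0)) := ⟨rfl⟩
  have hrange := hull_eq_range hβ hj hβj
  let b : T → hull (β 0) := fun ζ => ⟨β ζ, by rw [hrange]; exact ⟨ζ, rfl⟩⟩
  have hb : ∀ ζ, (b ζ : RadonFunctional G) = β ζ := fun ζ => rfl
  have hbc : Continuous b := continuous_induced_rng.2 hβ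
  have hbs : Function.Surjective b := fun ω => by
    obtain ⟨ζ, hζ⟩ := hrange.subset ω.2
    exact ⟨ζ, Subtype.ext hζ⟩
  have hcomp : CompactSpace (hull (β 0)) := hbs.compactSpace hbc
  have hprob : IsProbabilityMeasure (mT.map b) := Measure.isProbabilityMeasure_map hbc.aemeasurable
  have hir : (mT.map b).InnerRegularCompactLTTop :=
    Measure.InnerRegularCompactLTTop.map_of_continuous hbc
  have hinvm : IsInvariantProbability (β 0) (mT.map b) := by
    refine ⟨hprob, inferInstance, fun t => ?_⟩
    have hac : Continuous (hullAction (β 0) t) :=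
      continuous_induced_rng.2 ((continuous_translate t).comp continuous_subtype_val)
    have hcomm : hullAction (β 0) t ∘ b = b ∘ fun ζ => ζ + j t := by
      funext ζ
      exact Subtype.ext (hβj ζ t).symm
    rw [Measure.map_map hac.measurable hbc.measurable, hcomm,
      ← Measure.map_map hbc.measurable (by fun_prop : Continuous fun ζ => ζ + j t).measurable,
      map_add_right_eq_self_of_integral hinv]
  refine ⟨mT.map b, hinvm, fun m' hm' => ?_, fun F hF => ?_⟩
  · have := hm'.regular
    have := hm'.isProbabilityMeasure
    refine Measure.ext_of_integral_eq_on_compactlySupported fun F => ?_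
    let F' : C(hull (β 0), ℂ) := ⟨fun ω => (F ω : ℂ), by fun_prop⟩
    have h := (integral_hull_eq hβ hj hβj hinv hm' hb F').trans
      (integral_hull_eq hβ hj hβj hinv hinvm hb F').symm
    simp only [F', ContinuousMap.coe_mk, integral_complex_ofReal] at h
    exact_mod_cast h
  · have hq : IsQuotientMap b := hbc.isClosedMap.isQuotientMap hbc hbs
    have hFc : Continuous fun ω : hull (β 0) => F ω.1 := hq.continuous_iff.2 hF
    exact integral_map hbc.aemeasurable hFc.measurable.aestronglyMeasurable

end UniqueErgodicity

/-! ### Bounds by the total variation -/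

section TotalVariation

set_option linter.unusedSectionVars false

/-- The function `|g|`. -/
def normC {X : Type*} [TopologicalSpace X] (g : C_c(X, ℂ)) : C_c(X, ℂ) where
  toFun x := (‖g x‖ : ℂ)
  continuous_toFun := by fun_prop
  hasCompactSupport' := g.hasCompactSupport.comp_left (g := fun z : ℂ => (‖z‖ : ℂ)) (by simp)

@[simp]
theorem normC_apply {X : Type*} [TopologicalSpace X] (g : C_c(X, ℂ)) (x : X) :
    normC g x = (‖g x‖ : ℂ) := rfl

theorem normC_tensor {X Y : Type*} [TopologicalSpace X] [TopologicalSpace Y] (φ : C_c(X, ℂ))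
    (f : C_c(Y, ℂ)) : normC (tensor φ f) = tensor (normC φ) (normC f) := by
  ext x
  simp

variable {G H : Type*} [AddCommGroup G] [TopologicalSpace G] [IsTopologicalAddGroup G] [T2Space G]
  [LocallyCompactSpace G]
  [AddCommGroup H] [TopologicalSpace H] [IsTopologicalAddGroup H] [T2Space H]
  [LocallyCompactSpace H]
  (L : AddSubgroup (G × H)) [DiscreteTopology L]

/-- `∑_{l ∈ L} |g(x + l)|` for `ξ = [x]`. -/
def normSum (g : C_c(G × H, ℂ)) (ξ : (G × H) ⧸ L) : ℝ := (orbitSum L (normC g) ξ).re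

theorem normSum_mk (g : C_c(G × H, ℂ)) (x : G × H) :
    normSum L g (toTorus L x) = ∑' l : L, ‖g (x + l)‖ := by
  unfold normSum
  rw [orbitSum_mk]
  simp only [normC_apply]
  rw [← Complex.ofReal_tsum, Complex.ofReal_re]

theorem orbitSum_normC (g : C_c(G × H, ℂ)) (ξ : (G × H) ⧸ L) :
    orbitSum L (normC g) ξ = (normSum L g ξ : ℂ) := by
  obtain ⟨x, rfl⟩ := QuotientAddGroup.mk_surjective ξ
  rw [normSum_mk, orbitSum_mk, Complex.ofReal_tsum]
  rfl

theorem continuous_normSum (g : C_c(G × H, ℂ)) : Continuous (normSum L g) :=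
  Complex.continuous_re.comp (continuous_orbitSum L _)

theorem summable_norm_translates (g : C_c(G × H, ℂ)) (x : G × H) :
    Summable fun l : L => ‖g (x + l)‖ :=
  summable_lattice_translates L g.hasCompactSupport.norm x

theorem normSum_nonneg (g : C_c(G × H, ℂ)) (ξ : (G × H) ⧸ L) : 0 ≤ normSum L g ξ := by
  obtain ⟨x, rfl⟩ := QuotientAddGroup.mk_surjective ξ
  rw [normSum_mk]
  exact tsum_nonneg fun l => norm_nonneg _

theorem norm_orbitSum_le (g : C_c(G × H, ℂ)) (ξ : (G × H) ⧸ L) :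
    ‖orbitSum L g ξ‖ ≤ normSum L g ξ := by
  obtain ⟨x, rfl⟩ := QuotientAddGroup.mk_surjective ξ
  rw [normSum_mk, orbitSum_mk]
  exact norm_tsum_le_tsum_norm (summable_norm_translates L g x)

theorem normSum_le_mul {g g' : C_c(G × H, ℂ)} {c : ℝ} (h : ∀ x, ‖g x‖ ≤ c * ‖g' x‖)
    (ξ : (G × H) ⧸ L) : normSum L g ξ ≤ c * normSum L g' ξ := by
  obtain ⟨x, rfl⟩ := QuotientAddGroup.mk_surjective ξ
  rw [normSum_mk, normSum_mk, ← tsum_mul_left]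
  exact (summable_norm_translates L g x).tsum_le_tsum (fun l => h _)
    ((summable_norm_translates L g' x).mul_left c)

theorem normSum_le_add {g g₁ g₂ : C_c(G × H, ℂ)} (h : ∀ x, ‖g x‖ ≤ ‖g₁ x‖ + ‖g₂ x‖)
    (ξ : (G × H) ⧸ L) : normSum L g ξ ≤ normSum L g₁ ξ + normSum L g₂ ξ := by
  obtain ⟨x, rfl⟩ := QuotientAddGroup.mk_surjective ξ
  rw [normSum_mk, normSum_mk, normSum_mk,
    ← (summable_norm_translates L g₁ x).tsum_add (summable_norm_translates L g₂ x)]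
  exact (summable_norm_translates L g x).tsum_le_tsum (fun l => h _)
    ((summable_norm_translates L g₁ x).add (summable_norm_translates L g₂ x))

variable [CompactSpace ((G × H) ⧸ L)] (τ : ComplexRadonMeasure ((G × H) ⧸ L))

/-- `∫ ∑_{l ∈ L} |g(x + l)| d|τ|` with `x` a representative of `ξ + ζ`. -/
def torusNorm (g : C_c(G × H, ℂ)) (ζ : (G × H) ⧸ L) : ℝ :=
  ∫ ξ, normSum L g (ξ + ζ) ∂τ.variation

theorem integrable_normSum (g : C_c(G × H, ℂ)) (ζ : (G × H) ⧸ L) :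
    Integrable (fun ξ => normSum L g (ξ + ζ)) τ.variation := by
  let _ : MeasurableSpace ((G × H) ⧸ L) := borel _
  have : BorelSpace ((G × H) ⧸ L) := ⟨rfl⟩
  have := τ.isFiniteMeasure
  exact Continuous.integrable_of_hasCompactSupport
    ((continuous_normSum L g).comp (continuous_id.add continuous_const))
    (HasCompactSupport.of_compactSpace _)

theorem norm_integral_orbitSum_le (g : C_c(G × H, ℂ)) (ζ : (G × H) ⧸ L) :
    ‖τ.integral fun ξ => orbitSum L g (ξ + ζ)‖ ≤ torusNorm L τ g ζ :=
  τ.norm_integral_le ((continuous_normSum L g).comp (continuous_id.add continuous_const))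
    fun _ => norm_orbitSum_le L g _

theorem torusNorm_nonneg (g : C_c(G × H, ℂ)) (ζ : (G × H) ⧸ L) : 0 ≤ torusNorm L τ g ζ := by
  let _ : MeasurableSpace ((G × H) ⧸ L) := borel _
  exact integral_nonneg fun _ => normSum_nonneg L g _

theorem torusNorm_le_mul {g g' : C_c(G × H, ℂ)} {c : ℝ} (h : ∀ x, ‖g x‖ ≤ c * ‖g' x‖)
    (ζ : (G × H) ⧸ L) : torusNorm L τ g ζ ≤ c * torusNorm L τ g' ζ := by
  let _ : MeasurableSpace ((G × H) ⧸ L) := borel _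
  unfold torusNorm
  rw [← integral_const_mul]
  exact integral_mono (integrable_normSum L τ g ζ) ((integrable_normSum L τ g' ζ).const_mul c)
    fun _ => normSum_le_mul L h _

theorem torusNorm_le_add {g g₁ g₂ : C_c(G × H, ℂ)} (h : ∀ x, ‖g x‖ ≤ ‖g₁ x‖ + ‖g₂ x‖)
    (ζ : (G × H) ⧸ L) : torusNorm L τ g ζ ≤ torusNorm L τ g₁ ζ + torusNorm L τ g₂ ζ := by
  let _ : MeasurableSpace ((G × H) ⧸ L) := borel _
  unfold torusNorm
  rw [← integral_add (integrable_normSum L τ g₁ ζ) (integrable_normSum L τ g₂ ζ)]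
  exact integral_mono (integrable_normSum L τ g ζ)
    ((integrable_normSum L τ g₁ ζ).add (integrable_normSum L τ g₂ ζ))
    fun _ => normSum_le_add L h _

theorem abs_integral_orbitSum_normC (g : C_c(G × H, ℂ)) (ζ : (G × H) ⧸ L) :
    τ.abs.integral (fun ξ => orbitSum L (normC g) (ξ + ζ)) = (torusNorm L τ g ζ : ℂ) := by
  simp only [orbitSum_normC]
  exact τ.abs_integral_ofReal _

theorem exists_torusNorm_le (g : C_c(G × H, ℂ)) : ∃ C, ∀ ζ, torusNorm L τ g ζ ≤ C := by
  have hc : Continuous fun ζ => τ.abs.integral fun ξ => orbitSum L (normC g) (ξ + ζ) :=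
    τ.abs.continuous_integral ((continuous_orbitSum L _).comp (continuous_snd.add continuous_fst))
  obtain ⟨C, hC⟩ := hc.bounded_above_of_compact_support (HasCompactSupport.of_compactSpace _)
  refine ⟨C, fun ζ => ?_⟩
  have := hC ζ
  rw [abs_integral_orbitSum_normC, Complex.norm_real] at this
  exact (Real.le_norm_self _).trans this

variable [SigmaCompactSpace G] [SigmaCompactSpace H]

/-- The total variation of the disintegrated measure is dominated by that of the original one. -/
theorem IsDisintegration.torusNorm_le {ρ : ComplexRadonMeasure (G × H)}
    {τ : ComplexRadonMeasure ((G × H) ⧸ L)} (hτ : IsDisintegration L ρ τ)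
    (g : C_c(G × H, ℂ)) (x : G × H) :
    torusNorm L τ g (toTorus L x) ≤ ∫ y, ‖g (y + x)‖ ∂ρ.variation := by
  let _ : MeasurableSpace ((G × H) ⧸ L) := borel _
  have : BorelSpace ((G × H) ⧸ L) := ⟨rfl⟩
  have hcl : IsClosed (L : Set (G × H)) := AddSubgroup.isClosed_of_discrete
  have := τ.regular
  refine integral_le_of_norm_integral_mul_le τ.variation τ.measurable_phase τ.norm_phase
    ((continuous_normSum L g).comp (continuous_id.add continuous_const))
    (HasCompactSupport.of_compactSpace _) fun k hk => ?_
  let k' : C((G × H) ⧸ L, ℂ) := ⟨k, map_continuous k⟩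
  -- A test function k on the torus is lifted to k ∘ π times |g(· + x)|. Its integral against ρ is
  -- bounded by |ρ| because |k| ≤ 1; no formula for |τ| in terms of |ρ| is required.
  have h1 : τ.integral (orbitSum L (mulLift L (shift x (normC g)) k')) =
      ∫ ξ, (normSum L g (ξ + toTorus L x) : ℂ) * k ξ * τ.phase ξ ∂τ.variation := by
    unfold ComplexRadonMeasure.integral
    congr 1
    funext ξ
    rw [orbitSum_mulLift, orbitSum_shift, orbitSum_normC]
    rfl
  change ‖∫ ξ, (normSum L g (ξ + toTorus L x) : ℂ) * k ξ * τ.phase ξ ∂τ.variation‖ ≤ _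
  rw [← h1, ← hτ]
  let _ : MeasurableSpace (G × H) := borel _
  have : BorelSpace (G × H) := ⟨rfl⟩
  have := ρ.regular
  refine norm_integral_le_of_norm_le ?_ (ae_of_all _ fun y => ?_)
  · exact Continuous.integrable_of_hasCompactSupport (map_continuous (shift x g)).norm
      (shift x g).hasCompactSupport.norm
  · rw [norm_mul, ρ.norm_phase, mul_one, mulLift_apply, norm_mul]
    change ‖(‖g (y + x)‖ : ℂ)‖ * ‖k _‖ ≤ _
    rw [Complex.norm_real, norm_norm]
    exact mul_le_of_le_one_right (norm_nonneg _) (hk _)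

/-- A disintegration of a nonzero measure is nonzero. -/
theorem IsDisintegration.variation_ne_zero {ρ : ComplexRadonMeasure (G × H)}
    {τ : ComplexRadonMeasure ((G × H) ⧸ L)} (hτ : IsDisintegration L ρ τ)
    (hρ : ρ.variation ≠ 0) : τ.variation ≠ 0 := by
  intro h0
  let _ : MeasurableSpace (G × H) := borel _
  have : BorelSpace (G × H) := ⟨rfl⟩
  have := ρ.regular
  have hzero : ∀ g : C_c(G × H, ℂ), ρ.integral g = 0 := fun g => by
    rw [hτ g]
    unfold ComplexRadonMeasure.integral
    rw [h0, integral_zero_measure]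
  obtain ⟨K, hK, hK0⟩ := Measure.Regular.exists_isCompact_not_null.2 hρ
  obtain ⟨χ, hχ1, -, hχc, hχ01⟩ :=
    exists_continuous_one_zero_of_isCompact hK isClosed_empty (Set.disjoint_empty K)
  have hle : ∫ y, χ y ∂ρ.variation ≤ 0 := by
    refine integral_le_of_norm_integral_mul_le ρ.variation ρ.measurable_phase ρ.norm_phase
      χ.continuous hχc fun k _ => ?_
    have := hzero (complexify ⟨χ, hχc⟩ * k)
    refine le_of_eq ((congrArg norm this).trans norm_zero)
  have hge : ρ.variation.real K ≤ ∫ y, χ y ∂ρ.variation := by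
    have hi := χ.continuous.integrable_of_hasCompactSupport (μ := ρ.variation) hχc
    have h1 : ∫ y in K, χ y ∂ρ.variation = ρ.variation.real K := by
      rw [setIntegral_congr_fun hK.measurableSet (g := fun _ => (1 : ℝ)) fun y hy => hχ1 hy]
      simp
    rw [← h1]
    exact setIntegral_le_integral hi (ae_of_all _ fun y => (hχ01 y).1)
  have : ρ.variation.real K = 0 := le_antisymm (hge.trans hle) measureReal_nonneg
  rw [Measure.real, ENNReal.toReal_eq_zero_iff] at this
  exact this.elim hK0 hK.measure_ne_top

end TotalVariation

/-! ### Approximation by compactly supported weights -/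

section Cutoff

/-- An increasing sequence of compactly supported functions with values in `[0, 1]` that are
eventually equal to `1` on every compact set. -/
structure IsCutoffSeq {X : Type*} [TopologicalSpace X] (χ : ℕ → C_c(X, ℝ)) : Prop where
  nonneg : ∀ n x, 0 ≤ χ n x
  le_one : ∀ n x, χ n x ≤ 1
  mono : ∀ x, Monotone fun n => χ n x
  eventually_one : ∀ Q : Set X, IsCompact Q → ∃ N, ∀ n ≥ N, ∀ x ∈ Q, χ n x = 1

theorem exists_isCutoffSeq (X : Type*) [TopologicalSpace X] [T2Space X] [LocallyCompactSpace X]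
    [SigmaCompactSpace X] : ∃ χ : ℕ → C_c(X, ℝ), IsCutoffSeq χ := by
  let K := CompactExhaustion.choice X
  have h : ∀ n, ∃ χ : C(X, ℝ), Set.EqOn χ 1 (K n) ∧ Set.EqOn χ 0 (interior (K (n + 1)))ᶜ ∧
      HasCompactSupport χ ∧ ∀ x, χ x ∈ Set.Icc (0 : ℝ) 1 := fun n =>
    exists_continuous_one_zero_of_isCompact (K.isCompact n) isOpen_interior.isClosed_compl
      (Set.disjoint_compl_right_iff_subset.2 (K.subset_interior_succ n))
  choose χ h1 h0 hc h01 using h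
  refine ⟨fun n => ⟨χ n, hc n⟩, fun n x => (h01 n x).1, fun n x => (h01 n x).2,
    fun x => monotone_nat_of_le_succ fun n => ?_, fun Q hQ => ?_⟩
  · change χ n x ≤ χ (n + 1) x
    by_cases hx : x ∈ interior (K (n + 1))
    · rw [h1 (n + 1) (interior_subset hx)]
      exact (h01 n x).2
    · rw [h0 n hx]
      exact (h01 (n + 1) x).1
  · obtain ⟨N, hN⟩ := K.exists_superset_of_isCompact hQ
    exact ⟨N, fun n hn x hx => h1 n (K.subset hn (hN hx))⟩

theorem IsCutoffSeq.eventually_eq_one {X : Type*} [TopologicalSpace X] {χ : ℕ → C_c(X, ℝ)}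
    (hχ : IsCutoffSeq χ) (x : X) : ∀ᶠ n in atTop, χ n x = 1 := by
  obtain ⟨N, hN⟩ := hχ.eventually_one {x} isCompact_singleton
  exact eventually_atTop.2 ⟨N, fun n hn => hN n hn x rfl⟩

/-- The function `χ f`. -/
def cutoff {X : Type*} [TopologicalSpace X] (χ : C_c(X, ℝ)) (f : C(X, ℂ)) : C_c(X, ℂ) where
  toFun x := (χ x : ℂ) * f x
  continuous_toFun := by fun_prop
  hasCompactSupport' := (complexify χ).hasCompactSupport.mul_right

@[simp]
theorem cutoff_apply {X : Type*} [TopologicalSpace X] (χ : C_c(X, ℝ)) (f : C(X, ℂ)) (x : X) :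
    cutoff χ f x = (χ x : ℂ) * f x := rfl

theorem IsCutoffSeq.norm_cutoff {X : Type*} [TopologicalSpace X] {χ : ℕ → C_c(X, ℝ)}
    (hχ : IsCutoffSeq χ) (f : C(X, ℂ)) (n : ℕ) (x : X) :
    ‖cutoff (χ n) f x‖ = χ n x * ‖f x‖ := by
  rw [cutoff_apply, norm_mul, Complex.norm_real, Real.norm_of_nonneg (hχ.nonneg n x)]

theorem IsCutoffSeq.norm_cutoff_le {X : Type*} [TopologicalSpace X] {χ : ℕ → C_c(X, ℝ)}
    (hχ : IsCutoffSeq χ) (f : C(X, ℂ)) (n : ℕ) (x : X) : ‖cutoff (χ n) f x‖ ≤ ‖f x‖ := by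
  rw [hχ.norm_cutoff]
  exact mul_le_of_le_one_left (norm_nonneg _) (hχ.le_one n x)

theorem IsCutoffSeq.norm_cutoff_mono {X : Type*} [TopologicalSpace X] {χ : ℕ → C_c(X, ℝ)}
    (hχ : IsCutoffSeq χ) (f : C(X, ℂ)) (x : X) : Monotone fun n => ‖cutoff (χ n) f x‖ :=
  fun n m hnm => by
    simp only [hχ.norm_cutoff]
    exact mul_le_mul_of_nonneg_right (hχ.mono x hnm) (norm_nonneg _)

theorem IsCutoffSeq.tendsto_cutoff {X : Type*} [TopologicalSpace X] {χ : ℕ → C_c(X, ℝ)}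
    (hχ : IsCutoffSeq χ) (f : C(X, ℂ)) (x : X) :
    Tendsto (fun n => cutoff (χ n) f x) atTop (𝓝 (f x)) := by
  refine tendsto_const_nhds.congr' ?_
  filter_upwards [hχ.eventually_eq_one x] with n hn
  rw [cutoff_apply, hn, Complex.ofReal_one, one_mul]

end Cutoff

/-! ### Uniform limits of compactly supported weights on the torus. -/

section Approximation

set_option linter.unusedSectionVars false

variable {G H : Type*} [AddCommGroup G] [TopologicalSpace G] [IsTopologicalAddGroup G] [T2Space G]
  [LocallyCompactSpace G]
  [AddCommGroup H] [TopologicalSpace H] [IsTopologicalAddGroup H] [T2Space H]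
  [LocallyCompactSpace H]
  (L : AddSubgroup (G × H)) [DiscreteTopology L] [CompactSpace ((G × H) ⧸ L)]
  (τ : ComplexRadonMeasure ((G × H) ⧸ L))

theorem ComplexRadonMeasure.integral_sub {T : Type*} [TopologicalSpace T] [CompactSpace T]
    (τ : ComplexRadonMeasure T) {F F' : T → ℂ} (hF : Continuous F) (hF' : Continuous F') :
    τ.integral (fun ξ => F ξ - F' ξ) = τ.integral F - τ.integral F' :=
  map_sub τ.toCLM ⟨F, hF⟩ ⟨F', hF'⟩

theorem orbitSum_sub (g g' : C_c(G × H, ℂ)) (ξ : (G × H) ⧸ L) :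
    orbitSum L (g - g') ξ = orbitSum L g ξ - orbitSum L g' ξ := by
  obtain ⟨x, rfl⟩ := QuotientAddGroup.mk_surjective ξ
  simp only [orbitSum_mk]
  exact (summable_lattice_translates L g.hasCompactSupport x).tsum_sub
    (summable_lattice_translates L g'.hasCompactSupport x)

theorem torusVal_sub_of_tensor {φ φ₁ φ₂ : C_c(G, ℂ)} {f f₁ f₂ : C_c(H, ℂ)}
    (h : tensor φ f = tensor φ₁ f₁ - tensor φ₂ f₂) (ζ : (G × H) ⧸ L) :
    torusVal L τ φ f ζ = torusVal L τ φ₁ f₁ ζ - torusVal L τ φ₂ f₂ ζ := by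
  unfold torusVal
  rw [← τ.integral_sub (F := fun ξ => orbitSum L (tensor φ₁ f₁) (ξ + ζ))
    (F' := fun ξ => orbitSum L (tensor φ₂ f₂) (ξ + ζ))
    ((continuous_orbitSum L _).comp (continuous_id.add continuous_const))
    ((continuous_orbitSum L _).comp (continuous_id.add continuous_const))]
  simp only [h, orbitSum_sub]

theorem torusVal_sub_right (φ : C_c(G, ℂ)) (f f' : C_c(H, ℂ)) (ζ : (G × H) ⧸ L) :
    torusVal L τ φ (f - f') ζ = torusVal L τ φ f ζ - torusVal L τ φ f' ζ :=
  torusVal_sub_of_tensor L τ (by ext; simp [mul_sub]) ζ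

theorem torusVal_sub_left (φ φ' : C_c(G, ℂ)) (f : C_c(H, ℂ)) (ζ : (G × H) ⧸ L) :
    torusVal L τ (φ - φ') f ζ = torusVal L τ φ f ζ - torusVal L τ φ' f ζ :=
  torusVal_sub_of_tensor L τ (by ext; simp [sub_mul]) ζ

theorem torusVal_shift (φ : C_c(G, ℂ)) (f : C_c(H, ℂ)) (ζ : (G × H) ⧸ L) (t : G) :
    torusVal L τ (shift t φ) f ζ = torusVal L τ φ f (ζ + toTorus L (t, 0)) := by
  unfold torusVal
  congr 1
  funext ξ
  have : tensor (shift t φ) f = shift (t, 0) (tensor φ f) := by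
    ext x
    simp
  rw [this, orbitSum_shift, add_assoc]

theorem norm_torusVal_le (φ : C_c(G, ℂ)) (f : C_c(H, ℂ)) (ζ : (G × H) ⧸ L) :
    ‖torusVal L τ φ f ζ‖ ≤ torusNorm L τ (tensor φ f) ζ :=
  norm_integral_orbitSum_le L τ _ ζ

/-- The weights `fn n` converge with respect to `|τ|`, uniformly in all translates. -/
structure IsUniformApprox (fn : ℕ → C_c(H, ℂ)) : Prop where
  cauchy : ∀ φ : C_c(G, ℂ), ∀ ε > 0, ∃ N, ∀ n ≥ N, ∀ m ≥ N, ∀ ζ,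
    torusNorm L τ (tensor φ (fn m - fn n)) ζ ≤ ε
  bounded : ∀ φ : C_c(G, ℂ), ∃ C, 0 ≤ C ∧ ∀ n ζ, torusNorm L τ (tensor φ (fn n)) ζ ≤ C

variable {L τ} {fn : ℕ → C_c(H, ℂ)} {β : (G × H) ⧸ L → RadonFunctional G}

/-- One N for φ serves every test function dominated by a multiple of |φ|. This matters for
correlations, where the test function itself varies with ζ and n. -/
theorem norm_sub_torusVal_le
    (hβ : ∀ ζ φ, Tendsto (fun n => torusVal L τ φ (fn n) ζ) atTop (𝓝 (β ζ φ)))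
    {φ φ' : C_c(G, ℂ)} {c ε : ℝ} (hc : 0 ≤ c)
    (hφ : ∀ s, ‖φ' s‖ ≤ c * ‖φ s‖) {N n : ℕ} {ζ : (G × H) ⧸ L}
    (hN : ∀ m ≥ N, torusNorm L τ (tensor φ (fn m - fn n)) ζ ≤ ε) :
    ‖β ζ φ' - torusVal L τ φ' (fn n) ζ‖ ≤ c * ε := by
  refine le_of_tendsto ((hβ ζ φ').sub_const _).norm ?_
  filter_upwards [eventually_ge_atTop N] with m hm
  rw [← torusVal_sub_right]
  refine (norm_torusVal_le L τ _ _ ζ).trans ((torusNorm_le_mul L τ (fun x => ?_) ζ).trans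
    (mul_le_mul_of_nonneg_left (hN m hm) hc))
  rw [tensor_apply, tensor_apply, norm_mul, norm_mul, ← mul_assoc]
  exact mul_le_mul_of_nonneg_right (hφ _) (norm_nonneg _)

theorem IsUniformApprox.tendstoUniformly (hfn : IsUniformApprox L τ fn)
    (hβ : ∀ ζ φ, Tendsto (fun n => torusVal L τ φ (fn n) ζ) atTop (𝓝 (β ζ φ)))
    (φ : C_c(G, ℂ)) :
    TendstoUniformly (fun n ζ => torusVal L τ φ (fn n) ζ) (fun ζ => β ζ φ) atTop := by
  rw [Metric.tendstoUniformly_iff]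
  intro ε hε
  obtain ⟨N, hN⟩ := hfn.cauchy φ (ε / 2) (half_pos hε)
  filter_upwards [eventually_ge_atTop N] with n hn ζ
  rw [dist_eq_norm]
  have := norm_sub_torusVal_le (c := 1) hβ zero_le_one (fun s => (one_mul ‖φ s‖).ge)
    (fun m hm => hN n hn m hm ζ)
  linarith

theorem IsUniformApprox.continuous (hfn : IsUniformApprox L τ fn)
    (hβ : ∀ ζ φ, Tendsto (fun n => torusVal L τ φ (fn n) ζ) atTop (𝓝 (β ζ φ))) :
    Continuous β :=
  RadonFunctional.continuous_iff.2 fun φ => (hfn.tendstoUniformly hβ φ).continuous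
    (Frequently.of_forall fun n => continuous_torusVal L τ φ (fn n))

theorem apply_add_toTorus
    (hβ : ∀ ζ φ, Tendsto (fun n => torusVal L τ φ (fn n) ζ) atTop (𝓝 (β ζ φ)))
    (ζ : (G × H) ⧸ L) (t : G) : β (ζ + toTorus L (t, 0)) = translate t (β ζ) := by
  refine RadonFunctional.ext fun φ => tendsto_nhds_unique (hβ _ φ) ?_
  simp only [← torusVal_shift]
  exact hβ ζ (shift t φ)

/-- The correlations for the weights `fn n` converge uniformly. -/
theorem IsUniformApprox.tendstoUniformly_correlation (hfn : IsUniformApprox L τ fn)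
    (hβ : ∀ ζ φ, Tendsto (fun n => torusVal L τ φ (fn n) ζ) atTop (𝓝 (β ζ φ)))
    (φ ψ : C_c(G, ℂ)) :
    TendstoUniformly (fun n ζ => torusCorr L τ φ ψ (fn n) ζ)
      (fun ζ => correlation (β ζ) φ ψ) atTop := by
  obtain ⟨C₁, hC₁, hb₁⟩ := hfn.bounded φ
  obtain ⟨C₂, hC₂, hb₂⟩ := hfn.bounded (reflectConj ψ)
  have hval : ∀ ζ, ‖β ζ φ‖ ≤ C₁ := fun ζ =>
    le_of_tendsto (hβ ζ φ).norm (Eventually.of_forall fun n =>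
      (norm_torusVal_le L τ φ (fn n) ζ).trans (hb₁ n ζ))
  rw [Metric.tendstoUniformly_iff]
  intro ε hε
  -- The two errors below are C₁ δ and δ C₂; adding 1 keeps the denominator positive.
  set δ : ℝ := ε / (2 * (C₁ + C₂ + 1)) with hδdef
  have hδ : 0 < δ := by positivity
  obtain ⟨N₁, hN₁⟩ := hfn.cauchy φ δ hδ
  obtain ⟨N₂, hN₂⟩ := hfn.cauchy (reflectConj ψ) δ hδ
  filter_upwards [eventually_ge_atTop (max N₁ N₂)] with n hn ζ
  have hn₁ : N₁ ≤ n := (le_max_left _ _).trans hn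
  have hn₂ : N₂ ≤ n := (le_max_right _ _).trans hn
  set r : C_c(G, ℂ) := reflectConj (innerCorrelation (β ζ) φ ψ)
  set rn : C_c(G, ℂ) := torusInner L τ φ ψ (fn n) ζ
  -- Equivariance turns the shift of the test function by -s into the move of the base point to ζ -
  -- [s, 0], the form used in `torusInner`.
  have hr : ∀ s, r s =
      (starRingEnd ℂ) (β (ζ - toTorus L (s, 0)) φ) * reflectConj ψ s := fun s => by
    have h1 : ζ - toTorus L (s, 0) = ζ + toTorus L (-s, 0) := by
      rw [sub_eq_add_neg, ← QuotientAddGroup.mk_neg]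
      simp
    rw [h1, apply_add_toTorus hβ]
    change (starRingEnd ℂ) (β ζ (shift (-s) φ) * ψ (-s)) = _
    rw [map_mul]
    rfl
  have hrle : ∀ s, ‖r s‖ ≤ C₁ * ‖reflectConj ψ s‖ := fun s => by
    rw [hr, norm_mul, RCLike.norm_conj]
    exact mul_le_mul_of_nonneg_right (hval _) (norm_nonneg _)
  have hrn : ∀ s, ‖(r - rn) s‖ ≤ δ * ‖reflectConj ψ s‖ := fun s => by
    change ‖r s - rn s‖ ≤ _
    rw [hr, torusInner_apply, ← sub_mul, ← map_sub, norm_mul, RCLike.norm_conj]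
    refine mul_le_mul_of_nonneg_right ?_ (norm_nonneg _)
    have := norm_sub_torusVal_le (c := 1) (ζ := ζ - toTorus L (s, 0)) hβ zero_le_one
      (fun s => (one_mul ‖φ s‖).ge) (fun m hm => hN₁ n hn₁ m hm _)
    rwa [one_mul] at this
  -- The limit is replaced by the n-th weight in the outer measure here, and in the inner function
  -- in `h2`.
  have h1 : ‖β ζ r - torusVal L τ r (fn n) ζ‖ ≤ C₁ * δ :=
    norm_sub_torusVal_le hβ hC₁ hrle (fun m hm => hN₂ n hn₂ m hm ζ)
  have h2 : ‖torusVal L τ r (fn n) ζ - torusVal L τ rn (fn n) ζ‖ ≤ δ * C₂ := by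
    rw [← torusVal_sub_left]
    refine (norm_torusVal_le L τ _ _ ζ).trans ((torusNorm_le_mul L τ (fun x => ?_) ζ).trans
      (mul_le_mul_of_nonneg_left (hb₂ n ζ) hδ.le))
    rw [tensor_apply, tensor_apply, norm_mul, norm_mul, ← mul_assoc]
    exact mul_le_mul_of_nonneg_right (hrn _) (norm_nonneg _)
  rw [dist_eq_norm]
  change ‖(starRingEnd ℂ) (β ζ r) - (starRingEnd ℂ) (torusVal L τ rn (fn n) ζ)‖ < ε
  rw [← map_sub, RCLike.norm_conj]
  calc ‖β ζ r - torusVal L τ rn (fn n) ζ‖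
      = ‖(β ζ r - torusVal L τ r (fn n) ζ) +
          (torusVal L τ r (fn n) ζ - torusVal L τ rn (fn n) ζ)‖ := by congr 1; ring
    _ ≤ C₁ * δ + δ * C₂ := (norm_add_le _ _).trans (add_le_add h1 h2)
    _ ≤ (C₁ + C₂ + 1) * δ := by nlinarith
    _ = ε / 2 := by rw [hδdef]; field_simp
    _ < ε := half_lt_self hε

end Approximation

/-! ### Admissible weights as uniform limits of their cutoffs. -/

section Admissible

set_option linter.unusedSectionVars false

variable {G H : Type*} [AddCommGroup G] [TopologicalSpace G] [IsTopologicalAddGroup G] [T2Space G]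
  [LocallyCompactSpace G]
  [AddCommGroup H] [TopologicalSpace H] [IsTopologicalAddGroup H] [T2Space H]
  [LocallyCompactSpace H] [MeasurableSpace H] [BorelSpace H]
  {ρ : ComplexRadonMeasure (G × H)} {f : H → ℂ}

theorem IsAdmissible.comp_add_right (hf : IsAdmissible ρ f) (k : H) :
    IsAdmissible ρ fun h => f (h + k) where
  measurable := hf.measurable.comp (measurable_add_const k)
  locallyBounded h := by
    obtain ⟨U, hU, C, hC⟩ := hf.locallyBounded (h + k)
    exact ⟨(fun x => x + k) ⁻¹' U,
      (continuous_id.add continuous_const).continuousAt.preimage_mem_nhds hU, C,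
      fun x hx => hC _ hx⟩
  small_outside ε hε φ := by
    obtain ⟨Q, hQ, h⟩ := hf.small_outside ε hε φ
    refine ⟨(Homeomorph.addRight k) ⁻¹' Q, (Homeomorph.isCompact_preimage _).2 hQ,
      fun s k' => ?_⟩
    refine le_trans (le_of_eq ?_) (h s (k' + k))
    congr 1
    funext x
    have hx : x.2 + k' ∈ Homeomorph.addRight k ⁻¹' Q ↔ x.2 + (k' + k) ∈ Q := by
      rw [← add_assoc]
      rfl
    simp only [add_assoc]
    congr 1
    by_cases hQx : x.2 + (k' + k) ∈ Q
    · rw [Set.indicator_of_notMem (Set.notMem_compl_iff.2 (hx.2 hQx)),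
        Set.indicator_of_notMem (Set.notMem_compl_iff.2 hQx)]
    · rw [Set.indicator_of_mem (Set.mem_compl (hx.not.2 hQx)),
        Set.indicator_of_mem (Set.mem_compl hQx)]
      rfl

/-- The measure `φ ↦ ∫ φ(t + s) f(h + k) dρ(t, h)` on `G`, for `x = (s, k)`. -/
def shiftedMeasure (hf : IsAdmissible ρ f) (x : G × H) : RadonFunctional G :=
  translate x.1 (weightedMeasure ρ _ (hf.comp_add_right x.2))

theorem shiftedMeasure_apply (hf : IsAdmissible ρ f) (x : G × H) (φ : C_c(G, ℂ)) :
    shiftedMeasure hf x φ = ρ.integral fun y => φ (y.1 + x.1) * f (y.2 + x.2) := rfl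

theorem shiftedMeasure_zero (hf : IsAdmissible ρ f) :
    shiftedMeasure hf 0 = weightedMeasure ρ f hf := by
  refine RadonFunctional.ext fun φ => ?_
  rw [shiftedMeasure_apply]
  simp only [Prod.fst_zero, Prod.snd_zero, add_zero]
  rfl

variable {L : AddSubgroup (G × H)} [DiscreteTopology L] [CompactSpace ((G × H) ⧸ L)]
  {τ : ComplexRadonMeasure ((G × H) ⧸ L)}

theorem IsDisintegration.torusVal_eq (hτ : IsDisintegration L ρ τ) (φ : C_c(G, ℂ))
    (g : C_c(H, ℂ)) (x : G × H) :
    torusVal L τ φ g (toTorus L x) = ρ.integral fun y => φ (y.1 + x.1) * g (y.2 + x.2) := by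
  unfold torusVal
  simp only [← orbitSum_shift]
  exact (hτ (shift x (tensor φ g))).symm

variable {χ : ℕ → C_c(H, ℝ)}

theorem IsDisintegration.tendsto_shiftedMeasure (hτ : IsDisintegration L ρ τ)
    (hfc : Continuous f) (hf : IsAdmissible ρ f) (hχ : IsCutoffSeq χ) (x : G × H)
    (φ : C_c(G, ℂ)) :
    Tendsto (fun n => torusVal L τ φ (cutoff (χ n) ⟨f, hfc⟩) (toTorus L x)) atTop
      (𝓝 (shiftedMeasure hf x φ)) := by
  let _ : MeasurableSpace (G × H) := borel (G × H)
  have : BorelSpace (G × H) := ⟨rfl⟩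
  simp only [hτ.torusVal_eq, shiftedMeasure_apply]
  have hi := integrable_weight (hf.comp_add_right x.2) (shift x.1 φ)
  refine tendsto_integral_of_dominated_convergence _ (fun n => ?_) hi.norm
    (fun n => ae_of_all _ fun y => ?_) (ae_of_all _ fun y => ?_)
  · refine (Measurable.mul (Continuous.measurable ?_) ρ.measurable_phase).aestronglyMeasurable
    fun_prop
  · simp only [norm_mul, ρ.norm_phase, mul_one]
    exact mul_le_mul_of_nonneg_left (hχ.norm_cutoff_le ⟨f, hfc⟩ n _) (norm_nonneg _)
  · exact ((hχ.tendsto_cutoff ⟨f, hfc⟩ (y.2 + x.2)).const_mul _).mul_const _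

variable [SigmaCompactSpace G] [SigmaCompactSpace H]

/-- Once both cutoffs are 1 on Q, their difference vanishes on Q and is at most 1 in modulus
elsewhere. The |ρ|-integral is then the one controlled by admissibility, uniformly in the translate,
and `torusNorm_le` transfers the bound to |τ|. -/
theorem IsDisintegration.isUniformApprox (hτ : IsDisintegration L ρ τ)
    (hfc : Continuous f) (hf : IsAdmissible ρ f) (hχ : IsCutoffSeq χ) :
    IsUniformApprox L τ fun n => cutoff (χ n) ⟨f, hfc⟩ := by
  have hcauchy : ∀ φ : C_c(G, ℂ), ∀ ε > 0, ∃ N, ∀ n ≥ N, ∀ m ≥ N, ∀ ζ,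
      torusNorm L τ (tensor φ (cutoff (χ m) ⟨f, hfc⟩ - cutoff (χ n) ⟨f, hfc⟩)) ζ ≤ ε := by
    intro φ ε hε
    obtain ⟨Q, hQ, h⟩ := hf.small_outside ε hε φ
    obtain ⟨N, hN⟩ := hχ.eventually_one Q hQ
    refine ⟨N, fun n hn m hm ζ => ?_⟩
    obtain ⟨x, rfl⟩ := QuotientAddGroup.mk_surjective ζ
    refine (hτ.torusNorm_le L _ x).trans ?_
    let _ : MeasurableSpace (G × H) := borel (G × H)
    have : BorelSpace (G × H) := ⟨rfl⟩
    set g := tensor φ (cutoff (χ m) ⟨f, hfc⟩ - cutoff (χ n) ⟨f, hfc⟩)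
    have hgm : Measurable fun y => g (y + x) :=
      ((map_continuous g).comp (continuous_id.add continuous_const)).measurable
    rw [integral_norm_eq_lintegral_enorm hgm.aestronglyMeasurable]
    refine ENNReal.toReal_le_of_le_ofReal hε.le ((lintegral_mono fun y => ?_).trans (h x.1 x.2))
    change ‖φ (y.1 + x.1) * (χ m (y.2 + x.2) * f (y.2 + x.2) -
      χ n (y.2 + x.2) * f (y.2 + x.2))‖ₑ ≤ _
    by_cases hy : y.2 + x.2 ∈ Q
    · rw [hN n hn _ hy, hN m hm _ hy]
      simp
    · rw [Set.indicator_of_mem (Set.mem_compl hy), Pi.one_apply, mul_one, enorm_mul, enorm_mul,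
        ← sub_mul, enorm_mul]
      gcongr
      refine mul_le_of_le_one_left zero_le ?_
      rw [← Complex.ofReal_sub, ← ofReal_norm, Complex.norm_real, Real.norm_eq_abs]
      refine ENNReal.ofReal_le_one.2 (abs_le.2 ⟨?_, ?_⟩) <;>
      linarith [hχ.nonneg n (y.2 + x.2), hχ.nonneg m (y.2 + x.2), hχ.le_one n (y.2 + x.2),
        hχ.le_one m (y.2 + x.2)]
  refine ⟨hcauchy, fun φ => ?_⟩
  obtain ⟨N, hN⟩ := hcauchy φ 1 one_pos
  obtain ⟨C, hC⟩ := exists_torusNorm_le L τ (tensor φ (cutoff (χ N) ⟨f, hfc⟩))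
  -- For n ≤ N monotonicity of the cutoffs gives C; for n ≥ N the Cauchy estimate with error 1 is
  -- added.
  refine ⟨C + 1, ?_, fun n ζ => ?_⟩
  · linarith [hC 0, torusNorm_nonneg L τ (tensor φ (cutoff (χ N) ⟨f, hfc⟩)) 0]
  rcases le_total n N with hn | hn
  · refine le_trans ?_ ((hC ζ).trans (by linarith))
    refine (torusNorm_le_mul L τ (c := 1) (fun x => ?_) ζ).trans (one_mul _).le
    rw [one_mul, tensor_apply, tensor_apply, norm_mul, norm_mul]
    exact mul_le_mul_of_nonneg_left (hχ.norm_cutoff_mono _ _ hn) (norm_nonneg _)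
  · refine (torusNorm_le_add L τ (g₁ := tensor φ (cutoff (χ N) ⟨f, hfc⟩))
      (g₂ := tensor φ (cutoff (χ n) ⟨f, hfc⟩ - cutoff (χ N) ⟨f, hfc⟩)) (fun x => ?_) ζ).trans
      (add_le_add (hC ζ) (hN N le_rfl n hn ζ))
    refine le_trans (le_of_eq ?_) (norm_add_le _ _)
    simp only [tensor_apply, CompactlySupportedContinuousMap.coe_sub, Pi.sub_apply]
    congr 1
    ring

end Admissible

/-! ### Integrability of the weight -/

/-- The equation `normC ψ = ψ` encodes ψ ≥ 0, so ψ also has L¹ norm 1 and stays admissible as a test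
function after passing to absolute values. -/
theorem exists_normalized {G : Type*} [AddCommGroup G] [TopologicalSpace G]
    [IsTopologicalAddGroup G] [T2Space G] [LocallyCompactSpace G] [MeasurableSpace G]
    [BorelSpace G] (mG : Measure G) [mG.IsAddHaarMeasure] :
    ∃ ψ : C_c(G, ℂ), ∫ t, ψ t ∂mG = 1 ∧ normC ψ = ψ := by
  obtain ⟨χ, hχ1, -, hχc, hχ01⟩ := exists_continuous_one_zero_of_isCompact
    (isCompact_singleton (x := (0 : G))) isClosed_empty (Set.disjoint_empty _)
  have hpos : 0 < ∫ t, χ t ∂mG :=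
    χ.continuous.integral_pos_of_hasCompactSupport_nonneg_nonzero hχc (fun t => (hχ01 t).1)
      (x := 0) (by rw [hχ1 rfl]; exact one_ne_zero)
  set c := ∫ t, χ t ∂mG
  let ψ : C_c(G, ℝ) := ⟨⟨fun t => c⁻¹ * χ t, by fun_prop⟩, hχc.mul_left⟩
  refine ⟨complexify ψ, ?_, ?_⟩
  · simp only [complexify_apply]
    rw [integral_complex_ofReal]
    change ((∫ t, c⁻¹ * χ t ∂mG : ℝ) : ℂ) = 1
    rw [integral_const_mul, inv_mul_cancel₀ hpos.ne', Complex.ofReal_one]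
  · ext t
    rw [normC_apply, complexify_apply, Complex.norm_real]
    have : 0 ≤ ψ t := mul_nonneg (inv_nonneg.2 hpos.le) (hχ01 t).1
    rw [Real.norm_of_nonneg this]

section Weights

set_option linter.unusedSectionVars false

variable {G H : Type*} [AddCommGroup G] [TopologicalSpace G] [IsTopologicalAddGroup G] [T2Space G]
  [LocallyCompactSpace G] [SigmaCompactSpace G] [MeasurableSpace G] [BorelSpace G]
  [AddCommGroup H] [TopologicalSpace H] [IsTopologicalAddGroup H] [T2Space H]
  [LocallyCompactSpace H] [SigmaCompactSpace H] [MeasurableSpace H] [BorelSpace H]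
  {mG : Measure G} [mG.IsAddHaarMeasure] {mH : Measure H} [mH.IsAddHaarMeasure]
  {L : AddSubgroup (G × H)} [DiscreteTopology L] [CompactSpace ((G × H) ⧸ L)]
  {τ : ComplexRadonMeasure ((G × H) ⧸ L)} {v : ℝ} {m : @Measure ((G × H) ⧸ L) (borel _)}
  {χ : ℕ → C_c(H, ℝ)} {f : C(H, ℂ)}

/-- After Fubini the integral over ζ does not depend on ξ, by invariance, and unfolds to a product
of L¹ norms. -/
theorem integral_torusNorm (hm : IsTorusHaar mG mH L v m) (φ : C_c(G, ℂ)) (g : C_c(H, ℂ)) :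
    ∫ ζ, torusNorm L τ (tensor φ g) ζ ∂m =
      v⁻¹ * ((∫ t, ‖φ t‖ ∂mG) * ∫ k, ‖g k‖ ∂mH) *
        (@Measure.real _ (borel _) τ.variation Set.univ) := by
  let _ : MeasurableSpace ((G × H) ⧸ L) := borel _
  have : BorelSpace ((G × H) ⧸ L) := ⟨rfl⟩
  have := hm.isProbabilityMeasure
  have hcl : IsClosed (L : Set (G × H)) := AddSubgroup.isClosed_of_discrete
  have hswap := τ.abs.integral_integral_swap m
    (F := fun ζ ξ => orbitSum L (normC (tensor φ g)) (ξ + ζ))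
    ((continuous_orbitSum L _).comp (continuous_snd.add continuous_fst)) isCompact_univ
    (fun p hp => absurd (Set.mem_univ p) hp)
  have hinner : ∀ ξ, ∫ ζ, orbitSum L (normC (tensor φ g)) (ξ + ζ) ∂m =
      ((v⁻¹ * ((∫ t, ‖φ t‖ ∂mG) * ∫ k, ‖g k‖ ∂mH) : ℝ) : ℂ) := fun ξ => by
    have h1 := hm.integral_add_right ⟨_, continuous_orbitSum L (normC (tensor φ g))⟩ ξ
    simp only [ContinuousMap.coe_mk] at h1
    simp only [add_comm ξ]
    rw [h1, hm.integral_orbitSum, normC_tensor]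
    simp only [tensor_apply]
    rw [integral_prod_mul]
    simp only [normC_apply]
    rw [integral_complex_ofReal, integral_complex_ofReal]
    push_cast
    ring
  simp only [hinner, abs_integral_orbitSum_normC] at hswap
  rw [τ.abs_integral_ofReal, integral_complex_ofReal] at hswap
  have h2 := Complex.ofReal_injective hswap
  rw [h2, integral_const, smul_eq_mul, mul_comm]

/-- Integrating the uniform bound on `torusNorm` over the torus bounds the L¹ norms of all cutoffs
of f by C v / |τ|(T), where τ ≠ 0 is essential; monotone convergence yields f. -/
theorem IsUniformApprox.integrable (hm : IsTorusHaar mG mH L v m) (hv : 0 < v)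
    (hτ0 : τ.variation ≠ 0) (hχ : IsCutoffSeq χ)
    (hfn : IsUniformApprox L τ fun n => cutoff (χ n) f) : Integrable f mH := by
  let _ : MeasurableSpace ((G × H) ⧸ L) := borel _
  have : BorelSpace ((G × H) ⧸ L) := ⟨rfl⟩
  have := hm.isProbabilityMeasure
  have := τ.isFiniteMeasure
  obtain ⟨ψ, hψ, hψn⟩ := exists_normalized mG
  have hψ1 : ∫ t, ‖ψ t‖ ∂mG = 1 := by
    have h : ∫ t, normC ψ t ∂mG = 1 := by rw [hψn, hψ]
    simp only [normC_apply] at h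
    rw [integral_complex_ofReal] at h
    exact_mod_cast h
  obtain ⟨C, hC0, hC⟩ := hfn.bounded ψ
  set M : ℝ := τ.variation.real Set.univ
  have hM : 0 < M := by
    refine ENNReal.toReal_pos ?_ (measure_ne_top _ _)
    rwa [Ne, Measure.measure_univ_eq_zero]
  have hbound : ∀ n, ∫ k, ‖cutoff (χ n) f k‖ ∂mH ≤ C * v / M := fun n => by
    have h1 := integral_torusNorm (τ := τ) hm ψ (cutoff (χ n) f)
    rw [hψ1, one_mul] at h1
    have h2 : ∫ ζ, torusNorm L τ (tensor ψ (cutoff (χ n) f)) ζ ∂m ≤ C := by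
      have := norm_integral_le_of_norm_le_const (μ := m) (C := C)
        (f := fun ζ => torusNorm L τ (tensor ψ (cutoff (χ n) f)) ζ) (ae_of_all _ fun ζ => by
          rw [Real.norm_of_nonneg (torusNorm_nonneg L τ _ ζ)]
          exact hC n ζ)
      rw [probReal_univ, mul_one] at this
      exact (Real.le_norm_self _).trans this
    rw [h1] at h2
    rw [le_div_iff₀ hM]
    calc (∫ k, ‖cutoff (χ n) f k‖ ∂mH) * M
        = v * (v⁻¹ * (∫ k, ‖cutoff (χ n) f k‖ ∂mH) * M) := by field_simp
      _ ≤ v * C := mul_le_mul_of_nonneg_left h2 hv.le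
      _ = C * v := mul_comm _ _
  refine ⟨f.continuous.measurable.aestronglyMeasurable, ?_⟩
  have hmono : ∀ k, Monotone fun n => ‖cutoff (χ n) f k‖ₑ := fun k n n' hn => by
    simp only [← ofReal_norm]
    exact ENNReal.ofReal_le_ofReal (hχ.norm_cutoff_mono f k hn)
  have hlim := lintegral_tendsto_of_tendsto_of_monotone (μ := mH)
    (f := fun n k => ‖cutoff (χ n) f k‖ₑ) (F := fun k => ‖f k‖ₑ)
    (fun n => (map_continuous (cutoff (χ n) f)).measurable.enorm.aemeasurable)
    (ae_of_all _ hmono)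
    (ae_of_all _ fun k => (hχ.tendsto_cutoff f k).enorm)
  refine lt_of_le_of_lt (le_of_tendsto' hlim fun n => ?_) (ENNReal.ofReal_lt_top (r := C * v / M))
  have hi : Integrable (cutoff (χ n) f) mH :=
    (map_continuous _).integrable_of_hasCompactSupport (cutoff (χ n) f).hasCompactSupport
  rw [← ofReal_integral_norm_eq_lintegral_enorm hi]
  exact ENNReal.ofReal_le_ofReal (hbound n)

/-! ### Existence and limits of `f ∗ f̃` -/

/-- `∫ |f(k + h) f(k)| dk`. -/
def normConv (mH : Measure H) (f : H → ℂ) (h : H) : ℝ≥0∞ :=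
  ∫⁻ k, ‖f (k + h)‖ₑ * ‖f k‖ₑ ∂mH

theorem selfConvExistsAt_iff (f : H → ℂ) (h : H) :
    SelfConvExistsAt mH f h ↔ Integrable (fun k => f (k + h) * (starRingEnd ℂ) (f k)) mH := by
  have := (measurePreserving_add_right mH h).integrable_comp_emb
    (MeasurableEquiv.addRight h).measurableEmbedding
    (g := fun t => (ContinuousLinearMap.mul ℂ ℂ) (f t) (tildeFun f (h - t)))
  refine this.symm.trans ?_
  have hfun : ((fun t => (ContinuousLinearMap.mul ℂ ℂ) (f t) (tildeFun f (h - t))) ∘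
      fun x => x + h) = fun k => f (k + h) * (starRingEnd ℂ) (f k) := by
    funext k
    simp [tildeFun]
  rw [hfun]

theorem enorm_mul_conj (a b : ℂ) : ‖a * (starRingEnd ℂ) b‖ₑ = ‖a‖ₑ * ‖b‖ₑ := by
  rw [enorm_mul]
  congr 1
  rw [← ofReal_norm, ← ofReal_norm, RCLike.norm_conj]

theorem selfConvExistsAt_iff_normConv_lt_top {f : H → ℂ} (hf : Continuous f) (h : H) :
    SelfConvExistsAt mH f h ↔ normConv mH f h < ∞ := by
  rw [selfConvExistsAt_iff]
  have hm : AEStronglyMeasurable (fun k => f (k + h) * (starRingEnd ℂ) (f k)) mH :=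
    ((hf.comp (continuous_id.add continuous_const)).mul
      (Complex.continuous_conj.comp hf)).measurable.aestronglyMeasurable
  refine (and_iff_right hm).trans ?_
  unfold HasFiniteIntegral normConv
  simp only [enorm_mul_conj]

theorem enorm_selfConv_le (f : H → ℂ) (h : H) : ‖selfConv mH f h‖ₑ ≤ normConv mH f h := by
  rw [selfConv_eq]
  refine (enorm_integral_le_lintegral_enorm _).trans (le_of_eq ?_)
  simp only [enorm_mul_conj]
  rfl

theorem normConv_mono {f f' : H → ℂ} (hff' : ∀ k, ‖f k‖ ≤ ‖f' k‖) (h : H) :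
    normConv mH f h ≤ normConv mH f' h := by
  have : ∀ k, ‖f k‖ₑ ≤ ‖f' k‖ₑ := fun k => by
    simp only [← ofReal_norm]
    exact ENNReal.ofReal_le_ofReal (hff' k)
  exact lintegral_mono fun k => mul_le_mul' (this _) (this _)

theorem tendsto_normConv (hχ : IsCutoffSeq χ) (h : H) :
    Tendsto (fun n => normConv mH (cutoff (χ n) f) h) atTop (𝓝 (normConv mH f h)) := by
  have hmono : ∀ k, Monotone fun n => ‖cutoff (χ n) f k‖ₑ := fun k n n' hn => by
    simp only [← ofReal_norm]
    exact ENNReal.ofReal_le_ofReal (hχ.norm_cutoff_mono f k hn)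
  have hmeas : ∀ n, Measurable fun k => ‖cutoff (χ n) f k‖ₑ := fun n =>
    (map_continuous (cutoff (χ n) f)).measurable.enorm
  refine lintegral_tendsto_of_tendsto_of_monotone (fun n => ?_) (ae_of_all _ fun k n n' hn => ?_)
    (ae_of_all _ fun k => ?_)
  · exact (((hmeas n).comp (measurable_add_const h)).mul (hmeas n)).aemeasurable
  · exact mul_le_mul' (hmono _ hn) (hmono _ hn)
  · exact ENNReal.Tendsto.mul (hχ.tendsto_cutoff f _).enorm (Or.inr enorm_ne_top)
      (hχ.tendsto_cutoff f _).enorm (Or.inr enorm_ne_top)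

theorem tendsto_selfConv (hχ : IsCutoffSeq χ) {h : H} (hh : normConv mH f h < ∞) :
    Tendsto (fun n => selfConv mH (cutoff (χ n) f) h) atTop (𝓝 (selfConv mH f h)) := by
  have hi := (selfConvExistsAt_iff _ h).1
    ((selfConvExistsAt_iff_normConv_lt_top (mH := mH) f.continuous h).2 hh)
  simp only [selfConv_eq]
  refine tendsto_integral_of_dominated_convergence _ (fun n => ?_) hi.norm
    (fun n => ae_of_all _ fun k => ?_) (ae_of_all _ fun k => ?_)
  · exact (((map_continuous (cutoff (χ n) f)).comp (continuous_id.add continuous_const)).mul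
      (Complex.continuous_conj.comp (map_continuous _))).measurable.aestronglyMeasurable
  · rw [norm_mul, norm_mul, RCLike.norm_conj, RCLike.norm_conj]
    exact mul_le_mul (hχ.norm_cutoff_le f n _) (hχ.norm_cutoff_le f n _) (norm_nonneg _)
      (norm_nonneg _)
  · exact (hχ.tendsto_cutoff f _).mul
      ((Complex.continuous_conj.tendsto _).comp (hχ.tendsto_cutoff f k))

/-- By Tonelli the integral of `normConv` is the square of the L¹ norm of f. -/
theorem ae_selfConvExistsAt (hχ : IsCutoffSeq χ) (hf : Integrable f mH) :
    ∀ᵐ h ∂mH, SelfConvExistsAt mH f h := by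
  -- Addition on H × H may fail to be measurable for the product σ-algebra, so joint measurability
  -- is obtained as a limit of compactly supported continuous functions.
  have hmeas : Measurable fun p : H × H => f (p.2 + p.1) * f p.2 := by
    refine measurable_of_tendsto_metrizable
      (f := fun n (p : H × H) => cutoff (χ n) f (p.2 + p.1) * cutoff (χ n) f p.2) (fun n => ?_)
      (tendsto_pi_nhds.2 fun p => (hχ.tendsto_cutoff f _).mul (hχ.tendsto_cutoff f _))
    set g := cutoff (χ n) f
    refine HasCompactSupport.measurable_of_prod (by fun_prop) ?_
    have hg : IsCompact (tsupport g) := g.hasCompactSupport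
    refine HasCompactSupport.intro
      (((hg.prod hg).image (f := fun q : H × H => (q.1 - q.2, q.2)) (by fun_prop))) fun p hp => ?_
    by_contra h
    exact hp ⟨(p.2 + p.1, p.2), ⟨subset_tsupport _ (left_ne_zero_of_mul h),
      subset_tsupport _ (right_ne_zero_of_mul h)⟩, by simp⟩
  have hF : Measurable (Function.uncurry fun h k : H => ‖f (k + h)‖ₑ * ‖f k‖ₑ) := by
    have : (Function.uncurry fun h k : H => ‖f (k + h)‖ₑ * ‖f k‖ₑ) =
        fun p : H × H => ‖f (p.2 + p.1) * f p.2‖ₑ := by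
      funext p
      simp [Function.uncurry, enorm_mul]
    rw [this]
    exact hmeas.enorm
  have htot : ∫⁻ h, normConv mH f h ∂mH ≠ ∞ := by
    have h1 : ∀ k, ∫⁻ h, ‖f (k + h)‖ₑ * ‖f k‖ₑ ∂mH = (∫⁻ h, ‖f h‖ₑ ∂mH) * ‖f k‖ₑ := fun k => by
      rw [lintegral_mul_const' _ _ enorm_ne_top, lintegral_add_left_eq_self (fun h => ‖f h‖ₑ) k]
    unfold normConv
    rw [lintegral_lintegral_swap hF.aemeasurable]
    simp only [h1]
    rw [lintegral_const_mul' _ _ hf.hasFiniteIntegral.ne]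
    exact ENNReal.mul_ne_top hf.hasFiniteIntegral.ne hf.hasFiniteIntegral.ne
  filter_upwards [ae_lt_top hF.lintegral_prod_right' htot] with h hh
  exact (selfConvExistsAt_iff_normConv_lt_top f.continuous h).2 hh

/-! ### The majorant of `γ` -/

/-- `∑_{(l, l⋆) ∈ L} |φ(s - l)| ∫ |f(k + h - l⋆) f(k)| dk` for `x = (s, h)`. -/
def gammaMajorant (L : AddSubgroup (G × H)) (mH : Measure H) (φ : C_c(G, ℂ)) (f : H → ℂ) (x : G × H) : ℝ≥0∞ :=
  ∑' l : L, ‖φ (x.1 - l.1.1)‖ₑ * normConv mH f (x.2 - l.1.2)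

theorem gammaMajorant_mono (φ : C_c(G, ℂ)) {f f' : H → ℂ} (hff' : ∀ k, ‖f k‖ ≤ ‖f' k‖)
    (x : G × H) : gammaMajorant L mH φ f x ≤ gammaMajorant L mH φ f' x :=
  ENNReal.tsum_le_tsum fun _ => mul_le_mul' le_rfl (normConv_mono hff' _)

/-- On finite partial sums the cutoff bounds pass to the limit through `tendsto_normConv`. -/
theorem gammaMajorant_le_of_forall (hχ : IsCutoffSeq χ) (φ : C_c(G, ℂ)) {x : G × H} {S : ℝ≥0∞}
    (h : ∀ n, gammaMajorant L mH φ (cutoff (χ n) f) x ≤ S) : gammaMajorant L mH φ f x ≤ S := by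
  unfold gammaMajorant
  rw [ENNReal.tsum_eq_iSup_sum]
  refine iSup_le fun s => ?_
  refine le_of_tendsto' (tendsto_finsetSum s fun l _ =>
    ENNReal.Tendsto.const_mul (tendsto_normConv hχ (x.2 - l.1.2)) (Or.inr enorm_ne_top))
    fun n => ?_
  exact (ENNReal.sum_le_tsum s).trans (h n)

theorem autoConv_normC (g : C_c(H, ℂ)) (h : H) :
    autoConv mH (normC g) h = ((∫ k, ‖g (k + h)‖ * ‖g k‖ ∂mH : ℝ) : ℂ) := by
  rw [autoConv_apply, selfConv_eq, ← integral_complex_ofReal]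
  simp

theorem normConv_eq_enorm_autoConv (g : C_c(H, ℂ)) (h : H) :
    normConv mH g h = ‖autoConv mH (normC g) h‖ₑ := by
  have hi : Integrable (fun k => ‖g (k + h)‖ * ‖g k‖) mH :=
    Continuous.integrable_of_hasCompactSupport (by fun_prop) g.hasCompactSupport.norm.mul_left
  have h0 : ∀ k, 0 ≤ ‖g (k + h)‖ * ‖g k‖ := fun k => by positivity
  rw [autoConv_normC, ← ofReal_norm, Complex.norm_real, Real.norm_of_nonneg (integral_nonneg h0),
    ofReal_integral_eq_lintegral_ofReal hi (ae_of_all _ h0)]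
  unfold normConv
  simp only [← ofReal_norm, ENNReal.ofReal_mul (norm_nonneg _)]

/-- For compactly supported weights the majorant is thus continuous on the torus. -/
theorem gammaMajorant_eq (φ : C_c(G, ℂ)) (g : C_c(H, ℂ)) (x : G × H) :
    gammaMajorant L mH φ g x =
      ENNReal.ofReal (normSum L (tensor φ (autoConv mH (normC g))) (toTorus L x)) := by
  rw [normSum_mk, ENNReal.ofReal_tsum_of_nonneg (fun _ => norm_nonneg _)
    (summable_norm_translates L _ x), ← (Equiv.neg L).tsum_eq]
  refine tsum_congr fun l => ?_
  rw [ofReal_norm, tensor_apply, enorm_mul, normConv_eq_enorm_autoConv]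
  simp [sub_eq_add_neg]

theorem gammaAt_mk (f : H → ℂ) (x : G × H) (φ : C_c(G, ℂ)) :
    gammaAt L mH v f (toTorus L x) φ =
      (v : ℂ)⁻¹ * ∑' l : L, selfConv mH f (x.2 - l.1.2) * φ (x.1 - l.1.1) := rfl

theorem enorm_gamma_term_le (f : H → ℂ) (x : G × H) (φ : C_c(G, ℂ)) (l : L) :
    ‖selfConv mH f (x.2 - l.1.2) * φ (x.1 - l.1.1)‖ₑ ≤
      ‖φ (x.1 - l.1.1)‖ₑ * normConv mH f (x.2 - l.1.2) := by
  rw [enorm_mul, mul_comm]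
  exact mul_le_mul' le_rfl (enorm_selfConv_le f _)

theorem norm_gamma_term_le {f : H → ℂ} {x : G × H} {φ : C_c(G, ℂ)}
    (hx : gammaMajorant L mH φ f x ≠ ∞) {g : H → ℂ} (hgf : ∀ k, ‖g k‖ ≤ ‖f k‖) (l : L) :
    ‖selfConv mH g (x.2 - l.1.2) * φ (x.1 - l.1.1)‖ ≤
      (‖φ (x.1 - l.1.1)‖ₑ * normConv mH f (x.2 - l.1.2)).toReal := by
  rw [← toReal_enorm]
  exact ENNReal.toReal_mono (ENNReal.ne_top_of_tsum_ne_top hx l)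
    ((enorm_gamma_term_le g x φ l).trans (mul_le_mul' le_rfl (normConv_mono hgf _)))

theorem summable_gamma {f : H → ℂ} {x : G × H} {φ : C_c(G, ℂ)}
    (hx : gammaMajorant L mH φ f x ≠ ∞) :
    Summable fun l : L => selfConv mH f (x.2 - l.1.2) * φ (x.1 - l.1.1) :=
  Summable.of_norm_bounded (ENNReal.summable_toReal hx)
    (norm_gamma_term_le hx fun _ => le_rfl)

theorem norm_gammaAt_le (hv : 0 < v) {f g : H → ℂ} {x : G × H} {φ : C_c(G, ℂ)}
    (hx : gammaMajorant L mH φ f x ≠ ∞) (hgf : ∀ k, ‖g k‖ ≤ ‖f k‖) :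
    ‖gammaAt L mH v g (toTorus L x) φ‖ ≤ v⁻¹ * (gammaMajorant L mH φ f x).toReal := by
  rw [gammaAt_mk, norm_mul, norm_inv, Complex.norm_real, Real.norm_of_nonneg hv.le]
  refine mul_le_mul_of_nonneg_left ?_ (inv_nonneg.2 hv.le)
  unfold gammaMajorant
  rw [ENNReal.tsum_toReal_eq (ENNReal.ne_top_of_tsum_ne_top hx)]
  exact tsum_of_norm_bounded (ENNReal.summable_toReal hx).hasSum (norm_gamma_term_le hx hgf)

theorem tendsto_gammaAt (hχ : IsCutoffSeq χ) {x : G × H} {φ : C_c(G, ℂ)}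
    (hx : gammaMajorant L mH φ f x ≠ ∞) :
    Tendsto (fun n => gammaAt L mH v (cutoff (χ n) f) (toTorus L x) φ) atTop
      (𝓝 (gammaAt L mH v f (toTorus L x) φ)) := by
  simp only [gammaAt_mk]
  refine Tendsto.const_mul _ (tendsto_tsum_of_dominated_convergence (ENNReal.summable_toReal hx)
    (fun l => ?_) (Eventually.of_forall fun n l =>
      norm_gamma_term_le hx (hχ.norm_cutoff_le f n) l))
  -- Where φ vanishes, `normConv` may be infinite even though the majorant is finite, but then the
  -- term is 0 for every n.
  by_cases hφ : φ (x.1 - l.1.1) = 0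
  · simp [hφ]
  refine (tendsto_selfConv hχ ?_).mul_const _
  have := ENNReal.ne_top_of_tsum_ne_top hx l
  by_contra hinf
  rw [not_lt, top_le_iff] at hinf
  rw [hinf, ENNReal.mul_top (by simpa using hφ)] at this
  exact this rfl

/-- A finite majorant for φ gives no information on f ∗ f̃ at h - l⋆ when φ(s - l) = 0. The
countable family `χG` covers these l: some member equals 1 at s - l. -/
theorem gammaExistsAt_of_majorant {χG : ℕ → C_c(G, ℝ)} (hχG : IsCutoffSeq χG)
    {φ : C_c(G, ℂ)} {ξ : (G × H) ⧸ L}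
    (hφ : ∀ x, toTorus L x = ξ → gammaMajorant L mH φ f x ≠ ∞)
    (hall : ∀ j x, toTorus L x = ξ → gammaMajorant L mH (complexify (χG j)) f x ≠ ∞) :
    GammaExistsAt L mH f ξ φ := by
  refine fun x hx => ⟨fun l => ?_, summable_gamma (hφ x hx)⟩
  rw [selfConvExistsAt_iff_normConv_lt_top f.continuous]
  obtain ⟨j, hj⟩ := (hχG.eventually_eq_one (x.1 - l.1.1)).exists
  have h := ENNReal.ne_top_of_tsum_ne_top (hall j x hx) l
  rw [complexify_apply, hj, Complex.ofReal_one, enorm_one, one_mul] at h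
  exact h.lt_top

end Weights

/-! ### Integration of `γ` over the product of the torus with itself -/

section ProductIntegral

variable {T : Type*} [TopologicalSpace T] [CompactSpace T]

theorem ComplexRadonMeasure.measurable_prodPhase {T : Type*} [TopologicalSpace T]
    (τ : ComplexRadonMeasure T) :
    Measurable[@Prod.instMeasurableSpace T T (borel T) (borel T)]
      fun p : T × T => τ.phase p.1 * (starRingEnd ℂ) (τ.phase p.2) := by
  let _ : MeasurableSpace T := borel T
  have h1 : Measurable fun p : T × T => τ.phase p.1 := τ.measurable_phase.comp measurable_fst
  have h2 : Measurable fun p : T × T => (starRingEnd ℂ) (τ.phase p.2) :=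
    Complex.continuous_conj.measurable.comp (τ.measurable_phase.comp measurable_snd)
  exact h1.mul h2

theorem ComplexRadonMeasure.norm_mul_phase {T : Type*} [TopologicalSpace T]
    (τ : ComplexRadonMeasure T) (c : ℂ) (p : T × T) :
    ‖c * (τ.phase p.1 * (starRingEnd ℂ) (τ.phase p.2))‖ = ‖c‖ := by
  rw [norm_mul, norm_mul, RCLike.norm_conj, τ.norm_phase, τ.norm_phase, mul_one, mul_one]

/-- Fubini; the two conjugations in `conjIntegral` cancel on F and on the first phase and leave one
on the second. -/
theorem ComplexRadonMeasure.conjIntegral_eq_prod (τ : ComplexRadonMeasure T) {F : T × T → ℂ}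
    (hF : Integrable F τ.prodVariation) :
    τ.conjIntegral (fun η => τ.integral fun ξ => F (ξ, η)) =
      ∫ p, F p * (τ.phase p.1 * (starRingEnd ℂ) (τ.phase p.2)) ∂τ.prodVariation := by
  let _ : MeasurableSpace T := borel T
  have := τ.isFiniteMeasure
  have hi : Integrable (fun p => F p * (τ.phase p.1 * (starRingEnd ℂ) (τ.phase p.2)))
      (τ.variation.prod τ.variation) :=
    hF.mono (hF.aestronglyMeasurable.mul τ.measurable_prodPhase.aestronglyMeasurable)
      (ae_of_all _ fun p => (τ.norm_mul_phase _ p).le)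
  unfold ComplexRadonMeasure.prodVariation
  rw [integral_prod_symm _ hi]
  unfold ComplexRadonMeasure.conjIntegral ComplexRadonMeasure.integral
  rw [← integral_conj]
  congr 1
  funext η
  rw [map_mul, Complex.conj_conj, ← integral_mul_const]
  simp only [mul_assoc]

theorem ComplexRadonMeasure.tendsto_conjIntegral (τ : ComplexRadonMeasure T)
    {F : ℕ → T × T → ℂ} {F₀ : T × T → ℂ} {b : T × T → ℝ} (hF : ∀ n, Continuous (F n))
    (hb : Integrable b τ.prodVariation) (hFb : ∀ n, ∀ᵐ p ∂τ.prodVariation, ‖F n p‖ ≤ b p)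
    (hlim : ∀ᵐ p ∂τ.prodVariation, Tendsto (fun n => F n p) atTop (𝓝 (F₀ p))) :
    Integrable F₀ τ.prodVariation ∧
      Tendsto (fun n => τ.conjIntegral fun η => τ.integral fun ξ => F n (ξ, η)) atTop
        (𝓝 (τ.conjIntegral fun η => τ.integral fun ξ => F₀ (ξ, η))) := by
  let _ : MeasurableSpace T := borel T
  have : BorelSpace T := ⟨rfl⟩
  have hm : ∀ n, AEStronglyMeasurable (F n) τ.prodVariation := fun n =>
    (HasCompactSupport.stronglyMeasurable_of_prod (hF n)
      (HasCompactSupport.of_compactSpace _)).aestronglyMeasurable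
  have hm₀ : AEStronglyMeasurable F₀ τ.prodVariation :=
    aestronglyMeasurable_of_tendsto_ae atTop hm hlim
  have hi : ∀ n, Integrable (F n) τ.prodVariation := fun n => hb.mono' (hm n) (hFb n)
  have hi₀ : Integrable F₀ τ.prodVariation := by
    refine hb.mono' hm₀ ?_
    filter_upwards [hlim, ae_all_iff.2 hFb] with p hp hbp
    exact le_of_tendsto' hp.norm hbp
  refine ⟨hi₀, ?_⟩
  rw [τ.conjIntegral_eq_prod hi₀]
  simp only [fun n => τ.conjIntegral_eq_prod (hi n)]
  refine tendsto_integral_of_dominated_convergence b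
    (fun n => (hm n).mul τ.measurable_prodPhase.aestronglyMeasurable) hb (fun n => ?_) ?_
  · filter_upwards [hFb n] with p hp
    rwa [τ.norm_mul_phase]
  · filter_upwards [hlim] with p hp
    exact hp.mul_const _

end ProductIntegral

/-! ### Domination of γ_{ξ-η} on the product of the torus with itself. -/

section Majorant

set_option linter.unusedSectionVars false

variable {G H : Type*} [AddCommGroup G] [TopologicalSpace G] [IsTopologicalAddGroup G] [T2Space G]
  [LocallyCompactSpace G] [SigmaCompactSpace G] [MeasurableSpace G] [BorelSpace G]
  [AddCommGroup H] [TopologicalSpace H] [IsTopologicalAddGroup H] [T2Space H]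
  [LocallyCompactSpace H] [SigmaCompactSpace H] [MeasurableSpace H] [BorelSpace H]
  {mG : Measure G} [mG.IsAddHaarMeasure] [mG.Regular] {mH : Measure H} [mH.IsAddHaarMeasure]
  {L : AddSubgroup (G × H)} [DiscreteTopology L] [CompactSpace ((G × H) ⧸ L)]
  {τ : ComplexRadonMeasure ((G × H) ⧸ L)} {v : ℝ} {m : @Measure ((G × H) ⧸ L) (borel _)}
  {χ : ℕ → C_c(H, ℝ)} {f : C(H, ℂ)}

theorem norm_torusCorr_le {φ ψ : C_c(G, ℂ)} {g : C_c(H, ℂ)} {C D : ℝ} (hC0 : 0 ≤ C)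
    (hC : ∀ ζ, torusNorm L τ (tensor φ g) ζ ≤ C)
    (hD : ∀ ζ, torusNorm L τ (tensor (reflectConj ψ) g) ζ ≤ D) (ζ : (G × H) ⧸ L) :
    ‖torusCorr L τ φ ψ g ζ‖ ≤ C * D := by
  unfold torusCorr
  rw [RCLike.norm_conj]
  refine (norm_torusVal_le L τ _ _ ζ).trans ((torusNorm_le_mul L τ (c := C)
    (g' := tensor (reflectConj ψ) g) (fun x => ?_) ζ).trans
    (mul_le_mul_of_nonneg_left (hD ζ) hC0))
  rw [tensor_apply, tensor_apply, torusInner_apply, mul_assoc, norm_mul, RCLike.norm_conj]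
  exact mul_le_mul_of_nonneg_right ((norm_torusVal_le L τ _ _ _).trans (hC _)) (norm_nonneg _)

theorem torusNorm_normC_le (φ : C_c(G, ℂ)) (g : C_c(H, ℂ)) (ζ : (G × H) ⧸ L) :
    torusNorm L τ (tensor (normC φ) (normC g)) ζ ≤ torusNorm L τ (tensor φ g) ζ := by
  have := torusNorm_le_mul L τ (g := tensor (normC φ) (normC g)) (g' := tensor φ g) (c := 1)
    (fun x => by rw [← normC_tensor, normC_apply]; simp) ζ
  rwa [one_mul] at this

theorem tensor_autoConv_normC (φ : C_c(G, ℂ)) (g : C_c(H, ℂ)) :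
    tensor (normC φ) (autoConv mH (normC g)) = normC (tensor φ (autoConv mH (normC g))) := by
  rw [normC_tensor]
  congr 1
  ext h
  have h0 : 0 ≤ ∫ k, ‖g (k + h)‖ * ‖g k‖ ∂mH := integral_nonneg fun k => by positivity
  rw [normC_apply, autoConv_normC, Complex.norm_real, Real.norm_of_nonneg h0]

theorem continuous_normSum_sub (g : C_c(G × H, ℂ)) :
    Continuous fun p : ((G × H) ⧸ L) × ((G × H) ⧸ L) => normSum L g (p.1 - p.2) :=
  (continuous_normSum L g).comp continuous_sub

theorem normC_reflectConj {ψ : C_c(G, ℂ)} (hψ : normC ψ = ψ) :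
    normC (reflectConj ψ) = reflectConj ψ := by
  ext t
  have := DFunLike.congr_fun hψ (-t)
  rw [normC_apply] at this
  rw [normC_apply, reflectConj_apply, RCLike.norm_conj, ← this, Complex.norm_real, norm_norm,
    Complex.conj_ofReal]

theorem torusNorm_abs (g : C_c(G × H, ℂ)) (ζ : (G × H) ⧸ L) :
    torusNorm L τ.abs g ζ = torusNorm L τ g ζ := rfl

theorem norm_torusCorr_abs_le {φ ψ : C_c(G, ℂ)} (hψ : normC ψ = ψ) {g : C_c(H, ℂ)} {C D : ℝ}
    (hC0 : 0 ≤ C) (hC : ∀ ζ, torusNorm L τ (tensor φ g) ζ ≤ C)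
    (hD : ∀ ζ, torusNorm L τ (tensor (reflectConj ψ) g) ζ ≤ D) (ζ : (G × H) ⧸ L) :
    ‖torusCorr L τ.abs (normC φ) ψ (normC g) ζ‖ ≤ C * D := by
  refine norm_torusCorr_le hC0 (fun ζ => ?_) (fun ζ => ?_) ζ
  · rw [torusNorm_abs]
    exact (torusNorm_normC_le φ g ζ).trans (hC ζ)
  · rw [torusNorm_abs, ← normC_reflectConj hψ]
    exact (torusNorm_normC_le (reflectConj ψ) g ζ).trans (hD ζ)

/-- All phases are 1 and all summands nonnegative, so the double integral is an ordinary integral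
against |τ| × |τ|. -/
theorem abs_integral_gammaAt (φ : C_c(G, ℂ)) (g : C_c(H, ℂ)) :
    (τ.abs.conjIntegral fun η => τ.abs.integral fun ξ =>
        gammaAt L mH v (normC g) (ξ - η) (normC φ)) =
      ((v⁻¹ * ∫ p, normSum L (tensor φ (autoConv mH (normC g))) (p.1 - p.2)
        ∂τ.prodVariation : ℝ) : ℂ) := by
  let _ : MeasurableSpace ((G × H) ⧸ L) := borel _
  have : BorelSpace ((G × H) ⧸ L) := ⟨rfl⟩
  have := τ.isFiniteMeasure
  set A := tensor φ (autoConv mH (normC g)) with hA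
  have hγ : ∀ ξ, gammaAt L mH v (normC g) ξ (normC φ) = ((v⁻¹ * normSum L A ξ : ℝ) : ℂ) :=
    fun ξ => by
      rw [gammaAt_eq_orbitSum, tensor_autoConv_normC, orbitSum_normC]
      push_cast
      rfl
  have hInt : Integrable (fun p : ((G × H) ⧸ L) × ((G × H) ⧸ L) =>
      ((v⁻¹ * normSum L A (p.1 - p.2) : ℝ) : ℂ)) τ.abs.prodVariation :=
    integrable_prod_of_hasCompactSupport τ.variation τ.variation
      (Complex.continuous_ofReal.comp (continuous_const.mul (continuous_normSum_sub A)))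
      (HasCompactSupport.of_compactSpace _)
  simp only [hγ]
  refine (τ.abs.conjIntegral_eq_prod hInt).trans ?_
  have h1 : ∀ p : ((G × H) ⧸ L) × ((G × H) ⧸ L),
      τ.abs.phase p.1 * (starRingEnd ℂ) (τ.abs.phase p.2) = 1 := fun p => by
    simp [ComplexRadonMeasure.abs]
  simp only [h1, mul_one]
  rw [integral_complex_ofReal, integral_const_mul]
  rfl

/-- By `integral_torusCorr` for |τ| the left side is v times the mean of correlations bounded by C
D. The weight enters only through C and D, so the bound is uniform over the cutoffs. -/
theorem integral_normSum_autoConv_le (hm : IsTorusHaar mG mH L v m) (hv : 0 < v)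
    (φ ψ : C_c(G, ℂ)) (hψ : ∫ t, ψ t ∂mG = 1) (hψn : normC ψ = ψ) (g : C_c(H, ℂ)) {C D : ℝ}
    (hC0 : 0 ≤ C) (hC : ∀ ζ, torusNorm L τ (tensor φ g) ζ ≤ C)
    (hD : ∀ ζ, torusNorm L τ (tensor (reflectConj ψ) g) ζ ≤ D) :
    ∫ p, normSum L (tensor φ (autoConv mH (normC g))) (p.1 - p.2) ∂τ.prodVariation ≤
      v * (C * D) := by
  let _ : MeasurableSpace ((G × H) ⧸ L) := borel _
  have := hm.isProbabilityMeasure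
  have hcorr : ‖∫ ζ, torusCorr L τ.abs (normC φ) ψ (normC g) ζ ∂m‖ ≤ C * D := by
    have := norm_integral_le_of_norm_le_const (μ := m)
      (ae_of_all _ (norm_torusCorr_abs_le hψn hC0 hC hD))
    rwa [probReal_univ, mul_one] at this
  rw [integral_torusCorr L τ.abs mH mG hm _ ψ hψ, abs_integral_gammaAt, Complex.norm_real] at hcorr
  have := (Real.le_norm_self _).trans hcorr
  rwa [inv_mul_le_iff₀ hv] at this

/-- The supremum of the majorants of `γ` for the weights `fn n`. -/
def torusMajorant (L : AddSubgroup (G × H)) (mH : Measure H) [mH.IsAddHaarMeasure]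
    (φ : C_c(G, ℂ)) (fn : ℕ → C_c(H, ℂ)) (ξ : (G × H) ⧸ L) : ℝ≥0∞ :=
  ⨆ n, ENNReal.ofReal (normSum L (tensor φ (autoConv mH (normC (fn n)))) ξ)

theorem gammaMajorant_le_torusMajorant (hχ : IsCutoffSeq χ) (φ : C_c(G, ℂ)) (x : G × H) :
    gammaMajorant L mH φ f x ≤
      torusMajorant L mH φ (fun n => cutoff (χ n) f) (toTorus L x) := by
  refine gammaMajorant_le_of_forall hχ φ fun n => ?_
  rw [gammaMajorant_eq]
  exact le_iSup (fun n => ENNReal.ofReal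
    (normSum L (tensor φ (autoConv mH (normC (cutoff (χ n) f)))) (toTorus L x))) n

theorem measurable_torusMajorant_sub (φ : C_c(G, ℂ)) (fn : ℕ → C_c(H, ℂ)) :
    Measurable[@Prod.instMeasurableSpace _ _ (borel _) (borel _)]
      fun p : ((G × H) ⧸ L) × ((G × H) ⧸ L) => torusMajorant L mH φ fn (p.1 - p.2) := by
  let _ : MeasurableSpace ((G × H) ⧸ L) := borel _
  have : BorelSpace ((G × H) ⧸ L) := ⟨rfl⟩
  refine Measurable.iSup fun n => ENNReal.measurable_ofReal.comp ?_
  exact HasCompactSupport.measurable_of_prod (continuous_normSum_sub _)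
    (HasCompactSupport.of_compactSpace _)

/-- The functions under the supremum increase with n, so monotone convergence applies with the
uniform bound v C D. -/
theorem lintegral_torusMajorant_ne_top (hm : IsTorusHaar mG mH L v m) (hv : 0 < v)
    (hχ : IsCutoffSeq χ) (hfn : IsUniformApprox L τ fun n => cutoff (χ n) f) (φ : C_c(G, ℂ)) :
    ∫⁻ p, torusMajorant L mH φ (fun n => cutoff (χ n) f) (p.1 - p.2) ∂τ.prodVariation ≠ ∞ := by
  let _ : MeasurableSpace ((G × H) ⧸ L) := borel _
  have : BorelSpace ((G × H) ⧸ L) := ⟨rfl⟩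
  have := τ.isFiniteMeasure
  obtain ⟨ψ, hψ, hψn⟩ := exists_normalized mG
  obtain ⟨C, hC0, hC⟩ := hfn.bounded φ
  obtain ⟨D, -, hD⟩ := hfn.bounded (reflectConj ψ)
  unfold torusMajorant
  rw [lintegral_iSup]
  · refine ne_top_of_le_ne_top (ENNReal.ofReal_ne_top (r := v * (C * D))) (iSup_le fun n => ?_)
    have hInt : Integrable (fun p : ((G × H) ⧸ L) × ((G × H) ⧸ L) =>
        normSum L (tensor φ (autoConv mH (normC (cutoff (χ n) f)))) (p.1 - p.2))
        τ.prodVariation :=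
      integrable_prod_of_hasCompactSupport τ.variation τ.variation (continuous_normSum_sub _)
        (HasCompactSupport.of_compactSpace _)
    rw [← ofReal_integral_eq_lintegral_ofReal hInt
      (ae_of_all _ fun p => normSum_nonneg L _ _)]
    exact ENNReal.ofReal_le_ofReal
      (integral_normSum_autoConv_le hm hv φ ψ hψ hψn _ hC0 (hC n) (hD n))
  · exact fun n => ENNReal.measurable_ofReal.comp
      (HasCompactSupport.measurable_of_prod (continuous_normSum_sub _)
        (HasCompactSupport.of_compactSpace _))
  · intro n n' hn p
    obtain ⟨x, hx⟩ := QuotientAddGroup.mk_surjective (p.1 - p.2)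
    have := gammaMajorant_mono (L := L) (mH := mH) φ (f := cutoff (χ n) f)
      (f' := cutoff (χ n') f) (fun k => hχ.norm_cutoff_mono f k hn) x
    rw [gammaMajorant_eq, gammaMajorant_eq] at this
    simpa only [← hx] using this

theorem ae_gammaMajorant_ne_top (hm : IsTorusHaar mG mH L v m) (hv : 0 < v)
    (hχ : IsCutoffSeq χ) (hfn : IsUniformApprox L τ fun n => cutoff (χ n) f) (φ : C_c(G, ℂ)) :
    ∀ᵐ p ∂τ.prodVariation, ∀ x, toTorus L x = p.1 - p.2 → gammaMajorant L mH φ f x ≠ ∞ := by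
  filter_upwards [ae_lt_top (measurable_torusMajorant_sub φ _)
    (lintegral_torusMajorant_ne_top hm hv hχ hfn φ)] with p hp x hx
  refine ne_top_of_le_ne_top hp.ne ?_
  rw [← hx]
  exact gammaMajorant_le_torusMajorant hχ φ x

theorem ae_gammaExistsAt (hm : IsTorusHaar mG mH L v m) (hv : 0 < v)
    (hχ : IsCutoffSeq χ) (hfn : IsUniformApprox L τ fun n => cutoff (χ n) f) (φ : C_c(G, ℂ)) :
    ∀ᵐ p ∂τ.prodVariation, GammaExistsAt L mH f (p.1 - p.2) φ := by
  obtain ⟨χG, hχG⟩ := exists_isCutoffSeq G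
  filter_upwards [ae_gammaMajorant_ne_top hm hv hχ hfn φ,
    ae_all_iff.2 fun j => ae_gammaMajorant_ne_top hm hv hχ hfn (complexify (χG j))] with p h1 h2
  exact gammaExistsAt_of_majorant hχG h1 h2

theorem tendsto_conjIntegral_gammaAt (hm : IsTorusHaar mG mH L v m) (hv : 0 < v)
    (hχ : IsCutoffSeq χ) (hfn : IsUniformApprox L τ fun n => cutoff (χ n) f) (φ : C_c(G, ℂ)) :
    Integrable (fun p => gammaAt L mH v f (p.1 - p.2) φ) τ.prodVariation ∧
      Tendsto (fun n => τ.conjIntegral fun η => τ.integral fun ξ =>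
          gammaAt L mH v (cutoff (χ n) f) (ξ - η) φ) atTop
        (𝓝 (τ.conjIntegral fun η => τ.integral fun ξ => gammaAt L mH v f (ξ - η) φ)) := by
  have hfin := lintegral_torusMajorant_ne_top hm hv hχ hfn φ
  have hmeas := measurable_torusMajorant_sub (L := L) (mH := mH) φ fun n => cutoff (χ n) f
  refine τ.tendsto_conjIntegral
    (F := fun n p => gammaAt L mH v (cutoff (χ n) f) (p.1 - p.2) φ)
    (F₀ := fun p => gammaAt L mH v f (p.1 - p.2) φ)
    (b := fun p => v⁻¹ * (torusMajorant L mH φ (fun n => cutoff (χ n) f) (p.1 - p.2)).toReal)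
    (fun n => ?_) ((integrable_toReal_of_lintegral_ne_top hmeas.aemeasurable hfin).const_mul _)
    (fun n => ?_) ?_
  · simp only [gammaAt_eq_orbitSum]
    exact continuous_const.mul ((continuous_orbitSum L _).comp continuous_sub)
  · filter_upwards [ae_lt_top hmeas hfin] with p hp
    obtain ⟨x, hx⟩ := QuotientAddGroup.mk_surjective (p.1 - p.2)
    rw [← hx] at hp ⊢
    have hle := gammaMajorant_le_torusMajorant (L := L) (mH := mH) (f := f) hχ φ x
    refine (norm_gammaAt_le hv (ne_top_of_le_ne_top hp.ne hle)
      (hχ.norm_cutoff_le f n)).trans ?_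
    exact mul_le_mul_of_nonneg_left (ENNReal.toReal_mono hp.ne hle) (inv_nonneg.2 hv.le)
  · filter_upwards [ae_gammaMajorant_ne_top hm hv hχ hfn φ] with p hp
    obtain ⟨x, hx⟩ := QuotientAddGroup.mk_surjective (p.1 - p.2)
    rw [← hx]
    exact tendsto_gammaAt hχ (hp x hx)

end Majorant

/-! ### The autocorrelation -/

section Autocorrelation

set_option linter.unusedSectionVars false

variable {G H : Type*} [AddCommGroup G] [TopologicalSpace G] [IsTopologicalAddGroup G] [T2Space G]
  [LocallyCompactSpace G] [SigmaCompactSpace G] [MeasurableSpace G] [BorelSpace G]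
  [AddCommGroup H] [TopologicalSpace H] [IsTopologicalAddGroup H] [T2Space H]
  [LocallyCompactSpace H] [SigmaCompactSpace H] [MeasurableSpace H] [BorelSpace H]
  {mG : Measure G} [mG.IsAddHaarMeasure] [mG.Regular] {mH : Measure H} [mH.IsAddHaarMeasure]
  {L : AddSubgroup (G × H)} [DiscreteTopology L] [CompactSpace ((G × H) ⧸ L)]
  {ρ : ComplexRadonMeasure (G × H)}
  {τ : ComplexRadonMeasure ((G × H) ⧸ L)} {v : ℝ} {m : @Measure ((G × H) ⧸ L) (borel _)}
  {χ : ℕ → C_c(H, ℝ)} {f : H → ℂ}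

/-- Modulo L, (s, l⋆) is equivalent to (s - l, 0), and the points (s, l⋆) are dense in G × H. -/
theorem denseRange_toTorus_fst (hL : Dense (Prod.snd '' (L : Set (G × H)))) :
    DenseRange fun t : G => toTorus L (t, 0) := by
  have hD : Dense ((Set.univ : Set G) ×ˢ (Prod.snd '' (L : Set (G × H)))) := dense_univ.prod hL
  refine (QuotientAddGroup.mk_surjective.denseRange.dense_image (continuous_toTorus L) hD).mono ?_
  rintro _ ⟨⟨s, _⟩, ⟨-, l, hl, rfl⟩, rfl⟩
  refine ⟨s - l.1, ?_⟩
  refine QuotientAddGroup.eq.2 ?_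
  have hl' : -(s - l.1, (0 : H)) + (s, l.2) = l := by ext <;> simp
  rw [hl']
  exact hl

theorem tendsto_integral_of_tendstoUniformly {T : Type*} [TopologicalSpace T] [CompactSpace T]
    [MeasurableSpace T] [BorelSpace T] (μ : Measure T) [IsFiniteMeasure μ] {F : ℕ → T → ℂ}
    {F₀ : T → ℂ} (hF : ∀ n, Continuous (F n)) (h : TendstoUniformly F F₀ atTop) :
    Tendsto (fun n => ∫ x, F n x ∂μ) atTop (𝓝 (∫ x, F₀ x ∂μ)) := by
  have hF₀ : Continuous F₀ := h.continuous (Frequently.of_forall hF)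
  refine tendsto_integral_filter_of_dominated_convergence (fun x => ‖F₀ x‖ + 1)
    (Eventually.of_forall fun n => (hF n).measurable.aestronglyMeasurable) ?_
    (Continuous.integrable_of_hasCompactSupport (by fun_prop)
      (HasCompactSupport.of_compactSpace _)) (ae_of_all _ fun x => h.tendsto_at x)
  filter_upwards [Metric.tendstoUniformly_iff.1 h 1 one_pos] with n hn
  refine ae_of_all _ fun x => ?_
  have h1 := hn x
  rw [dist_eq_norm, norm_sub_rev] at h1
  have h2 := norm_le_norm_add_norm_sub (F₀ x) (F n x)
  rw [norm_sub_rev] at h2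
  linarith

/-- Both sides are limits over the cutoffs, for which `integral_torusCorr` gives equality: the mean
converges by uniform convergence of the correlations, the double integral by domination. -/
theorem IsDisintegration.isAutocorrelation (hτ : IsDisintegration L ρ τ)
    (hL : Dense (Prod.snd '' (L : Set (G × H)))) (hm : IsTorusHaar mG mH L v m) (hv : 0 < v)
    (hfc : Continuous f) (hf : IsAdmissible ρ f) :
    IsAutocorrelation mG (weightedMeasure ρ f hf) fun φ =>
      τ.conjIntegral fun η => τ.integral fun ξ => gammaAt L mH v f (ξ - η) φ := by
  let _ : MeasurableSpace ((G × H) ⧸ L) := borel _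
  have : BorelSpace ((G × H) ⧸ L) := ⟨rfl⟩
  have := hm.isProbabilityMeasure
  have := hm.regular
  have hcl : IsClosed (L : Set (G × H)) := AddSubgroup.isClosed_of_discrete
  obtain ⟨χ, hχ⟩ := exists_isCutoffSeq H
  have hfn := hτ.isUniformApprox hfc hf hχ
  -- Any representatives do: the measure at ζ is the limit of `torusVal`, which depends only on ζ.
  -- In particular `out 0` need not be 0.
  obtain ⟨out, hout⟩ : ∃ out : (G × H) ⧸ L → G × H, ∀ ζ, toTorus L (out ζ) = ζ :=
    QuotientAddGroup.mk_surjective.hasRightInverse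
  let β : (G × H) ⧸ L → RadonFunctional G := fun ζ => shiftedMeasure hf (out ζ)
  have hβ : ∀ ζ φ, Tendsto (fun n => torusVal L τ φ (cutoff (χ n) ⟨f, hfc⟩) ζ) atTop
      (𝓝 (β ζ φ)) := fun ζ φ => by
    have := hτ.tendsto_shiftedMeasure hfc hf hχ (out ζ) φ
    rwa [hout] at this
  have hβ0 : β 0 = weightedMeasure ρ f hf := by
    rw [← shiftedMeasure_zero hf]
    refine RadonFunctional.ext fun φ => tendsto_nhds_unique (hβ 0 φ) ?_
    exact hτ.tendsto_shiftedMeasure hfc hf hχ 0 φ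
  rw [← hβ0]
  obtain ⟨mΩ, hinv, huniq, hInt⟩ := exists_unique_invariantProbability (hfn.continuous hβ)
    (denseRange_toTorus_fst hL) (apply_add_toTorus hβ) (mT := m) hm.integral_add_right
  refine ⟨mΩ, hinv, huniq, fun ψ hψ φ => ?_⟩
  have hunif := hfn.tendstoUniformly_correlation hβ φ ψ
  have hcont := continuous_torusCorr L τ φ ψ
  rw [hInt (fun ω => correlation ω φ ψ) (hunif.continuous (Frequently.of_forall fun n => hcont _))]
  refine tendsto_nhds_unique (tendsto_conjIntegral_gammaAt hm hv hχ hfn φ).2 ?_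
  have hlim := tendsto_integral_of_tendstoUniformly m (fun n => hcont _) hunif
  simpa only [integral_torusCorr L τ mH mG hm φ ψ hψ] using hlim

/-! ### The Dirac comb -/

theorem regular_dirac {T : Type*} [TopologicalSpace T] [T1Space T] [MeasurableSpace T]
    [BorelSpace T] (a : T) : (Measure.dirac a).Regular where
  outerRegular A hA r hr := by
    by_cases ha : a ∈ A
    · rw [Measure.dirac_apply_of_mem ha] at hr
      exact ⟨Set.univ, Set.subset_univ _, isOpen_univ, by simpa using hr⟩
    · refine ⟨{a}ᶜ, fun x hx h => ha (h ▸ hx), isOpen_compl_singleton, ?_⟩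
      rw [Measure.dirac_apply' _ (measurableSet_singleton a).compl]
      exact lt_of_le_of_lt (by simp) hr
  innerRegular U hU r hr := by
    by_cases ha : a ∈ U
    · refine ⟨{a}, Set.singleton_subset_iff.2 ha, isCompact_singleton, ?_⟩
      rw [Measure.dirac_apply_of_mem (Set.mem_singleton a)]
      rwa [Measure.dirac_apply_of_mem ha] at hr
    · rw [Measure.dirac_apply' _ hU.measurableSet] at hr
      simp [ha] at hr

/-- The unit point mass at `a`. -/
def ComplexRadonMeasure.dirac {T : Type*} [TopologicalSpace T] [T1Space T] (a : T) :
    ComplexRadonMeasure T where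
  variation := @Measure.dirac T (borel T) a
  regular := by
    let _ : MeasurableSpace T := borel T
    have : BorelSpace T := ⟨rfl⟩
    exact regular_dirac a
  phase _ := 1
  measurable_phase := @measurable_const _ _ _ (borel T) _
  norm_phase _ := norm_one

theorem ComplexRadonMeasure.integral_dirac {T : Type*} [TopologicalSpace T] [T1Space T] (a : T)
    (F : T → ℂ) : (ComplexRadonMeasure.dirac a).integral F = F a := by
  let _ : MeasurableSpace T := borel T
  have : BorelSpace T := ⟨rfl⟩
  refine (MeasureTheory.integral_dirac (fun x => F x * (1 : ℂ)) a).trans (mul_one _)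

theorem ComplexRadonMeasure.conjIntegral_dirac {T : Type*} [TopologicalSpace T] [T1Space T]
    (a : T) (F : T → ℂ) : (ComplexRadonMeasure.dirac a).conjIntegral F = F a := by
  rw [ComplexRadonMeasure.conjIntegral, ComplexRadonMeasure.integral_dirac, Complex.conj_conj]

theorem ComplexRadonMeasure.of_ae_prodVariation_dirac {T : Type*} [TopologicalSpace T] [T1Space T]
    {a : T} {P : T × T → Prop} (h : ∀ᵐ p ∂(ComplexRadonMeasure.dirac a).prodVariation, P p) :
    P (a, a) := by
  let _ : MeasurableSpace T := borel T
  have : BorelSpace T := ⟨rfl⟩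
  have h' : ∀ᵐ p ∂((Measure.dirac a).prod (Measure.dirac a)), P p := h
  rwa [Measure.dirac_prod_dirac, ae_dirac_eq] at h'

theorem IsDiracComb.isDisintegration [T1Space ((G × H) ⧸ L)] (hρ : IsDiracComb L ρ) :
    IsDisintegration L ρ (ComplexRadonMeasure.dirac 0) := fun g => by
  rw [hρ g, ComplexRadonMeasure.integral_dirac]
  have := orbitSum_mk L g 0
  simp only [zero_add] at this
  exact this.symm

/-- The integrand of (f ∗ f̃)(0) is |f|². -/
theorem memLp_two_of_selfConvExistsAt (hfc : Continuous f) (h : SelfConvExistsAt mH f 0) :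
    MemLp f 2 mH := by
  rw [memLp_two_iff_integrable_sq_norm hfc.measurable.aestronglyMeasurable]
  have := ((selfConvExistsAt_iff _ _).1 h).norm
  simpa [sq] using this

theorem selfConvExistsAt_of_memLp_two (hf : MemLp f 2 mH) (h : H) : SelfConvExistsAt mH f h := by
  rw [selfConvExistsAt_iff]
  exact (hf.comp_measurePreserving (measurePreserving_add_right mH h)).integrable_mul hf.star

end Autocorrelation

end CutProject

end

theorem mainTheorem3 {G H : Type*}
    [AddCommGroup G] [TopologicalSpace G] [IsTopologicalAddGroup G] [T2Space G]
    [LocallyCompactSpace G] [SigmaCompactSpace G] [MeasurableSpace G] [BorelSpace G]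
    [AddCommGroup H] [TopologicalSpace H] [IsTopologicalAddGroup H] [T2Space H]
    [LocallyCompactSpace H] [SigmaCompactSpace H] [MeasurableSpace H] [BorelSpace H]
    (mG : Measure G) [mG.IsAddHaarMeasure] [mG.Regular]
    (mH : Measure H) [mH.IsAddHaarMeasure] [mH.Regular]
    (L : AddSubgroup (G × H)) (hL : IsCutProjectScheme L)
    (ρ : ComplexRadonMeasure (G × H)) (hρL : IsInvariantUnder L ρ) (hρ : ρ.variation ≠ 0)
    (Z : Set (G × H)) (hZ : IsFundamentalCell L Z)
    (f : H → ℂ) (hfc : Continuous f) (hf : IsAdmissible ρ f) :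
    -- `f` is integrable and `f ∗ f̃` exists almost everywhere
    Integrable f mH ∧ (∀ᵐ h ∂mH, SelfConvExistsAt mH f h) ∧
    -- the measure `ρT` on `(G × H) / L` exists, and the autocorrelation is given by it
    (∃ ρT : ComplexRadonMeasure ((G × H) ⧸ L), IsDisintegration L ρ ρT) ∧
    (∀ ρT : ComplexRadonMeasure ((G × H) ⧸ L), IsDisintegration L ρ ρT →
      (∀ φ : C_c(G, ℂ),
        (∀ᵐ p ∂ρT.prodVariation, GammaExistsAt L mH f (p.1 - p.2) φ) ∧
        Integrable (fun p => gammaAt L mH ((mG.prod mH).real Z) f (p.1 - p.2) φ)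
          ρT.prodVariation) ∧
      IsAutocorrelation mG (weightedMeasure ρ f hf) fun φ =>
        ρT.conjIntegral fun η => ρT.integral fun ξ =>
          gammaAt L mH ((mG.prod mH).real Z) f (ξ - η) φ) ∧
    -- the case of the Dirac comb of `L`
    (IsDiracComb L ρ →
      MemLp f 2 mH ∧ (∀ h, SelfConvExistsAt mH f h) ∧
      (∀ φ : C_c(G, ℂ), GammaExistsAt L mH f 0 φ ∧
        gammaAt L mH ((mG.prod mH).real Z) f 0 φ =
          ((mG.prod mH).real Z : ℂ)⁻¹ * ∑' l : L, selfConv mH f (-l.1.2) * φ (-l.1.1)) ∧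
      IsAutocorrelation mG (weightedMeasure ρ f hf)
        (gammaAt L mH ((mG.prod mH).real Z) f 0)) := by
  have := hL.discrete
  have := hL.cocompact
  have hcl : IsClosed (L : Set (G × H)) := AddSubgroup.isClosed_of_discrete
  have hv := volume_cell_pos mG mH L hZ
  obtain ⟨m, hm⟩ := exists_isTorusHaar mG mH L hZ
  obtain ⟨χ, hχ⟩ := exists_isCutoffSeq H
  obtain ⟨ρ₀, hρ₀⟩ := exists_isDisintegration L hρL
  have hInt : Integrable f mH := IsUniformApprox.integrable (f := ⟨f, hfc⟩) hm hv
    (hρ₀.variation_ne_zero L hρ) hχ (hρ₀.isUniformApprox hfc hf hχ)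
  have hgen : ∀ ρT : ComplexRadonMeasure ((G × H) ⧸ L), IsDisintegration L ρ ρT →
      (∀ φ : C_c(G, ℂ),
        (∀ᵐ p ∂ρT.prodVariation, GammaExistsAt L mH f (p.1 - p.2) φ) ∧
        Integrable (fun p => gammaAt L mH ((mG.prod mH).real Z) f (p.1 - p.2) φ)
          ρT.prodVariation) ∧
      IsAutocorrelation mG (weightedMeasure ρ f hf) fun φ =>
        ρT.conjIntegral fun η => ρT.integral fun ξ =>
          gammaAt L mH ((mG.prod mH).real Z) f (ξ - η) φ := fun ρT hρT =>
    have hfn := hρT.isUniformApprox hfc hf hχ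
    ⟨fun φ => ⟨ae_gammaExistsAt hm hv hχ hfn φ,
      (tendsto_conjIntegral_gammaAt hm hv hχ hfn φ).1⟩,
      hρT.isAutocorrelation hL.dense_snd hm hv hfc hf⟩
  refine ⟨hInt, ae_selfConvExistsAt (f := ⟨f, hfc⟩) hχ hInt, ⟨ρ₀, hρ₀⟩, hgen, fun hδ => ?_⟩
  obtain ⟨hγ, hauto⟩ := hgen _ hδ.isDisintegration
  have hγ0 : ∀ φ : C_c(G, ℂ), GammaExistsAt L mH f 0 φ := fun φ => by
    have := ComplexRadonMeasure.of_ae_prodVariation_dirac (hγ φ).1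
    rwa [sub_zero] at this
  have hL2 : MemLp f 2 mH := by
    -- Even the test function φ = 0 suffices: `GammaExistsAt` includes existence of f ∗ f̃ at every
    -- h - l⋆, here with h = 0 and l = 0.
    have := ((hγ0 0) 0 rfl).1 0
    refine memLp_two_of_selfConvExistsAt hfc ?_
    simpa using this
  refine ⟨hL2, selfConvExistsAt_of_memLp_two hL2, fun φ => ⟨hγ0 φ, ?_⟩, ?_⟩
  · have := gammaAt_mk (L := L) (mH := mH) (v := (mG.prod mH).real Z) f 0 φ
    simpa using this
  · simpa only [ComplexRadonMeasure.conjIntegral_dirac, ComplexRadonMeasure.integral_dirac,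
      sub_zero] using hauto
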